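/- Write $e(x)=e^{2\pi i x}$, $q=e(\tau)$, $y=e(z)$ for $\tau\in\mathbb H$, $z\in\mathbb C$, let $\eta(\tau)=q^{1/24}\prod_{n\ge1}(1-q^n)$, and put $$\theta_1=-iq^{1/8}y^{1/2}\prod_{n\ge1}(1-q^n)(1-yq^n)(1-y^{-1}q^{n-1}),\qquad \theta_2=q^{1/8}y^{1/2}\prod_{n\ge1}(1-q^n)(1+yq^n)(1+y^{-1}q^{n-1}),$$ $$\theta_3=\prod_{n\ge1}(1-q^n)(1+yq^{n-1/2})(1+y^{-1}q^{n-1/2}),\qquad \theta_4=\prod_{n\ge1}(1-q^n)(1-yq^{n-1/2})(1-y^{-1}q^{n-1/2}),$$ $$\varphi_{0,1}(\tau,z)=4\sum_{i=2,3,4}\left(\frac{\theta_i(\tau,z)}{\theta_i(\tau,0)}\right)^2,\qquad \varphi_{-2,1}(\tau,z)=-\frac{\theta_1(\tau,z)^2}{\eta(\tau)^6}.$$ Let $M_{24}\subset S_{24}$ be the automorphism group of an extended binary Golay code (a self-dual doubly even binary linear code of length $24$ with no words of weight $4$). For $g\in M_{24}$ let $\chi(g)$ be the trace of $g$ in the permutation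 representation of degree $24$, let $n_g$ and $h_g$ be the lengths of the longest and of the shortest cycle of $g$ (fixed points are cycles of length $1$), and let $N_g$ be the level of $g$: the positive integer such that the multiset of cycle lengths of $g$ is invariant under $i\mapsto N_g/i$. Write $\eta_k=\eta(k\tau)$ and $\Lambda_N=N\,q\frac{d}{dq}\log\frac{\eta(N\tau)}{\eta(\tau)}$, and let $f_{23,1}=\eta_1^2\eta_{23}^2$ and $f_{23,2}=\frac{\eta_1^3\eta_{23}^3}{\eta_2\eta_{46}}+4\eta_1\eta_2\eta_{23}\eta_{46}+4\eta_2^2\eta_{46}^2$. Define $\tilde T_g$ by the cycle shape of $g$: $$\begin{array}{ll} 1^{24}: 0 & 1^82^8: 16\Lambda_2\\ 2^{12}: 2\eta_1^8/\eta_2^4 & 1^63^6: 6\Lambda_3\\ 3^8: 2\eta_1^6/\eta_3^2 & 2^44^4: 2\eta_2^8/\eta_4^4\\ 1^42^24^4: 4(-\Lambda_2+\Lambda_4) & 4^6: 2\eta_1^4\eta_2^2/\eta_4^2\\ 1^45^4: 2\Lambda_5 & 1^22^23^26^2: 2(-\Lambda_2-\Lambda_3+\Lambda_6)\\ 6^4: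 2\eta_1^2\eta_2^2\eta_3^2/\eta_6^2 & 1^37^3: \Lambda_7\\ 1^2 2\,4\,8^2: -\Lambda_4+\Lambda_8 & 2^210^2: 2\eta_1^3\eta_2\eta_5/\eta_{10}\\ 1^211^2: \tfrac25(\Lambda_{11}-11\eta_1^2\eta_{11}^2) & 2\,4\,6\,12: 2\eta_1^3\eta_4^2\eta_6^3/(\eta_2\eta_3\eta_{12}^2)\\ 12^2: 2\eta_1^4\eta_4\eta_6/(\eta_2\eta_{12}) & 1\,2\,7\,14: \tfrac13(-\Lambda_2-\Lambda_7+\Lambda_{14}-14\eta_1\eta_2\eta_7\eta_{14})\\ 1\,3\,5\,15: \tfrac14(-\Lambda_3-\Lambda_5+\Lambda_{15}-15\eta_1\eta_3\eta_5\eta_{15}) & 3\,21: \tfrac13\big(7\eta_1^3\eta_7^3/(\eta_3\eta_{21})-\eta_1^6/\eta_3^2\big)\\ 1\,23: \tfrac1{11}(\Lambda_{23}-23f_{23,1}+23f_{23,2}) & \end{array}$$ (these $21$ shapes are those of the elements of $M_{24}$; for any other permutation put $\tilde T_g=0$). A weak Jacobi form of weight $w$ and index $t$ for $\Gamma_0(N)$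 is a holomorphic function $\phi:\mathbb H\times\mathbb C\to\mathbb C$ such that $\phi=\phi|_{w,t}\gamma$ for all $\gamma\in\Gamma_0(N)$, where for $\gamma=\begin{pmatrix}a&b\\c&d\end{pmatrix}$ $$(\phi|_{w,t}\gamma)(\tau,z)=(c\tau+d)^{-w}\,e\!\left(-\tfrac{tcz^2}{c\tau+d}\right)\phi\!\left(\tfrac{a\tau+b}{c\tau+d},\tfrac{z}{c\tau+d}\right),$$ such that $\phi(\tau,z)=e(t(\lambda^2\tau+2\lambda z))\,\phi(\tau,z+\lambda\tau+\mu)$ for all $\lambda,\mu\in\mathbb Z$, and such that $\phi$ has a Fourier expansion $\sum_{n\ge0,\ell\in\mathbb Z}c(n,\ell)q^ny^\ell$ and, for every $\gamma\in SL_2(\mathbb Z)$, $\phi|_{w,t}\gamma$ has a Fourier expansion $\sum_{n\ge0,\ell\in\mathbb Z}c_\gamma(n,\ell)q^{n/M}y^\ell$ for some integer $M\ge1$. **Proposition.** For every $g\in M_{24}$, the function $$\mathcal Z_g(\tau,z)=\frac{\chi(g)}{12}\varphi_{0,1}(\tau,z)+\tilde T_g(\tau)\,\varphi_{-2,1}(\tau,z)$$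 is a weak Jacobi form of weight $0$ and index $1$ for $\Gamma_0(N_g)$. Moreover, for all $\gamma=\begin{pmatrix}a&b\\c&d\end{pmatrix}\in\Gamma_0(n_g)$, $\tau\in\mathbb H$ and $z\in\mathbb C$, $$\mathcal Z_g(\tau,z)=\rho_{n_g|h_g}(\gamma)\,e\!\left(-\frac{cz^2}{c\tau+d}\right)\mathcal Z_g\!\left(\frac{a\tau+b}{c\tau+d},\frac{z}{c\tau+d}\right),\qquad \rho_{n|h}(\gamma)=e\!\left(-\frac{cd}{nh}\right).$$ -/

import Mathlib

open UpperHalfPlane hiding I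
open Complex
open scoped Real MatrixGroups

namespace MathieuMoonshine

/-! ### The Mathieu group `M₂₄` and cycle shapes -/

/-- `C` is an extended binary Golay code: a self-dual, doubly even binary linear code of length
`24` without words of weight `4`. -/
structure IsGolayCode (C : Submodule (ZMod 2) (Fin 24 → ZMod 2)) : Prop where
  selfDual : ∀ v, v ∈ C ↔ ∀ w ∈ C, ∑ i, v i * w i = 0
  doublyEven : ∀ v ∈ C, 4 ∣ hammingNorm v
  no_weight_four : ∀ v ∈ C, hammingNorm v ≠ 4

/-- The group of permutations of the `24` coordinates that preserve the code `C`; for a Golay code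
this is the Mathieu group `M₂₄` in its defining permutation representation. -/
def mathieu24 (C : Submodule (ZMod 2) (Fin 24 → ZMod 2)) : Subgroup (Equiv.Perm (Fin 24)) where
  carrier := {g | ∀ v : Fin 24 → ZMod 2, v ∘ g ∈ C ↔ v ∈ C}
  one_mem' := fun _ => Iff.rfl
  mul_mem' := fun {a b} ha hb v => (hb (v ∘ a)).trans (ha v)
  inv_mem' := fun {a} ha v => by
    rw [← ha (v ∘ ⇑a⁻¹)]
    have : (v ∘ ⇑a⁻¹) ∘ ⇑a = v := by
      funext i
      simp
    rw [this]

/-- The cycle shape of `g`: the multiset of the lengths of all its cycles, fixed points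
included. -/
def cycleShape (g : Equiv.Perm (Fin 24)) : Multiset ℕ := g.partition.parts

/-- `n_g`: the length of the longest cycle. -/
def longest (g : Equiv.Perm (Fin 24)) : ℕ := (cycleShape g).sup

/-- `h_g`: the length of the shortest cycle. -/
noncomputable def shortest (g : Equiv.Perm (Fin 24)) : ℕ := sInf {i | i ∈ cycleShape g}

/-- The cycle shape of `g` is balanced of level `N`: it is mapped to itself by `i ↦ N / i`. -/
def IsBalanced (g : Equiv.Perm (Fin 24)) (N : ℕ) : Prop :=
  0 < N ∧ (∀ i ∈ cycleShape g, i ∣ N) ∧ (cycleShape g).map (fun i => N / i) = cycleShape g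

/-- `N_g`: the level of `g`, the positive integer for which its cycle shape is balanced. -/
noncomputable def level (g : Equiv.Perm (Fin 24)) : ℕ := sInf {N | IsBalanced g N}

/-- `χ(g)`: the trace of `g` in the `24`-dimensional permutation representation. -/
noncomputable def chi (g : Equiv.Perm (Fin 24)) : ℂ := Matrix.trace (g.permMatrix ℂ)

/-! ### Eta products, theta functions, and the basic forms -/

/-- `e(x) = exp(2πix)`. -/
noncomputable def e (x : ℂ) : ℂ := exp (2 * π * I * x)

/-- `η(kτ)`, with `η` the Dedekind eta function. -/
noncomputable def etaAt (k : ℕ) (τ : ℍ) : ℂ := ModularForm.eta (k * (τ : ℂ))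

/-- `Λ_N = N q d/dq log (η(Nτ) / η(τ))`, where `q d/dq = (2πi)⁻¹ d/dτ`. -/
noncomputable def Lam (N : ℕ) (τ : ℍ) : ℂ :=
  N * ((2 * π * I)⁻¹ *
    logDeriv (fun w : ℂ => ModularForm.eta (N * w) / ModularForm.eta w) (τ : ℂ))

/-- The second form of the chosen basis of newforms of level `23`. -/
noncomputable def f232 (τ : ℍ) : ℂ :=
  etaAt 1 τ ^ 3 * etaAt 23 τ ^ 3 / (etaAt 2 τ * etaAt 46 τ)
    + 4 * etaAt 1 τ * etaAt 2 τ * etaAt 23 τ * etaAt 46 τ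
    + 4 * etaAt 2 τ ^ 2 * etaAt 46 τ ^ 2

/-! The Jacobi theta functions, with `q = e(τ)`, `y = e(z)`; the product index is shifted to start
at `n = 0`. -/

noncomputable def theta1 (τ : ℍ) (z : ℂ) : ℂ :=
  -I * e (τ / 8) * e (z / 2) *
    ∏' n : ℕ, (1 - e τ ^ (n + 1)) * (1 - e z * e τ ^ (n + 1)) * (1 - (e z)⁻¹ * e τ ^ n)

noncomputable def theta2 (τ : ℍ) (z : ℂ) : ℂ :=
  e (τ / 8) * e (z / 2) *
    ∏' n : ℕ, (1 - e τ ^ (n + 1)) * (1 + e z * e τ ^ (n + 1)) * (1 + (e z)⁻¹ * e τ ^ n)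

noncomputable def theta3 (τ : ℍ) (z : ℂ) : ℂ :=
  ∏' n : ℕ, (1 - e τ ^ (n + 1)) * (1 + e z * e ((n + 1 / 2) * τ)) *
    (1 + (e z)⁻¹ * e ((n + 1 / 2) * τ))

noncomputable def theta4 (τ : ℍ) (z : ℂ) : ℂ :=
  ∏' n : ℕ, (1 - e τ ^ (n + 1)) * (1 - e z * e ((n + 1 / 2) * τ)) *
    (1 - (e z)⁻¹ * e ((n + 1 / 2) * τ))

/-- `φ_{0,1}`. -/
noncomputable def phi01 (τ : ℍ) (z : ℂ) : ℂ :=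
  4 * ((theta2 τ z / theta2 τ 0) ^ 2 + (theta3 τ z / theta3 τ 0) ^ 2
    + (theta4 τ z / theta4 τ 0) ^ 2)

/-- `φ_{-2,1}`. -/
noncomputable def phi21 (τ : ℍ) (z : ℂ) : ℂ := -(theta1 τ z ^ 2 / etaAt 1 τ ^ 6)

/-! ### The forms `T̃_g` and the twisted elliptic genera -/

/-- The shape `∏ iˡ`, given as the list of the pairs `(i, l)`. -/
def shape (s : List (ℕ × ℕ)) : Multiset ℕ := (s.map fun p => Multiset.replicate p.2 p.1).sum

/-- The weight two forms `T̃_g`, listed by the cycle shape of `g`. The 21 shapes listed (of the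
classes 1A, 2A, 2B, 3A, 3B, 4A, 4B, 4C, 5A, 6A, 6B, 7AB, 8A, 10A, 11A, 12A, 12B, 14AB, 15AB, 21AB,
23AB, in this order) are those of the elements of `M₂₄`; the last value, for permutations of any
other shape, is a placeholder. -/
noncomputable def tildeT (g : Equiv.Perm (Fin 24)) (τ : ℍ) : ℂ :=
  let H := fun k : ℕ => etaAt k τ
  let L := fun N : ℕ => Lam N τ
  if cycleShape g = shape [(1, 24)] then 0
  else if cycleShape g = shape [(1, 8), (2, 8)] then 16 * L 2
  else if cycleShape g = shape [(2, 12)] then 2 * H 1 ^ 8 / H 2 ^ 4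
  else if cycleShape g = shape [(1, 6), (3, 6)] then 6 * L 3
  else if cycleShape g = shape [(3, 8)] then 2 * H 1 ^ 6 / H 3 ^ 2
  else if cycleShape g = shape [(2, 4), (4, 4)] then 2 * H 2 ^ 8 / H 4 ^ 4
  else if cycleShape g = shape [(1, 4), (2, 2), (4, 4)] then 4 * (-L 2 + L 4)
  else if cycleShape g = shape [(4, 6)] then 2 * H 1 ^ 4 * H 2 ^ 2 / H 4 ^ 2
  else if cycleShape g = shape [(1, 4), (5, 4)] then 2 * L 5
  else if cycleShape g = shape [(1, 2), (2, 2), (3, 2), (6, 2)] then 2 * (-L 2 - L 3 + L 6)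
  else if cycleShape g = shape [(6, 4)] then 2 * H 1 ^ 2 * H 2 ^ 2 * H 3 ^ 2 / H 6 ^ 2
  else if cycleShape g = shape [(1, 3), (7, 3)] then L 7
  else if cycleShape g = shape [(1, 2), (2, 1), (4, 1), (8, 2)] then -L 4 + L 8
  else if cycleShape g = shape [(2, 2), (10, 2)] then 2 * H 1 ^ 3 * H 2 * H 5 / H 10
  else if cycleShape g = shape [(1, 2), (11, 2)] then 2 * (L 11 - 11 * H 1 ^ 2 * H 11 ^ 2) / 5
  else if cycleShape g = shape [(2, 1), (4, 1), (6, 1), (12, 1)] then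
    2 * H 1 ^ 3 * H 4 ^ 2 * H 6 ^ 3 / (H 2 * H 3 * H 12 ^ 2)
  else if cycleShape g = shape [(12, 2)] then 2 * H 1 ^ 4 * H 4 * H 6 / (H 2 * H 12)
  else if cycleShape g = shape [(1, 1), (2, 1), (7, 1), (14, 1)] then
    (-L 2 - L 7 + L 14 - 14 * H 1 * H 2 * H 7 * H 14) / 3
  else if cycleShape g = shape [(1, 1), (3, 1), (5, 1), (15, 1)] then
    (-L 3 - L 5 + L 15 - 15 * H 1 * H 3 * H 5 * H 15) / 4
  else if cycleShape g = shape [(3, 1), (21, 1)] then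
    (7 * H 1 ^ 3 * H 7 ^ 3 / (H 3 * H 21) - H 1 ^ 6 / H 3 ^ 2) / 3
  else if cycleShape g = shape [(1, 1), (23, 1)] then
    (L 23 - 23 * (H 1 ^ 2 * H 23 ^ 2) + 23 * f232 τ) / 11
  else 0

/-- The twisted elliptic genus `𝒵_g = (χ(g)/12) φ_{0,1} + T̃_g φ_{-2,1}`. -/
noncomputable def ellGenus (g : Equiv.Perm (Fin 24)) (τ : ℍ) (z : ℂ) : ℂ :=
  chi g / 12 * phi01 τ z + tildeT g τ * phi21 τ z

/-- `ρ_{n|h}(γ) = e(-cd/(nh))`. -/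
noncomputable def rho (n h : ℕ) (γ : SL(2, ℤ)) : ℂ := e (-((γ 1 0 : ℂ) * (γ 1 1 : ℂ) / (n * h)))

/-! ### Weak Jacobi forms for `Γ₀(N)` -/

/-- The weight `w`, index `t` action of `γ ∈ SL₂(ℤ)`:
`(cτ+d)^{-w} e(-t c z² / (cτ+d)) φ((aτ+b)/(cτ+d), z/(cτ+d))`. -/
noncomputable def jacobiSlash (w t : ℤ) (φ : ℍ → ℂ → ℂ) (γ : SL(2, ℤ)) (τ : ℍ) (z : ℂ) : ℂ :=
  ((γ 1 0 : ℂ) * τ + (γ 1 1 : ℂ)) ^ (-w) *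
    e (-(t * ((γ 1 0 : ℂ) * z ^ 2 / ((γ 1 0 : ℂ) * τ + (γ 1 1 : ℂ))))) *
    φ (γ • τ) (z / ((γ 1 0 : ℂ) * τ + (γ 1 1 : ℂ)))

/-- `φ` has an (absolutely convergent) Fourier expansion in integral powers of `q^{1/M}` and `y`
without negative powers of `q`. -/
def HasWeakFourierExpansion (M : ℕ) (φ : ℍ → ℂ → ℂ) : Prop :=
  ∃ c : ℕ × ℤ → ℂ, ∀ (τ : ℍ) (z : ℂ),
    HasSum (fun p : ℕ × ℤ => c p * e (p.1 * τ / M) * e (p.2 * z)) (φ τ z)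

/-- Weak Jacobi forms of weight `w` and index `t` for `Γ₀(N)`: holomorphic functions on `ℍ × ℂ`
with the modular and the elliptic transformation law, whose Fourier expansion has no negative
powers of `q`, also at the other cusps. -/
structure IsWeakJacobiForm (N : ℕ) (w t : ℤ) (φ : ℍ → ℂ → ℂ) : Prop where
  holo : DifferentiableOn ℂ (fun p : ℂ × ℂ => φ (ofComplex p.1) p.2) {p | 0 < p.1.im}
  modular : ∀ γ ∈ CongruenceSubgroup.Gamma0 N, ∀ (τ : ℍ) (z : ℂ), φ τ z = jacobiSlash w t φ γ τ z
  elliptic : ∀ (lam mu : ℤ) (τ : ℍ) (z : ℂ),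
    φ τ z = e (t * (lam ^ 2 * τ + 2 * lam * z)) * φ τ (z + lam * τ + mu)
  fourier : HasWeakFourierExpansion 1 φ
  cusps : ∀ γ : SL(2, ℤ), ∃ M : ℕ, 0 < M ∧ HasWeakFourierExpansion M (jacobiSlash w t φ γ)

end MathieuMoonshine

open MathieuMoonshine

/-!
The functions `φ_{0,1}` and `φ_{-2,1}` are weak Jacobi forms for the whole modular group: it is
enough to transform the theta functions under `S` and `T`, which the Jacobi triple product reduces
to Poisson summation. If `χ(g) ≠ 0` then `g` has a fixed point, so `h_g = 1` and the multiplier is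
trivial on `Γ₀(n_g)`; hence everything comes down to `T̃_g` being a holomorphic form of weight two
for `Γ₀(n_g)` with multiplier `e(cd / (n_g h_g))`.

For eta quotients this follows from Petersson's formula for the multiplier of `η` and from the
orders at the cusps; for `Λ_N` it follows from the transformation law of `E₂`. The exception is
`f_{23,2}`, which is visibly modular only for `Γ₀(46)`. The function
`x = η(2τ)η(46τ) / (η(τ)η(23τ))` has two further conjugates over `Γ₀(23)`. The three have product
`-1/4`, and sum `-1` because the sum is finite at the cusps and invariant under `Γ₀(23)` and the
Fricke involution. This identifies `f_{23,2}` with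
`2 η(τ)²η(23τ)² (x₁² + x₂² + x₃² - 1)`, which is `Γ₀(23)`-invariant of weight two.
-/

namespace MathieuMoonshine

open scoped ModularForm

/-! ### The Jacobi triple product -/

section TripleProduct

open Filter Topology

/-- The finite `q`-Pochhammer symbol `(q; q)_m = ∏_{k = 1}^m (1 - q ^ k)`. -/
noncomputable def qPochhammer (q : ℂ) (m : ℕ) : ℂ := ∏ k ∈ Finset.range m, (1 - q ^ (k + 1))

/-- `1 / (q; q)_m`, extended by zero to negative `m`: with this convention the coefficients of the
finite triple product satisfy their recursion for all integer indices. -/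
noncomputable def qPochhammerInv (q : ℂ) (m : ℤ) : ℂ :=
  if m < 0 then 0 else (qPochhammer q m.toNat)⁻¹

/-- The coefficient `(q; q)_{2N} / ((q; q)_{N - n} (q; q)_{N + n})`, a central `q`-binomial
coefficient, of the `N`-th finite triple product. -/
noncomputable def tripleProductCoeff (q : ℂ) (N : ℕ) (n : ℤ) : ℂ :=
  qPochhammer q (2 * N) * qPochhammerInv q (N - n) * qPochhammerInv q (N + n)

lemma qPochhammer_succ (q : ℂ) (m : ℕ) :
    qPochhammer q (m + 1) = qPochhammer q m * (1 - q ^ (m + 1)) :=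
  Finset.prod_range_succ _ _

lemma one_sub_pow_succ_ne_zero {q : ℂ} (hq : ‖q‖ < 1) (k : ℕ) : 1 - q ^ (k + 1) ≠ 0 := by
  intro h
  have hnorm : ‖q‖ ^ (k + 1) = 1 := by rw [← norm_pow, ← sub_eq_zero.1 h, norm_one]
  exact (pow_lt_one₀ (norm_nonneg _) hq k.succ_ne_zero).ne hnorm

lemma qPochhammerInv_of_neg (q : ℂ) {m : ℤ} (hm : m < 0) : qPochhammerInv q m = 0 := if_pos hm

lemma qPochhammerInv_natCast (q : ℂ) (m : ℕ) : qPochhammerInv q m = (qPochhammer q m)⁻¹ :=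
  if_neg (Int.natCast_nonneg m).not_gt

lemma qPochhammerInv_sub_one {q : ℂ} (hq : ‖q‖ < 1) (m : ℤ) :
    qPochhammerInv q (m - 1) = (1 - q ^ m) * qPochhammerInv q m := by
  rcases lt_trichotomy m 0 with hneg | rfl | hpos
  · rw [qPochhammerInv_of_neg q hneg, qPochhammerInv_of_neg q (by lia), mul_zero]
  · rw [qPochhammerInv_of_neg q (by lia), zpow_zero, sub_self, zero_mul]
  · obtain ⟨k, rfl⟩ : ∃ k : ℕ, m = (k + 1 : ℕ) := ⟨(m - 1).toNat, by lia⟩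
    rw [show ((k + 1 : ℕ) : ℤ) - 1 = k by lia, qPochhammerInv_natCast, qPochhammerInv_natCast,
      zpow_natCast, qPochhammer_succ, mul_inv, mul_comm (qPochhammer q k)⁻¹,
      mul_inv_cancel_left₀ (one_sub_pow_succ_ne_zero hq k)]

lemma tripleProductCoeff_zero_zero (q : ℂ) : tripleProductCoeff q 0 0 = 1 := by
  simp [tripleProductCoeff, qPochhammer, qPochhammerInv]

lemma tripleProductCoeff_zero_of_ne_zero (q : ℂ) {n : ℤ} (hn : n ≠ 0) :
    tripleProductCoeff q 0 n = 0 := by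
  rcases hn.lt_or_gt with h | h
  · rw [tripleProductCoeff, qPochhammerInv_of_neg q (m := (0 : ℕ) + n) (by lia), mul_zero]
  · rw [tripleProductCoeff, qPochhammerInv_of_neg q (m := (0 : ℕ) - n) (by lia), mul_zero, zero_mul]

lemma tripleProductCoeff_succ {q : ℂ} (hq : ‖q‖ < 1) (hq0 : q ≠ 0) (N : ℕ) (n : ℤ) :
    tripleProductCoeff q (N + 1) n = (1 + q ^ (2 * N + 1)) * tripleProductCoeff q N n
      + q ^ (N + 1 - n) * tripleProductCoeff q N (n - 1)
      + q ^ (N + 1 + n) * tripleProductCoeff q N (n + 1) := by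
  have hQ : qPochhammer q (2 * (N + 1)) =
      qPochhammer q (2 * N) * (1 - q ^ (2 * N + 1)) * (1 - q ^ (2 * N + 2)) := by
    rw [show 2 * (N + 1) = 2 * N + 1 + 1 by ring, qPochhammer_succ, qPochhammer_succ]
  have hαβ : q ^ ((N : ℤ) + 1 - n) * q ^ ((N : ℤ) + 1 + n) = q ^ (2 * N + 2) := by
    rw [← zpow_add₀ hq0, ← zpow_natCast]; congr 1; push_cast; ring
  have hodd : q ^ (2 * N + 1) = q ^ ((N : ℤ) + 1 - n) * q ^ ((N : ℤ) + 1 + n) / q := by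
    rw [hαβ, eq_div_iff hq0]; ring
  have hα : q ^ ((N : ℤ) - n) = q ^ ((N : ℤ) + 1 - n) / q := by
    rw [div_eq_mul_inv, ← zpow_sub_one₀ hq0]; congr 1; ring
  have hβ : q ^ ((N : ℤ) + n) = q ^ ((N : ℤ) + 1 + n) / q := by
    rw [div_eq_mul_inv, ← zpow_sub_one₀ hq0]; congr 1; ring
  have hα₁ : qPochhammerInv q (N - n) =
      (1 - q ^ ((N : ℤ) + 1 - n)) * qPochhammerInv q (N + 1 - n) := by
    rw [← qPochhammerInv_sub_one hq]; congr 1; ring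
  have hβ₁ : qPochhammerInv q (N + n) =
      (1 - q ^ ((N : ℤ) + 1 + n)) * qPochhammerInv q (N + 1 + n) := by
    rw [← qPochhammerInv_sub_one hq]; congr 1; ring
  have hα₂ := qPochhammerInv_sub_one hq (N - n)
  have hβ₂ := qPochhammerInv_sub_one hq (N + n)
  simp only [tripleProductCoeff, Nat.cast_add, Nat.cast_one,
    show (N : ℤ) - (n - 1) = N + 1 - n by ring, show (N : ℤ) + (n - 1) = N + n - 1 by ring,
    show (N : ℤ) - (n + 1) = N - n - 1 by ring, show (N : ℤ) + (n + 1) = N + 1 + n by ring]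
  rw [hα₂, hβ₂, hα₁, hβ₁, hQ, hα, hβ, hodd, ← hαβ]
  generalize q ^ ((N : ℤ) + 1 - n) = α
  generalize q ^ ((N : ℤ) + 1 + n) = β
  field_simp
  ring

lemma mul_zpow_sq_mul_zpow_sub_one {s y : ℂ} (hs : s ≠ 0) (hy : y ≠ 0) (N : ℕ) (n : ℤ) :
    s * (s ^ 2) ^ N * y * (s ^ ((n - 1) ^ 2) * y ^ (n - 1)) =
      (s ^ 2) ^ ((N : ℤ) + 1 - n) * (s ^ (n ^ 2) * y ^ n) := by
  have hpow : s * (s ^ 2) ^ N * s ^ ((n - 1) ^ 2) =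
      (s ^ 2) ^ ((N : ℤ) + 1 - n) * s ^ (n ^ 2) := by
    rw [← pow_mul, ← zpow_natCast, ← zpow_one_add₀ hs, ← zpow_add₀ hs, ← zpow_natCast s 2,
      ← zpow_mul, ← zpow_add₀ hs]
    congr 1; push_cast; ring
  rw [← mul_assoc ((s ^ 2) ^ _), ← hpow, zpow_sub_one₀ hy]
  field_simp

lemma mul_zpow_sq_mul_zpow_add_one {s y : ℂ} (hs : s ≠ 0) (hy : y ≠ 0) (N : ℕ) (n : ℤ) :
    s * (s ^ 2) ^ N * y⁻¹ * (s ^ ((n + 1) ^ 2) * y ^ (n + 1)) =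
      (s ^ 2) ^ ((N : ℤ) + 1 + n) * (s ^ (n ^ 2) * y ^ n) := by
  have h := mul_zpow_sq_mul_zpow_sub_one hs (inv_ne_zero hy) N (-n)
  rwa [← neg_add', neg_sq, neg_sq, inv_zpow', inv_zpow', neg_neg, neg_neg, sub_neg_eq_add] at h

lemma hasSum_finite_tripleProduct {s y : ℂ} (hs : ‖s‖ < 1) (hs0 : s ≠ 0) (hy : y ≠ 0) (N : ℕ) :
    HasSum (fun n : ℤ => tripleProductCoeff (s ^ 2) N n * (s ^ (n ^ 2) * y ^ n))
      (∏ k ∈ Finset.range N, (1 + y * (s * (s ^ 2) ^ k)) * (1 + y⁻¹ * (s * (s ^ 2) ^ k))) := by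
  induction N with
  | zero =>
    have h := hasSum_single (f := fun n : ℤ => tripleProductCoeff (s ^ 2) 0 n *
      (s ^ (n ^ 2) * y ^ n)) 0 fun n hn => by
        rw [tripleProductCoeff_zero_of_ne_zero _ hn, zero_mul]
    simpa [tripleProductCoeff_zero_zero] using h
  | succ N ih =>
    have hq : ‖s ^ 2‖ < 1 := norm_pow s 2 ▸ pow_lt_one₀ (norm_nonneg _) hs two_ne_zero
    have hdown := ((Equiv.subRight (1 : ℤ)).hasSum_iff.2 ih).mul_left (s * (s ^ 2) ^ N * y)
    have hup := ((Equiv.addRight (1 : ℤ)).hasSum_iff.2 ih).mul_left (s * (s ^ 2) ^ N * y⁻¹)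
    convert! ((ih.mul_left (1 + (s ^ 2) ^ (2 * N + 1))).add hdown).add hup using 1
    · funext n
      simp only [tripleProductCoeff_succ hq (pow_ne_zero 2 hs0), Function.comp,
        Equiv.subRight_apply, Equiv.coe_addRight]
      linear_combination
        -tripleProductCoeff (s ^ 2) N (n - 1) * mul_zpow_sq_mul_zpow_sub_one hs0 hy N n
          - tripleProductCoeff (s ^ 2) N (n + 1) * mul_zpow_sq_mul_zpow_add_one hs0 hy N n
    · rw [Finset.prod_range_succ]
      field_simp
      ring

lemma tendsto_qPochhammer {q : ℂ} (hq : ‖q‖ < 1) :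
    Tendsto (qPochhammer q) atTop (𝓝 (∏' n : ℕ, (1 - q ^ (n + 1)))) :=
  (ModularForm.multipliable_one_sub_pow hq).hasProd.tendsto_prod_nat

lemma tprod_one_sub_pow_ne_zero {q : ℂ} (hq : ‖q‖ < 1) : ∏' n : ℕ, (1 - q ^ (n + 1)) ≠ 0 := by
  simp_rw [sub_eq_add_neg]
  refine tprod_one_add_ne_zero_of_summable (fun n => ?_) ?_
  · rw [← sub_eq_add_neg]
    exact one_sub_pow_succ_ne_zero hq n
  · simpa using
      (summable_nat_add_iff 1).mpr (summable_geometric_of_lt_one (norm_nonneg _) hq)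

lemma tendsto_qPochhammerInv {q : ℂ} (hq : ‖q‖ < 1) :
    Tendsto (qPochhammerInv q) atTop (𝓝 (∏' n : ℕ, (1 - q ^ (n + 1)))⁻¹) := by
  have htoNat : Tendsto Int.toNat atTop atTop := tendsto_atTop.2 fun b => by
    filter_upwards [eventually_ge_atTop (b : ℤ)] with m hm
    lia
  refine (((tendsto_qPochhammer hq).comp htoNat).inv₀ (tprod_one_sub_pow_ne_zero hq)).congr' ?_
  filter_upwards [eventually_ge_atTop 0] with m hm
  exact (if_neg hm.not_gt).symm

lemma exists_norm_tripleProductCoeff_le {q : ℂ} (hq : ‖q‖ < 1) :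
    ∃ C, ∀ N n, ‖tripleProductCoeff q N n‖ ≤ C := by
  obtain ⟨A, hA⟩ := (tendsto_qPochhammer hq).norm.bddAbove_range
  obtain ⟨B, hB⟩ :=
    ((tendsto_qPochhammer hq).inv₀ (tprod_one_sub_pow_ne_zero hq)).norm.bddAbove_range
  have hA' (m : ℕ) : ‖qPochhammer q m‖ ≤ A := hA ⟨m, rfl⟩
  have hA0 : 0 ≤ A := (norm_nonneg _).trans (hA' 0)
  have hB0 : 0 ≤ B := (norm_nonneg _).trans (hB ⟨0, rfl⟩)
  have hB' (m : ℤ) : ‖qPochhammerInv q m‖ ≤ B := by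
    unfold qPochhammerInv
    split_ifs
    · simpa using hB0
    · exact hB ⟨_, rfl⟩
  refine ⟨A * B * B, fun N n => ?_⟩
  rw [tripleProductCoeff, norm_mul, norm_mul]
  gcongr
  exacts [hA' _, hB' _, hB' _]

lemma tendsto_tripleProductCoeff {q : ℂ} (hq : ‖q‖ < 1) (n : ℤ) :
    Tendsto (fun N => tripleProductCoeff q N n) atTop (𝓝 (∏' n : ℕ, (1 - q ^ (n + 1)))⁻¹) := by
  have hcast : Tendsto (fun N : ℕ => (N : ℤ)) atTop atTop := tendsto_natCast_atTop_atTop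
  have hnum := (tendsto_qPochhammer hq).comp (tendsto_id.const_mul_atTop' (two_pos : 0 < 2))
  have hsub := (tendsto_qPochhammerInv hq).comp (tendsto_atTop_add_const_right _ (-n) hcast)
  have hadd := (tendsto_qPochhammerInv hq).comp (tendsto_atTop_add_const_right _ n hcast)
  have hlim := (hnum.mul hsub).mul hadd
  rwa [mul_inv_cancel₀ (tprod_one_sub_pow_ne_zero hq), one_mul] at hlim

lemma summable_norm_mul_geometric {q : ℂ} (hq : ‖q‖ < 1) (u : ℂ) :
    Summable fun k : ℕ => ‖u * q ^ k‖ := by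
  simpa only [norm_mul, norm_pow] using
    (summable_geometric_of_lt_one (norm_nonneg q) hq).mul_left ‖u‖

theorem tsum_zpow_sq_mul_zpow_eq_tprod {s y : ℂ} (hs : ‖s‖ < 1) (hs0 : s ≠ 0) (hy : y ≠ 0)
    (hsum : Summable fun n : ℤ => s ^ (n ^ 2) * y ^ n) :
    ∑' n : ℤ, s ^ (n ^ 2) * y ^ n = ∏' n : ℕ, (1 - (s ^ 2) ^ (n + 1)) *
      (1 + y * (s * (s ^ 2) ^ n)) * (1 + y⁻¹ * (s * (s ^ 2) ^ n)) := by
  have hq : ‖s ^ 2‖ < 1 := norm_pow s 2 ▸ pow_lt_one₀ (norm_nonneg _) hs two_ne_zero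
  have hmul (u : ℂ) : Multipliable fun k : ℕ => 1 + u * (s * (s ^ 2) ^ k) := by
    simpa only [mul_assoc] using
      multipliable_one_add_of_summable (summable_norm_mul_geometric hq (u * s))
  obtain ⟨C, hC⟩ := exists_norm_tripleProductCoeff_le hq
  have hlim := tendsto_tsum_of_dominated_convergence (𝓕 := atTop)
    (f := fun N (n : ℤ) => tripleProductCoeff (s ^ 2) N n * (s ^ (n ^ 2) * y ^ n))
    (hsum.norm.mul_left C) (fun n => (tendsto_tripleProductCoeff hq n).mul_const _)
    (Eventually.of_forall fun N n => by rw [norm_mul]; gcongr; exact hC N n)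
  simp_rw [(hasSum_finite_tripleProduct hs hs0 hy _).tsum_eq, tsum_mul_left] at hlim
  have hprod := tendsto_nhds_unique hlim ((hmul y).mul (hmul y⁻¹)).hasProd.tendsto_prod_nat
  simp only [mul_assoc (1 - (s ^ 2) ^ _)]
  rw [(ModularForm.multipliable_one_sub_pow hq).tprod_mul ((hmul y).mul (hmul y⁻¹)), ← hprod,
    mul_inv_cancel_left₀ (tprod_one_sub_pow_ne_zero hq)]

lemma jacobiTheta₂_term_eq_zpow (n : ℤ) (z τ : ℂ) :
    jacobiTheta₂_term n z τ = cexp (π * I * τ) ^ (n ^ 2) * cexp (2 * π * I * z) ^ n := by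
  rw [jacobiTheta₂_term, ← exp_int_mul, ← exp_int_mul, ← Complex.exp_add]
  congr 1; push_cast; ring

theorem theta3_eq_jacobiTheta₂ (τ : ℍ) (z : ℂ) : theta3 τ z = jacobiTheta₂ z τ := by
  set s := cexp (π * I * τ) with hs
  set y := cexp (2 * π * I * z)
  have hs1 : ‖s‖ < 1 := by
    rw [hs, norm_exp, Real.exp_lt_one_iff]
    simpa using mul_pos Real.pi_pos τ.im_pos
  have hsum : Summable fun n : ℤ => s ^ (n ^ 2) * y ^ n := by
    simpa only [jacobiTheta₂_term_eq_zpow] using (summable_jacobiTheta₂_term_iff z τ).2 τ.im_pos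
  have hτ : e τ = s ^ 2 := by
    rw [e, hs, ← exp_nat_mul]; congr 1; push_cast; ring
  have hhalf (n : ℕ) : e ((n + 1 / 2) * τ) = s * (s ^ 2) ^ n := by
    rw [e, hs, ← exp_nat_mul, ← exp_nat_mul, ← Complex.exp_add]; congr 1; push_cast; ring
  calc theta3 τ z = ∏' n : ℕ, (1 - (s ^ 2) ^ (n + 1)) * (1 + y * (s * (s ^ 2) ^ n)) *
        (1 + y⁻¹ * (s * (s ^ 2) ^ n)) := by
        simp only [theta3, hhalf, hτ, show e z = y from rfl]
    _ = ∑' n : ℤ, s ^ (n ^ 2) * y ^ n :=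
        (tsum_zpow_sq_mul_zpow_eq_tprod hs1 (exp_ne_zero _) (exp_ne_zero _) hsum).symm
    _ = jacobiTheta₂ z τ := (tsum_congr fun n => jacobiTheta₂_term_eq_zpow n z τ).symm

end TripleProduct

/-! ### The exponential and the automorphy factor -/

lemma e_add (x y : ℂ) : e (x + y) = e x * e y := by
  rw [e, e, e, ← Complex.exp_add]; congr 1; ring

lemma e_ne_zero (x : ℂ) : e x ≠ 0 := exp_ne_zero _

lemma e_zero : e 0 = 1 := by simp [e]

lemma e_neg (x : ℂ) : e (-x) = (e x)⁻¹ := by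
  rw [e, e, ← Complex.exp_neg]; congr 1; ring

lemma e_intCast (n : ℤ) : e n = 1 := by
  rw [e, mul_comm, exp_int_mul_two_pi_mul_I]

lemma e_natCast_mul (n : ℕ) (x : ℂ) : e (n * x) = e x ^ n := by
  rw [e, e, ← exp_nat_mul]; congr 1; ring

lemma e_intCast_mul (n : ℤ) (x : ℂ) : e (n * x) = e x ^ n := by
  rw [e, e, ← exp_int_mul]; congr 1; ring

lemma e_half : e (1 / 2) = -1 := by
  rw [e, ← exp_pi_mul_I]; congr 1; ring

lemma e_quarter : e (1 / 4) = I := by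
  rw [e, show 2 * π * I * (1 / 4) = π / 2 * I by ring, exp_pi_div_two_mul_I]

lemma norm_e (x : ℂ) : ‖e x‖ = Real.exp (-2 * π * x.im) := by
  rw [e, norm_exp]; congr 1; simp

lemma norm_e_lt_one {x : ℂ} (hx : 0 < x.im) : ‖e x‖ < 1 := by
  rw [norm_e, Real.exp_lt_one_iff, mul_assoc, neg_mul, neg_lt_zero]
  positivity

lemma differentiable_e : Differentiable ℂ e := by
  unfold e; fun_prop

lemma denom_T (τ : ℍ) : denom ModularGroup.T τ = 1 := by
  rw [ModularGroup.denom_apply]; simp [ModularGroup.T]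

lemma denom_mul (γ γ' : SL(2, ℤ)) (τ : ℍ) :
    denom (γ * γ' : SL(2, ℤ)) τ = denom γ (γ' • τ : ℍ) * denom γ' τ := by
  rw [map_mul, map_mul, denom_cocycle_σ, ModularGroup.sl_moeb]
  simp [σ]

lemma coe_smul_eq_div_denom (γ : SL(2, ℤ)) (τ : ℍ) :
    ((γ • τ : ℍ) : ℂ) = ((γ 0 0 : ℂ) * τ + (γ 0 1 : ℂ)) / denom γ τ := by
  rw [coe_specialLinearGroup_apply, ModularGroup.denom_apply]; simp

lemma coe_S_smul (τ : ℍ) : ((ModularGroup.S • τ : ℍ) : ℂ) = -1 / τ := by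
  rw [coe_smul_eq_div_denom, ModularGroup.denom_S]; simp [ModularGroup.S]

lemma coe_T_smul (τ : ℍ) : ((ModularGroup.T • τ : ℍ) : ℂ) = τ + 1 := by
  rw [coe_smul_eq_div_denom, denom_T]; simp [ModularGroup.T]

lemma coe_det_eq_one (γ : SL(2, ℤ)) :
    (γ 0 0 : ℂ) * (γ 1 1 : ℂ) - (γ 0 1 : ℂ) * (γ 1 0 : ℂ) = 1 := by
  have h := γ.det_coe
  rw [Matrix.det_fin_two] at h
  exact_mod_cast h

/-! ### The action of `SL₂(ℤ)` on functions of `(τ, z)` -/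

lemma jacobiSlash_apply (w t : ℤ) (φ : ℍ → ℂ → ℂ) (γ : SL(2, ℤ)) (τ : ℍ) (z : ℂ) :
    jacobiSlash w t φ γ τ z = denom γ τ ^ (-w) *
      e (-(t * ((γ 1 0 : ℂ) * z ^ 2 / denom γ τ))) * φ (γ • τ) (z / denom γ τ) := rfl

lemma jacobiSlash_S (w t : ℤ) (φ : ℍ → ℂ → ℂ) (τ : ℍ) (z : ℂ) :
    jacobiSlash w t φ ModularGroup.S τ z =
      (τ : ℂ) ^ (-w) * e (-(t * (z ^ 2 / τ))) * φ (ModularGroup.S • τ) (z / τ) := by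
  rw [jacobiSlash_apply, ModularGroup.denom_S]; simp [ModularGroup.S]

lemma jacobiSlash_T (w t : ℤ) (φ : ℍ → ℂ → ℂ) (τ : ℍ) (z : ℂ) :
    jacobiSlash w t φ ModularGroup.T τ z = φ (ModularGroup.T • τ) z := by
  rw [jacobiSlash_apply, denom_T]; simp [ModularGroup.T, e_zero]

lemma jacobiSlash_one (w t : ℤ) (φ : ℍ → ℂ → ℂ) : jacobiSlash w t φ 1 = φ := by
  funext τ z
  simp [jacobiSlash_apply, e_zero]

lemma mul_sq_div_denom_mul (γ γ' : SL(2, ℤ)) (τ : ℍ) (z : ℂ) :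
    ((γ * γ') 1 0 : ℂ) * z ^ 2 / denom (γ * γ' : SL(2, ℤ)) τ =
      (γ' 1 0 : ℂ) * z ^ 2 / denom γ' τ +
        (γ 1 0 : ℂ) * (z / denom γ' τ) ^ 2 / denom γ (γ' • τ : ℍ) := by
  have h := denom_ne_zero γ' τ
  have h' := denom_ne_zero γ (γ' • τ)
  have hrow : (((γ * γ') 1 0 : ℤ) : ℂ) =
      (γ 1 0 : ℂ) * (γ' 0 0 : ℂ) + (γ 1 1 : ℂ) * (γ' 1 0 : ℂ) := by
    simp [Matrix.mul_apply, Fin.sum_univ_two]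
  have hcocycle : denom γ (γ' • τ : ℍ) * denom γ' τ =
      (γ 1 0 : ℂ) * ((γ' 0 0 : ℂ) * τ + (γ' 0 1 : ℂ)) + (γ 1 1 : ℂ) * denom γ' τ := by
    rw [ModularGroup.denom_apply γ, coe_smul_eq_div_denom]; field_simp
  have hnum : (((γ * γ') 1 0 : ℤ) : ℂ) * denom γ' τ =
      (γ' 1 0 : ℂ) * (denom γ (γ' • τ : ℍ) * denom γ' τ) + (γ 1 0 : ℂ) := by
    rw [hcocycle, hrow]
    simp only [ModularGroup.denom_apply]
    linear_combination (γ 1 0 : ℂ) * coe_det_eq_one γ'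
  rw [denom_mul]
  field_simp
  linear_combination z ^ 2 * hnum

lemma jacobiSlash_mul (w t : ℤ) (φ : ℍ → ℂ → ℂ) (γ γ' : SL(2, ℤ)) :
    jacobiSlash w t φ (γ * γ') = jacobiSlash w t (jacobiSlash w t φ γ) γ' := by
  funext τ z
  simp only [jacobiSlash_apply]
  rw [mul_sq_div_denom_mul, mul_add, neg_add, e_add, denom_mul, mul_zpow, mul_smul, div_div,
    mul_comm (denom γ' τ)]
  ring

lemma jacobiSlash_eq_of_generators {w t : ℤ} {φ : ℍ → ℂ → ℂ}
    (hS : jacobiSlash w t φ ModularGroup.S = φ) (hT : jacobiSlash w t φ ModularGroup.T = φ)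
    (γ : SL(2, ℤ)) : jacobiSlash w t φ γ = φ := by
  have hγ : γ ∈ Subgroup.closure {ModularGroup.S, ModularGroup.T} := by
    simp [SpecialLinearGroup.SL2Z_generators]
  induction hγ using Subgroup.closure_induction with
  | mem x hx => rcases hx with rfl | rfl <;> assumption
  | one => exact jacobiSlash_one w t φ
  | mul x y _ _ hx hy => rw [jacobiSlash_mul, hx, hy]
  | inv x _ hx =>
    conv_lhs => rw [← hx]
    rw [← jacobiSlash_mul, mul_inv_cancel, jacobiSlash_one]

/-! ### The theta functions -/

lemma e_half_add_mul (τ : ℂ) (n : ℕ) : e ((n + 1 / 2) * τ) = e (τ / 2) * e τ ^ n := by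
  rw [← e_natCast_mul, ← e_add]; congr 1; ring

lemma theta4_eq_theta3 (τ : ℍ) (z : ℂ) : theta4 τ z = theta3 τ (z + 1 / 2) := by
  simp only [theta3, theta4, e_add, e_half, mul_neg, mul_one, neg_mul, inv_neg, sub_eq_add_neg]

lemma theta2_eq_theta3 (τ : ℍ) (z : ℂ) :
    theta2 τ z = e (τ / 8) * e (z / 2) * theta3 τ (z + τ / 2) := by
  rw [theta3, theta2]
  congr 1
  refine tprod_congr fun n => ?_
  have hpos : e (z + τ / 2) * e ((n + 1 / 2) * τ) = e z * e τ ^ (n + 1) := by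
    rw [← e_natCast_mul, ← e_add, ← e_add]; congr 1; push_cast; ring
  have hneg : (e (z + τ / 2))⁻¹ * e ((n + 1 / 2) * τ) = (e z)⁻¹ * e τ ^ n := by
    rw [← e_natCast_mul, ← e_neg, ← e_neg, ← e_add, ← e_add]; congr 1; ring
  rw [hpos, hneg]

lemma theta1_eq_theta2 (τ : ℍ) (z : ℂ) : theta1 τ z = -theta2 τ (z + 1 / 2) := by
  rw [theta1, theta2, add_div, show (1 / 2 / 2 : ℂ) = 1 / 4 by norm_num, e_add, e_add, e_half,
    e_quarter]
  simp only [mul_neg, mul_one, neg_mul, inv_neg, sub_eq_add_neg]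
  ring

lemma jacobiTheta₂_add_right_one (z τ : ℂ) :
    jacobiTheta₂ z (τ + 1) = jacobiTheta₂ (z + 1 / 2) τ := by
  refine tsum_congr fun n => ?_
  obtain ⟨k, hk⟩ : Even (n ^ 2 - n) := by
    rw [show n ^ 2 - n = n * (n - 1) by ring]; exact Int.even_mul_pred_self n
  have hk' : (n : ℂ) ^ 2 = n + 2 * k := by
    exact_mod_cast (by omega : n ^ 2 = n + 2 * k)
  rw [jacobiTheta₂_term, jacobiTheta₂_term, exp_eq_exp_iff_exists_int]
  exact ⟨k, by linear_combination π * I * hk'⟩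

lemma jacobiTheta₂_add_mul_add (lam mu : ℤ) (z τ : ℂ) :
    jacobiTheta₂ (z + lam * τ + mu) τ = e (-(lam ^ 2 * τ / 2 + lam * z)) * jacobiTheta₂ z τ := by
  conv_rhs => rw [jacobiTheta₂, ← tsum_mul_left, ← (Equiv.addRight lam).tsum_eq]
  refine tsum_congr fun n => ?_
  simp only [jacobiTheta₂_term, Equiv.coe_addRight, e]
  rw [← Complex.exp_add, exp_eq_exp_iff_exists_int]
  exact ⟨n * mu, by push_cast; ring⟩

lemma sqrt_sq (x : ℂ) : Complex.sqrt x ^ 2 = x := by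
  simpa only [Nat.cast_ofNat, Complex.sqrt] using cpow_nat_inv_pow x two_ne_zero

lemma jacobiTheta₂_div_neg_one_div_sq (z : ℂ) (τ : ℍ) :
    jacobiTheta₂ (z / τ) (-1 / τ) ^ 2 = -I * τ * e (z ^ 2 / τ) * jacobiTheta₂ z τ ^ 2 := by
  have hτ := τ.ne_zero
  have hI := I_ne_zero
  have hroot : ((-I * (τ : ℂ)) ^ (1 / 2 : ℂ)) ^ 2 = -I * τ := by
    simpa only [Complex.sqrt, one_div] using sqrt_sq (-I * (τ : ℂ))
  have hexp : cexp (-π * I * z ^ 2 / τ) ^ 2 * e (z ^ 2 / τ) = 1 := by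
    rw [e, ← exp_nat_mul, ← Complex.exp_add, ← Complex.exp_zero]; congr 1; push_cast; ring
  rw [jacobiTheta₂_functional_equation z τ, mul_pow, mul_pow, div_pow, hroot, one_pow]
  generalize jacobiTheta₂ (z / τ) (-1 / τ) = A
  calc A ^ 2 = A ^ 2 * (cexp (-π * I * z ^ 2 / τ) ^ 2 * e (z ^ 2 / τ)) := by rw [hexp, mul_one]
    _ = _ := by field

lemma theta3_add_mul_add (lam mu : ℤ) (τ : ℍ) (z : ℂ) :
    theta3 τ (z + lam * τ + mu) = e (-(lam ^ 2 * τ / 2 + lam * z)) * theta3 τ z := by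
  simp only [theta3_eq_jacobiTheta₂, jacobiTheta₂_add_mul_add]

lemma theta3_add_one (τ : ℍ) (z : ℂ) : theta3 τ (z + 1) = theta3 τ z := by
  simp only [theta3_eq_jacobiTheta₂, jacobiTheta₂_add_left]

lemma theta3_S_sq (τ : ℍ) (z : ℂ) : theta3 (ModularGroup.S • τ) (z / τ) ^ 2 =
    -I * τ * e (z ^ 2 / τ) * theta3 τ z ^ 2 := by
  rw [theta3_eq_jacobiTheta₂, theta3_eq_jacobiTheta₂, coe_S_smul, jacobiTheta₂_div_neg_one_div_sq]

lemma theta4_S_sq (τ : ℍ) (z : ℂ) : theta4 (ModularGroup.S • τ) (z / τ) ^ 2 =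
    -I * τ * e (z ^ 2 / τ) * theta2 τ z ^ 2 := by
  have hτ := τ.ne_zero
  have hexp : e ((z + τ / 2) ^ 2 / τ) = e (z ^ 2 / τ) * (e (τ / 8) * e (z / 2)) ^ 2 := by
    rw [← e_add, ← e_natCast_mul, ← e_add]; congr 1; push_cast; field_simp; ring
  rw [theta4_eq_theta3, theta2_eq_theta3, show z / (τ : ℂ) + 1 / 2 = (z + τ / 2) / τ by field_simp,
    theta3_S_sq, hexp]
  ring

lemma theta2_S_sq (τ : ℍ) (z : ℂ) : theta2 (ModularGroup.S • τ) (z / τ) ^ 2 =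
    -I * τ * e (z ^ 2 / τ) * theta4 τ z ^ 2 := by
  have hτ := τ.ne_zero
  have hexp : (e (-1 / τ / 8) * e (z / τ / 2)) ^ 2 * e ((z - 1 / 2) ^ 2 / τ) = e (z ^ 2 / τ) := by
    rw [← e_add, ← e_natCast_mul, ← e_add]; congr 1; push_cast; field_simp; ring
  rw [theta4_eq_theta3, theta2_eq_theta3, coe_S_smul, mul_pow,
    show z / (τ : ℂ) + -1 / τ / 2 = (z - 1 / 2) / τ by field_simp; ring, theta3_S_sq,
    ← theta3_add_one τ (z - 1 / 2), show z - 1 / 2 + 1 = z + 1 / 2 by ring]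
  linear_combination -I * τ * theta3 τ (z + 1 / 2) ^ 2 * hexp

lemma theta1_S_sq (τ : ℍ) (z : ℂ) : theta1 (ModularGroup.S • τ) (z / τ) ^ 2 =
    I * τ * e (z ^ 2 / τ) * theta1 τ z ^ 2 := by
  have hτ := τ.ne_zero
  have hexp : e ((z + τ / 2) ^ 2 / τ) =
      -(e (z ^ 2 / τ) * (e (τ / 8) * e ((z + 1 / 2) / 2)) ^ 2) := by
    rw [neg_eq_neg_one_mul, ← inv_neg_one, ← e_half, ← e_neg, ← e_add, ← e_natCast_mul, ← e_add,
      ← e_add]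
    congr 1; push_cast; field_simp; ring
  rw [theta1_eq_theta2, theta1_eq_theta2, show z / (τ : ℂ) + 1 / 2 = (z + τ / 2) / τ by field_simp,
    neg_sq, neg_sq, theta2_S_sq, theta4_eq_theta3, theta2_eq_theta3, hexp,
    show z + τ / 2 + 1 / 2 = z + 1 / 2 + (τ : ℂ) / 2 by ring]
  ring

lemma theta3_T (τ : ℍ) (z : ℂ) : theta3 (ModularGroup.T • τ) z = theta4 τ z := by
  rw [theta4_eq_theta3, theta3_eq_jacobiTheta₂, theta3_eq_jacobiTheta₂, coe_T_smul,
    jacobiTheta₂_add_right_one]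

lemma theta4_T (τ : ℍ) (z : ℂ) : theta4 (ModularGroup.T • τ) z = theta3 τ z := by
  rw [theta4_eq_theta3, theta3_T, theta4_eq_theta3, ← theta3_add_one τ z]
  congr 1; ring

lemma theta2_T (τ : ℍ) (z : ℂ) : theta2 (ModularGroup.T • τ) z = e (1 / 8) * theta2 τ z := by
  rw [theta2_eq_theta3, theta2_eq_theta3, theta3_T, theta4_eq_theta3, coe_T_smul,
    show z + (τ + 1) / 2 + 1 / 2 = z + (τ : ℂ) / 2 + 1 by ring, theta3_add_one, add_div, e_add]
  ring

lemma theta1_T (τ : ℍ) (z : ℂ) : theta1 (ModularGroup.T • τ) z = e (1 / 8) * theta1 τ z := by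
  rw [theta1_eq_theta2, theta1_eq_theta2, theta2_T, mul_neg]

lemma theta3_add_mul_add_sq (lam mu : ℤ) (τ : ℍ) (z : ℂ) :
    theta3 τ (z + lam * τ + mu) ^ 2 = e (-(lam ^ 2 * τ + 2 * lam * z)) * theta3 τ z ^ 2 := by
  rw [theta3_add_mul_add, mul_pow, ← e_natCast_mul]
  congr 2; push_cast; ring

lemma e_elliptic_add_half (lam : ℤ) (τ z : ℂ) :
    e (-(lam ^ 2 * τ + 2 * lam * (z + 1 / 2))) = e (-(lam ^ 2 * τ + 2 * lam * z)) := by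
  rw [show -(lam ^ 2 * τ + 2 * lam * (z + 1 / 2)) =
    -(lam ^ 2 * τ + 2 * lam * z) + ((-lam : ℤ) : ℂ) by push_cast; ring, e_add, e_intCast, mul_one]

lemma theta4_add_mul_add_sq (lam mu : ℤ) (τ : ℍ) (z : ℂ) :
    theta4 τ (z + lam * τ + mu) ^ 2 = e (-(lam ^ 2 * τ + 2 * lam * z)) * theta4 τ z ^ 2 := by
  rw [theta4_eq_theta3, theta4_eq_theta3, ← e_elliptic_add_half, ← theta3_add_mul_add_sq lam mu]
  congr 2; ring

lemma theta2_add_mul_add_sq (lam mu : ℤ) (τ : ℍ) (z : ℂ) :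
    theta2 τ (z + lam * τ + mu) ^ 2 = e (-(lam ^ 2 * τ + 2 * lam * z)) * theta2 τ z ^ 2 := by
  have hexp : e ((z + lam * τ + mu) / 2) ^ 2 * e (-(lam ^ 2 * τ + 2 * lam * (z + τ / 2))) =
      e (-(lam ^ 2 * τ + 2 * lam * z)) * e (z / 2) ^ 2 := by
    rw [← e_natCast_mul, ← e_natCast_mul, ← e_add, ← e_add, ← mul_one (e (_ + _ * (z / 2))),
      ← e_intCast mu, ← e_add]
    congr 1; push_cast; ring
  rw [theta2_eq_theta3, theta2_eq_theta3, mul_pow,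
    show z + lam * τ + mu + τ / 2 = z + τ / 2 + lam * (τ : ℂ) + mu by ring, theta3_add_mul_add_sq]
  linear_combination e (τ / 8) ^ 2 * theta3 τ (z + τ / 2) ^ 2 * hexp

lemma theta1_add_mul_add_sq (lam mu : ℤ) (τ : ℍ) (z : ℂ) :
    theta1 τ (z + lam * τ + mu) ^ 2 = e (-(lam ^ 2 * τ + 2 * lam * z)) * theta1 τ z ^ 2 := by
  rw [theta1_eq_theta2, theta1_eq_theta2, neg_sq, neg_sq, ← e_elliptic_add_half,
    ← theta2_add_mul_add_sq lam mu]
  congr 2; ring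

lemma tprod_mul_one_add_mul_one_add_ne_zero {q : ℂ} (hq : ‖q‖ < 1) {a b : ℂ}
    (ha : ∀ n : ℕ, 1 + a * q ^ n ≠ 0) (hb : ∀ n : ℕ, 1 + b * q ^ n ≠ 0) :
    ∏' n : ℕ, (1 - q ^ (n + 1)) * (1 + a * q ^ n) * (1 + b * q ^ n) ≠ 0 := by
  have hsum := summable_norm_mul_geometric hq
  have hmul (u : ℂ) := multipliable_one_add_of_summable (hsum u)
  have hq' := ModularForm.multipliable_one_sub_pow hq
  rw [(hq'.mul (hmul a)).tprod_mul (hmul b), hq'.tprod_mul (hmul a)]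
  exact mul_ne_zero (mul_ne_zero (tprod_one_sub_pow_ne_zero hq)
    (tprod_one_add_ne_zero_of_summable ha (hsum a))) (tprod_one_add_ne_zero_of_summable hb (hsum b))

lemma one_add_ne_zero_of_norm_lt_one {x : ℂ} (hx : ‖x‖ < 1) : 1 + x ≠ 0 := by
  intro h
  rw [eq_neg_of_add_eq_zero_right h, norm_neg, norm_one] at hx
  exact hx.false

lemma norm_e_coe_lt_one (τ : ℍ) : ‖e τ‖ < 1 := norm_e_lt_one τ.im_pos

lemma norm_e_half_mul_pow_lt_one (τ : ℍ) (n : ℕ) : ‖e (τ / 2) * e τ ^ n‖ < 1 := by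
  rw [← e_half_add_mul]
  refine norm_e_lt_one ?_
  have : ((n + 1 / 2) * (τ : ℂ)).im = (n + 1 / 2) * τ.im := by simp
  rw [this]
  exact mul_pos (by positivity) τ.im_pos

lemma theta3_zero_ne_zero (τ : ℍ) : theta3 τ 0 ≠ 0 := by
  have h (n : ℕ) := one_add_ne_zero_of_norm_lt_one (norm_e_half_mul_pow_lt_one τ n)
  simpa only [theta3, e_zero, inv_one, one_mul, e_half_add_mul] using
    tprod_mul_one_add_mul_one_add_ne_zero (norm_e_coe_lt_one τ) h h

lemma theta4_zero_ne_zero (τ : ℍ) : theta4 τ 0 ≠ 0 := by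
  have h (n : ℕ) : 1 + (-e (τ / 2)) * e τ ^ n ≠ 0 :=
    one_add_ne_zero_of_norm_lt_one (by simpa using norm_e_half_mul_pow_lt_one τ n)
  simpa only [theta4, e_zero, inv_one, one_mul, e_half_add_mul, sub_eq_add_neg, neg_mul] using
    tprod_mul_one_add_mul_one_add_ne_zero (norm_e_coe_lt_one τ) h h

lemma theta2_zero_ne_zero (τ : ℍ) : theta2 τ 0 ≠ 0 := by
  have hq := norm_e_coe_lt_one τ
  have hpos (n : ℕ) : 1 + e τ * e τ ^ n ≠ 0 := one_add_ne_zero_of_norm_lt_one <| by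
    rw [← pow_succ', norm_pow]
    exact pow_lt_one₀ (norm_nonneg _) hq n.succ_ne_zero
  have hneg : ∀ n : ℕ, 1 + 1 * e τ ^ n ≠ 0
    | 0 => by norm_num
    | n + 1 => by rw [one_mul, pow_succ']; exact hpos n
  rw [theta2]
  refine mul_ne_zero (mul_ne_zero (e_ne_zero _) (e_ne_zero _)) ?_
  simpa only [e_zero, inv_one, one_mul, ← pow_succ'] using
    tprod_mul_one_add_mul_one_add_ne_zero hq hpos hneg

section Holomorphy

variable {L : ℂ × ℂ → ℂ}

lemma differentiableOn_theta3 (hL : Differentiable ℂ L) :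
    DifferentiableOn ℂ (fun p : ℂ × ℂ => theta3 (ofComplex p.1) (L p)) {p | 0 < p.1.im} := by
  refine DifferentiableOn.congr (f := fun p : ℂ × ℂ => jacobiTheta₂ (L p) p.1) (fun p hp => ?_)
    fun p hp => by rw [theta3_eq_jacobiTheta₂, ofComplex_apply_of_im_pos hp]
  exact ((hasFDerivAt_jacobiTheta₂ (L p) hp).differentiableAt.comp
    (f := fun p : ℂ × ℂ => (L p, p.1)) p (by fun_prop)).differentiableWithinAt

lemma differentiableOn_theta4 (hL : Differentiable ℂ L) :
    DifferentiableOn ℂ (fun p : ℂ × ℂ => theta4 (ofComplex p.1) (L p)) {p | 0 < p.1.im} := by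
  simp only [theta4_eq_theta3]
  exact differentiableOn_theta3 (by fun_prop)

lemma differentiableOn_theta2 (hL : Differentiable ℂ L) :
    DifferentiableOn ℂ (fun p : ℂ × ℂ => theta2 (ofComplex p.1) (L p)) {p | 0 < p.1.im} := by
  have he := differentiable_e
  have hθ := differentiableOn_theta3 (L := fun p => L p + p.1 / 2) (by fun_prop)
  have hfactor : Differentiable ℂ fun p : ℂ × ℂ => e (p.1 / 8) * e (L p / 2) := by fun_prop
  exact (hfactor.differentiableOn.mul hθ).congr fun p hp => by
    rw [theta2_eq_theta3]
    simp only [Pi.mul_apply, ofComplex_apply_of_im_pos hp]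

lemma differentiableOn_theta1 (hL : Differentiable ℂ L) :
    DifferentiableOn ℂ (fun p : ℂ × ℂ => theta1 (ofComplex p.1) (L p)) {p | 0 < p.1.im} := by
  simp only [theta1_eq_theta2]
  exact (differentiableOn_theta2 (by fun_prop)).fun_neg

end Holomorphy

/-! ### The Dedekind eta function -/

lemma eta_add_one (τ : ℂ) : ModularForm.eta (τ + 1) = e (1 / 24) * ModularForm.eta τ := by
  have hq : Function.Periodic.qParam 24 (τ + 1) = e (1 / 24) * Function.Periodic.qParam 24 τ := by
    rw [Function.Periodic.qParam, Function.Periodic.qParam, e, ← Complex.exp_add]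
    congr 1; push_cast; ring
  have hfactor (n : ℕ) : ModularForm.eta_q n (τ + 1) = ModularForm.eta_q n τ := by
    rw [ModularForm.eta_q_eq_pow, ModularForm.eta_q_eq_pow, mul_add, mul_one, Complex.exp_add,
      exp_two_pi_mul_I, mul_one]
  simp only [ModularForm.eta, hq, hfactor, mul_assoc]

lemma sqrt_mul_of_arg_add_mem {x y : ℂ} (hx : x ≠ 0) (hy : y ≠ 0)
    (h : x.arg + y.arg ∈ Set.Ioc (-π) π) :
    Complex.sqrt (x * y) = Complex.sqrt x * Complex.sqrt y := by
  rw [sqrt_eq_exp hx, sqrt_eq_exp hy, sqrt_eq_exp (mul_ne_zero hx hy), Complex.log_mul hx hy h,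
    ← Complex.exp_add]
  congr 1; ring

lemma abs_arg_lt_of_re_pos {x : ℂ} (hx : 0 < x.re) : |x.arg| < π / 2 :=
  Complex.abs_arg_lt_pi_div_two_iff.2 (Or.inl hx)

lemma ne_zero_of_re_pos {x : ℂ} (hx : 0 < x.re) : x ≠ 0 := by
  rintro rfl; simp at hx

lemma ne_zero_of_im_pos {τ : ℂ} (hτ : 0 < τ.im) : τ ≠ 0 := by
  rintro rfl; simp at hτ

lemma sqrt_mul_of_re_pos {x y : ℂ} (hx : 0 < x.re) (hy : 0 < y.re) :
    Complex.sqrt (x * y) = Complex.sqrt x * Complex.sqrt y := by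
  have hx' := abs_lt.1 (abs_arg_lt_of_re_pos hx)
  have hy' := abs_lt.1 (abs_arg_lt_of_re_pos hy)
  exact sqrt_mul_of_arg_add_mem (ne_zero_of_re_pos hx) (ne_zero_of_re_pos hy)
    ⟨by linarith, by linarith⟩

lemma sqrt_I_eq : Complex.sqrt I = e (1 / 8) := by
  rw [sqrt_eq_exp I_ne_zero, Complex.log_I, e]; congr 1; field_simp; norm_num

lemma sqrt_neg_I_eq : Complex.sqrt (-I) = e (-(1 / 8)) := by
  rw [sqrt_eq_exp (neg_ne_zero.2 I_ne_zero), Complex.log_neg_I, e]; congr 1; ring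

lemma sqrt_I_mul {x : ℂ} (hx : 0 < x.re) :
    Complex.sqrt (I * x) = e (1 / 8) * Complex.sqrt x := by
  have hx' := abs_lt.1 (abs_arg_lt_of_re_pos hx)
  have := Real.pi_pos
  rw [sqrt_mul_of_arg_add_mem I_ne_zero (ne_zero_of_re_pos hx), sqrt_I_eq]
  rw [Complex.arg_I]
  constructor <;> linarith

lemma sqrt_neg_I_mul {x : ℂ} (hx : 0 < x.re) :
    Complex.sqrt (-I * x) = e (-(1 / 8)) * Complex.sqrt x := by
  have hx' := abs_lt.1 (abs_arg_lt_of_re_pos hx)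
  have := Real.pi_pos
  rw [sqrt_mul_of_arg_add_mem (neg_ne_zero.2 I_ne_zero) (ne_zero_of_re_pos hx), sqrt_neg_I_eq]
  rw [Complex.arg_neg_I]
  constructor <;> linarith

lemma neg_I_mul_re (x : ℂ) : (-I * x).re = x.im := by simp

lemma eta_neg_one_div {τ : ℂ} (hτ : 0 < τ.im) :
    ModularForm.eta (-1 / τ) = Complex.sqrt (-I * τ) * ModularForm.eta τ := by
  have hsqrt : Complex.sqrt τ = Complex.sqrt I * Complex.sqrt (-I * τ) := by
    rw [sqrt_I_eq, ← sqrt_I_mul (by rwa [neg_I_mul_re])]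
    congr 1
    linear_combination τ * I_sq
  have hI : Complex.sqrt I ≠ 0 := by rw [sqrt_I_eq]; exact e_ne_zero _
  have hS : ModularForm.eta (-1 / τ) =
      (Complex.sqrt I)⁻¹ * (Complex.sqrt τ * ModularForm.eta τ) :=
    ModularForm.eta_comp_eq_csqrt_I_inv hτ
  rw [hS, hsqrt]
  field_simp

lemma eta_neg_one_div_sq {τ : ℂ} (hτ : 0 < τ.im) :
    ModularForm.eta (-1 / τ) ^ 2 = -I * τ * ModularForm.eta τ ^ 2 := by
  rw [eta_neg_one_div hτ, mul_pow, sqrt_sq]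

lemma natCast_mul_im_pos {k : ℕ} (hk : 0 < k) {w : ℂ} (hw : 0 < w.im) : 0 < ((k : ℂ) * w).im := by
  simpa using mul_pos (Nat.cast_pos.2 hk) hw

lemma etaAt_ne_zero {k : ℕ} (hk : 0 < k) (τ : ℍ) : etaAt k τ ≠ 0 :=
  ModularForm.eta_ne_zero (natCast_mul_im_pos hk τ.im_pos)

lemma differentiableOn_etaAt {k : ℕ} (hk : 0 < k) :
    DifferentiableOn ℂ (fun w : ℂ => etaAt k (ofComplex w)) {w | 0 < w.im} := by
  refine DifferentiableOn.congr (f := fun w : ℂ => ModularForm.eta (k * w)) (fun w hw => ?_)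
    fun w hw => by rw [etaAt, ofComplex_apply_of_im_pos hw]
  exact ((ModularForm.differentiableAt_eta_of_mem_upperHalfPlaneSet
    (natCast_mul_im_pos hk hw)).comp
    (f := fun w : ℂ => (k : ℂ) * w) w (by fun_prop)).differentiableWithinAt

/-! ### The forms `φ_{0,1}` and `φ_{-2,1}` -/

lemma jacobiSlash_phi01_S : jacobiSlash 0 1 phi01 ModularGroup.S = phi01 := by
  funext τ z
  have h2 := theta2_zero_ne_zero τ
  have h3 := theta3_zero_ne_zero τ
  have h4 := theta4_zero_ne_zero τ
  have hτ := τ.ne_zero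
  have hI := I_ne_zero
  have he := e_ne_zero (z ^ 2 / τ)
  have h2S := theta2_S_sq τ 0
  have h3S := theta3_S_sq τ 0
  have h4S := theta4_S_sq τ 0
  simp only [zero_div, zero_pow two_ne_zero, e_zero, mul_one] at h2S h3S h4S
  simp only [jacobiSlash_S, phi01, div_pow, theta2_S_sq, theta3_S_sq, theta4_S_sq, h2S, h3S, h4S,
    Int.cast_one, one_mul, e_neg, neg_zero, zpow_zero]
  field_simp
  ring

lemma jacobiSlash_phi01_T : jacobiSlash 0 1 phi01 ModularGroup.T = phi01 := by
  funext τ z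
  simp only [jacobiSlash_T, phi01, theta2_T, theta3_T, theta4_T,
    mul_div_mul_left _ _ (e_ne_zero (1 / 8))]
  ring

theorem jacobiSlash_phi01 (γ : SL(2, ℤ)) : jacobiSlash 0 1 phi01 γ = phi01 :=
  jacobiSlash_eq_of_generators jacobiSlash_phi01_S jacobiSlash_phi01_T γ

lemma jacobiSlash_phi21_S : jacobiSlash (-2) 1 phi21 ModularGroup.S = phi21 := by
  funext τ z
  have hη : etaAt 1 (ModularGroup.S • τ) ^ 6 = I * τ ^ 3 * etaAt 1 τ ^ 6 := by
    have h := eta_neg_one_div_sq τ.im_pos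
    simp only [etaAt, coe_S_smul, Nat.cast_one, one_mul] at h ⊢
    rw [show 6 = 2 * 3 by rfl, pow_mul, pow_mul, h]
    linear_combination (-τ ^ 3 * (ModularForm.eta τ ^ 2) ^ 3 * I) * I_sq
  have hη0 := etaAt_ne_zero one_pos τ
  have hτ := τ.ne_zero
  have hI := I_ne_zero
  have he := e_ne_zero (z ^ 2 / τ)
  simp only [jacobiSlash_S, phi21, theta1_S_sq, hη, Int.cast_one, one_mul, e_neg, neg_neg]
  field_simp

lemma jacobiSlash_phi21_T : jacobiSlash (-2) 1 phi21 ModularGroup.T = phi21 := by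
  funext τ z
  have hη : etaAt 1 (ModularGroup.T • τ) = e (1 / 24) * etaAt 1 τ := by
    simp only [etaAt, coe_T_smul, Nat.cast_one, one_mul, eta_add_one]
  have hroot : e (1 / 8) ^ 2 = e (1 / 24) ^ 6 := by
    rw [← e_natCast_mul, ← e_natCast_mul]; norm_num
  rw [jacobiSlash_T, phi21, phi21, hη, theta1_T, mul_pow, mul_pow, hroot,
    mul_div_mul_left _ _ (pow_ne_zero _ (e_ne_zero _))]

theorem jacobiSlash_phi21 (γ : SL(2, ℤ)) : jacobiSlash (-2) 1 phi21 γ = phi21 :=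
  jacobiSlash_eq_of_generators jacobiSlash_phi21_S jacobiSlash_phi21_T γ

lemma phi01_elliptic (lam mu : ℤ) (τ : ℍ) (z : ℂ) :
    phi01 τ z = e (lam ^ 2 * τ + 2 * lam * z) * phi01 τ (z + lam * τ + mu) := by
  simp only [phi01, div_pow, theta2_add_mul_add_sq, theta3_add_mul_add_sq, theta4_add_mul_add_sq,
    e_neg]
  field [e_ne_zero (lam ^ 2 * τ + 2 * lam * z)]

lemma phi21_elliptic (lam mu : ℤ) (τ : ℍ) (z : ℂ) :
    phi21 τ z = e (lam ^ 2 * τ + 2 * lam * z) * phi21 τ (z + lam * τ + mu) := by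
  simp only [phi21, theta1_add_mul_add_sq, e_neg]
  field [e_ne_zero (lam ^ 2 * τ + 2 * lam * z)]

lemma differentiableOn_fun_div {E : Type*} [NormedAddCommGroup E] [NormedSpace ℂ E] {f g : E → ℂ}
    {s : Set E} (hf : DifferentiableOn ℂ f s) (hg : DifferentiableOn ℂ g s)
    (hg0 : ∀ x ∈ s, g x ≠ 0) : DifferentiableOn ℂ (fun x => f x / g x) s := by
  simp only [div_eq_mul_inv]
  exact hf.fun_mul (hg.fun_inv hg0)

lemma differentiableOn_phi01 :
    DifferentiableOn ℂ (fun p : ℂ × ℂ => phi01 (ofComplex p.1) p.2) {p | 0 < p.1.im} := by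
  have hz : Differentiable ℂ fun p : ℂ × ℂ => p.2 := by fun_prop
  have h0 : Differentiable ℂ fun _ : ℂ × ℂ => (0 : ℂ) := by fun_prop
  have h2 := differentiableOn_fun_div (differentiableOn_theta2 hz) (differentiableOn_theta2 h0)
    fun p _ => theta2_zero_ne_zero _
  have h3 := differentiableOn_fun_div (differentiableOn_theta3 hz) (differentiableOn_theta3 h0)
    fun p _ => theta3_zero_ne_zero _
  have h4 := differentiableOn_fun_div (differentiableOn_theta4 hz) (differentiableOn_theta4 h0)
    fun p _ => theta4_zero_ne_zero _
  exact (((h2.fun_pow 2).fun_add (h3.fun_pow 2)).fun_add (h4.fun_pow 2)).const_mul 4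

lemma differentiableOn_phi21 :
    DifferentiableOn ℂ (fun p : ℂ × ℂ => phi21 (ofComplex p.1) p.2) {p | 0 < p.1.im} := by
  have hθ : DifferentiableOn ℂ (fun p : ℂ × ℂ => theta1 (ofComplex p.1) p.2) {p | 0 < p.1.im} :=
    differentiableOn_theta1 (by fun_prop)
  have hη : DifferentiableOn ℂ (fun p : ℂ × ℂ => etaAt 1 (ofComplex p.1)) {p | 0 < p.1.im} :=
    (differentiableOn_etaAt one_pos).comp (f := Prod.fst) (by fun_prop) fun p hp => hp
  exact (differentiableOn_fun_div (hθ.fun_pow 2) (hη.fun_pow 6)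
    fun p _ => pow_ne_zero _ (etaAt_ne_zero one_pos _)).fun_neg

/-! ### Fourier expansions -/

section Fourier

open Filter Topology

lemma HasWeakFourierExpansion.add {M : ℕ} {φ ψ : ℍ → ℂ → ℂ} (hφ : HasWeakFourierExpansion M φ)
    (hψ : HasWeakFourierExpansion M ψ) : HasWeakFourierExpansion M fun τ z => φ τ z + ψ τ z := by
  obtain ⟨c, hc⟩ := hφ
  obtain ⟨d, hd⟩ := hψ
  refine ⟨fun p => c p + d p, fun τ z => ?_⟩
  simpa only [add_mul] using (hc τ z).add (hd τ z)

lemma HasWeakFourierExpansion.const_mul {M : ℕ} {φ : ℍ → ℂ → ℂ} (a : ℂ)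
    (hφ : HasWeakFourierExpansion M φ) : HasWeakFourierExpansion M fun τ z => a * φ τ z := by
  obtain ⟨c, hc⟩ := hφ
  refine ⟨fun p => a * c p, fun τ z => ?_⟩
  simpa only [mul_assoc] using (hc τ z).mul_left a

lemma HasWeakFourierExpansion.comp_add_const {M : ℕ} {φ : ℍ → ℂ → ℂ}
    (hφ : HasWeakFourierExpansion M φ) (a : ℂ) :
    HasWeakFourierExpansion M fun τ z => φ τ (z + a) := by
  obtain ⟨c, hc⟩ := hφ
  refine ⟨fun p => c p * e (p.2 * a), fun τ z => (hc τ (z + a)).congr_fun fun p => ?_⟩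
  rw [mul_add, e_add]; ring

lemma hasSum_mul_fiberwise {α β : Type*} {f g : α → ℂ} {a b : ℂ} (hf : HasSum f a)
    (hg : HasSum g b) (s : α × α → β) :
    HasSum (fun p => ∑' x : s ⁻¹' {p}, f x.1.1 * g x.1.2) (a * b) :=
  (hf.mul hg (summable_mul_of_summable_norm hf.summable.norm hg.summable.norm)).tsum_fiberwise s

lemma fourier_term_mul (M : ℕ) (a b : ℂ) (τ : ℍ) (z : ℂ) (x y : ℕ × ℤ) :
    a * b * (e ((x + y).1 * τ / M) * e ((x + y).2 * z)) =
      a * e (x.1 * τ / M) * e (x.2 * z) * (b * e (y.1 * τ / M) * e (y.2 * z)) := by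
  rw [Prod.fst_add, Prod.snd_add, Nat.cast_add, Int.cast_add, add_mul, add_mul, add_div, e_add,
    e_add]
  ring

lemma HasWeakFourierExpansion.mul {M : ℕ} {φ ψ : ℍ → ℂ → ℂ} (hφ : HasWeakFourierExpansion M φ)
    (hψ : HasWeakFourierExpansion M ψ) : HasWeakFourierExpansion M fun τ z => φ τ z * ψ τ z := by
  obtain ⟨c, hc⟩ := hφ
  obtain ⟨d, hd⟩ := hψ
  let s : (ℕ × ℤ) × (ℕ × ℤ) → ℕ × ℤ := fun x => x.1 + x.2
  refine ⟨fun p => ∑' x : s ⁻¹' {p}, c x.1.1 * d x.1.2, fun τ z => ?_⟩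
  refine (hasSum_mul_fiberwise (hc τ z) (hd τ z) s).congr_fun fun p => ?_
  rw [mul_assoc, ← tsum_mul_right]
  refine tsum_congr fun x => ?_
  have hx : x.1.1 + x.1.2 = p := x.2
  have h := fourier_term_mul M (c x.1.1) (d x.1.2) τ z x.1.1 x.1.2
  rwa [hx] at h

lemma hasWeakFourierExpansion_of_hasSum {M : ℕ} {φ : ℍ → ℂ → ℂ} {ι : Type*} {i : ι → ℕ × ℤ}
    (hi : Function.Injective i) (c : ι → ℂ)
    (h : ∀ (τ : ℍ) (z : ℂ), HasSum (fun j => c j * e ((i j).1 * τ / M) * e ((i j).2 * z)) (φ τ z)) :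
    HasWeakFourierExpansion M φ := by
  refine ⟨Function.extend i c 0, fun τ z => ?_⟩
  rw [← hi.hasSum_iff]
  · refine (h τ z).congr_fun fun p => ?_
    simp only [Function.comp, hi.extend_apply]
  · intro p hp
    rw [Function.extend_apply' _ _ _ (by simpa using hp), Pi.zero_apply, zero_mul, zero_mul]

lemma injective_mul_fst {k : ℕ} (hk : 0 < k) :
    Function.Injective fun p : ℕ × ℤ => (k * p.1, p.2) :=
  (mul_right_injective₀ hk.ne').prodMap Function.injective_id

lemma HasWeakFourierExpansion.mul_level {M : ℕ} {φ : ℍ → ℂ → ℂ}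
    (hφ : HasWeakFourierExpansion M φ) {k : ℕ} (hk : 0 < k) :
    HasWeakFourierExpansion (M * k) φ := by
  obtain ⟨c, hc⟩ := hφ
  refine hasWeakFourierExpansion_of_hasSum (injective_mul_fst hk) c fun τ z => ?_
  refine (hc τ z).congr_fun fun p => ?_
  have hk' : (k : ℂ) ≠ 0 := Nat.cast_ne_zero.2 hk.ne'
  rw [Nat.cast_mul, Nat.cast_mul, mul_assoc (k : ℂ), mul_comm (M : ℂ), mul_div_mul_left _ _ hk']

lemma e_natCast_mul_add_one_div_two (n : ℕ) (τ : ℂ) :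
    e (n * (τ + 1) / 2) = (-1) ^ n * e (n * τ / 2) := by
  rw [← e_half, ← e_natCast_mul, ← e_add]; congr 1; ring

/-- Averaging the expansion over `τ` and `τ + 1` removes the odd powers of `q^{1/2}`. -/
lemma HasWeakFourierExpansion.of_T_invariant {φ : ℍ → ℂ → ℂ} (hφ : HasWeakFourierExpansion 2 φ)
    (hT : ∀ τ z, φ (ModularGroup.T • τ) z = φ τ z) : HasWeakFourierExpansion 1 φ := by
  obtain ⟨c, hc⟩ := hφ
  refine ⟨fun p => c (2 * p.1, p.2), fun τ z => ?_⟩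
  have hT' := hc (ModularGroup.T • τ) z
  rw [hT, coe_T_smul] at hT'
  have hmean := ((hc τ z).add hT').div_const 2
  simp only [Nat.cast_ofNat, e_natCast_mul_add_one_div_two, add_self_div_two] at hmean
  rw [← (injective_mul_fst two_pos).hasSum_iff] at hmean
  · refine hmean.congr_fun fun p => ?_
    rw [Function.comp_apply, (even_two_mul p.1).neg_one_pow, Nat.cast_mul, Nat.cast_two,
      mul_assoc (2 : ℂ), mul_div_cancel_left₀ _ two_ne_zero, Nat.cast_one, div_one]
    ring
  · rintro ⟨n, l⟩ hp
    have hn : ¬ Even n := fun ⟨m, hm⟩ => hp ⟨(m, l), by simp [hm, two_mul]⟩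
    rw [(Nat.not_even_iff_odd.1 hn).neg_one_pow]
    ring

lemma hasWeakFourierExpansion_e (M : ℕ) (l : ℤ) :
    HasWeakFourierExpansion M fun _ z => e (l * z) := by
  refine hasWeakFourierExpansion_of_hasSum (i := fun _ : Unit => (0, l))
    (Function.injective_of_subsingleton _) (fun _ => 1) fun τ z => ?_
  simp [e_zero]

lemma coe_T_pow_smul (M : ℕ) (τ : ℍ) : ((ModularGroup.T ^ M • τ : ℍ) : ℂ) = τ + M := by
  rw [← zpow_natCast, modular_T_zpow_smul, coe_vadd]; simp [add_comm]

lemma periodic_comp_ofComplex {M : ℕ} {f : ℍ → ℂ} (hf : ∀ τ, f (ModularGroup.T ^ M • τ) = f τ) :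
    Function.Periodic (f ∘ ofComplex) M := by
  intro w
  rcases lt_or_ge 0 w.im with hw | hw
  · have hw' : ofComplex (w + M) = ModularGroup.T ^ M • ofComplex w := by
      ext1
      rw [coe_T_pow_smul, ofComplex_apply_of_im_pos hw, ofComplex_apply_of_im_pos (by simpa)]
    rw [Function.comp_apply, hw', hf, Function.comp_apply]
  · rw [Function.comp_apply, Function.comp_apply, ofComplex_apply_of_im_nonpos hw,
      ofComplex_apply_of_im_nonpos (by simpa)]

lemma hasWeakFourierExpansion_of_isBoundedAtImInfty {M : ℕ} (hM : 0 < M) {f : ℍ → ℂ}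
    (hf : DifferentiableOn ℂ (fun w : ℂ => f (ofComplex w)) {w | 0 < w.im})
    (hper : ∀ τ, f (ModularGroup.T ^ M • τ) = f τ) (hb : IsBoundedAtImInfty f) :
    HasWeakFourierExpansion M fun τ _ => f τ := by
  have hsum := hasSum_qExpansion (Nat.cast_pos.2 hM) (periodic_comp_ofComplex hper)
    (mdifferentiable_iff.2 hf) hb
  refine hasWeakFourierExpansion_of_hasSum (i := fun n : ℕ => (n, (0 : ℤ)))
    (fun a b h => by simpa using h) (fun n => (qExpansion M f).coeff n) fun τ z => ?_
  refine (hsum τ).congr_fun fun n => ?_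
  have hq : Function.Periodic.qParam (M : ℝ) τ ^ n = e (n * τ / M) := by
    rw [Function.Periodic.qParam, e, ← Complex.exp_nat_mul]; congr 1; push_cast; ring
  rw [smul_eq_mul, hq, Int.cast_zero, zero_mul, e_zero, mul_one]

lemma norm_e_natCast_mul_div_two (k : ℕ) (τ : ℍ) :
    ‖e (k * τ / 2)‖ = Real.exp (-(π * k * τ.im)) := by
  have him : ((k : ℂ) * τ / 2).im = k * τ.im / 2 := by simp
  rw [norm_e, him]; congr 1; ring

lemma tendsto_e_natCast_mul_div_two (k : ℕ) :
    Tendsto (fun τ : ℍ => e (k * τ / 2)) atImInfty (𝓝 (if k = 0 then 1 else 0)) := by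
  split_ifs with hk
  · simp [hk, e_zero]
  · have hk' : 0 < π * k := by positivity
    rw [tendsto_zero_iff_norm_tendsto_zero]
    simp only [norm_e_natCast_mul_div_two]
    exact Real.tendsto_exp_neg_atTop_nhds_zero.comp (tendsto_comap.const_mul_atTop hk')

lemma tendsto_tsum_atImInfty {ι : Type*} (u : ι → ℂ) (k : ι → ℕ)
    (hs : Summable fun i => u i * e (k i * UpperHalfPlane.I / 2)) :
    Tendsto (fun τ : ℍ => ∑' i, u i * e (k i * τ / 2)) atImInfty
      (𝓝 (∑' i, if k i = 0 then u i else 0)) := by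
  refine tendsto_tsum_of_dominated_convergence hs.norm (fun i => ?_) ?_
  · simpa only [mul_ite, mul_one, mul_zero] using
      (tendsto_e_natCast_mul_div_two (k i)).const_mul (u i)
  · filter_upwards [(atImInfty_mem _).2 ⟨1, fun τ hτ => hτ⟩] with τ (hτ : 1 ≤ τ.im) i
    rw [norm_mul, norm_mul, norm_e_natCast_mul_div_two, norm_e_natCast_mul_div_two]
    gcongr
    exact hτ

lemma hasWeakFourierExpansion_inv_of_tendsto {M : ℕ} (hM : 0 < M) {f : ℍ → ℂ}
    (hf : DifferentiableOn ℂ (fun w : ℂ => f (ofComplex w)) {w | 0 < w.im}) (hf0 : ∀ τ, f τ ≠ 0)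
    (hper : ∀ τ, f (ModularGroup.T ^ M • τ) = f τ) {a : ℂ} (ha : a ≠ 0)
    (hlim : Tendsto f atImInfty (𝓝 a)) : HasWeakFourierExpansion M fun τ _ => (f τ)⁻¹ :=
  hasWeakFourierExpansion_of_isBoundedAtImInfty hM (f := fun τ => (f τ)⁻¹)
    (hf.fun_inv fun _ _ => hf0 _) (fun τ => by rw [hper]) ((hlim.inv₀ ha).isBigO_one ℝ)

lemma natCast_natAbs_sq (n : ℤ) : ((n.natAbs ^ 2 : ℕ) : ℂ) = (n : ℂ) ^ 2 := by
  rw [← Int.cast_pow, ← n.natAbs_sq]; norm_cast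

lemma natCast_toNat_mul_add_one (n : ℤ) :
    (((n * (n + 1)).toNat : ℕ) : ℂ) = (n : ℂ) * (n + 1) := by
  have hn : 0 ≤ n * (n + 1) := by
    rcases le_or_gt 0 n with h | h
    · positivity
    · nlinarith
  exact_mod_cast congrArg (Int.cast : ℤ → ℂ) (Int.toNat_of_nonneg hn)

lemma hasSum_theta3 (τ : ℍ) (z : ℂ) :
    HasSum (fun n : ℤ => e (n * z) * e ((n.natAbs ^ 2 : ℕ) * τ / 2)) (theta3 τ z) := by
  rw [theta3_eq_jacobiTheta₂]
  refine (hasSum_jacobiTheta₂_term z τ.im_pos).congr_fun fun n => ?_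
  rw [natCast_natAbs_sq, ← e_add, jacobiTheta₂_term, e]
  congr 1; ring

lemma hasSum_theta3_add_half (τ : ℍ) (z : ℂ) :
    HasSum (fun n : ℤ => e (n * z) * e ((n * (n + 1)).toNat * τ / 2)) (theta3 τ (z + τ / 2)) := by
  refine (hasSum_theta3 τ (z + τ / 2)).congr_fun fun n => ?_
  rw [natCast_natAbs_sq, natCast_toNat_mul_add_one, ← e_add, ← e_add]
  congr 1; ring

lemma hasWeakFourierExpansion_theta3 : HasWeakFourierExpansion 2 theta3 := by
  refine hasWeakFourierExpansion_of_hasSum (i := fun n : ℤ => (n.natAbs ^ 2, n))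
    (fun a b h => (Prod.mk.inj h).2) (fun _ => 1) fun τ z => ?_
  refine (hasSum_theta3 τ z).congr_fun fun n => ?_
  rw [one_mul, mul_comm, Nat.cast_ofNat]

lemma hasWeakFourierExpansion_theta4 : HasWeakFourierExpansion 2 theta4 := by
  simpa only [← theta4_eq_theta3] using hasWeakFourierExpansion_theta3.comp_add_const (1 / 2)

lemma hasWeakFourierExpansion_theta3_add_half :
    HasWeakFourierExpansion 1 fun τ z => theta3 τ (z + τ / 2) := by
  refine hasWeakFourierExpansion_of_hasSum (i := fun n : ℤ => ((n * (n + 1)).toNat / 2, n))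
    (fun a b h => (Prod.mk.inj h).2) (fun _ => 1) fun τ z => ?_
  refine (hasSum_theta3_add_half τ z).congr_fun fun n => ?_
  have heven : 2 ∣ (n * (n + 1)).toNat := by
    obtain ⟨m, hm⟩ := Int.even_mul_succ_self n
    exact ⟨m.toNat, by omega⟩
  rw [one_mul, mul_comm, Nat.cast_div heven (by norm_num), Nat.cast_ofNat, Nat.cast_one, div_one,
    div_mul_eq_mul_div]

lemma tendsto_theta3 (z : ℂ) : Tendsto (fun τ : ℍ => theta3 τ z) atImInfty (𝓝 1) := by
  have h := tendsto_tsum_atImInfty (fun n : ℤ => e (n * z)) (fun n => n.natAbs ^ 2)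
    (hasSum_theta3 UpperHalfPlane.I z).summable
  rw [tsum_eq_single 0 fun n hn => by simp [hn]] at h
  simpa only [fun τ => (hasSum_theta3 τ z).tsum_eq, Int.natAbs_zero, zero_pow two_ne_zero, if_true,
    Int.cast_zero, zero_mul, e_zero] using h

lemma toNat_mul_add_one_eq_zero_iff {n : ℤ} : (n * (n + 1)).toNat = 0 ↔ n = 0 ∨ n = -1 := by
  rw [Int.toNat_eq_zero]
  constructor
  · intro h
    by_contra! hn
    rcases lt_or_gt_of_ne hn.1 with hneg | hpos
    · have : n < -1 := by omega
      nlinarith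
    · nlinarith
  · rintro (rfl | rfl) <;> norm_num

lemma tendsto_theta3_half : Tendsto (fun τ : ℍ => theta3 τ (τ / 2)) atImInfty (𝓝 2) := by
  have hs (τ : ℍ) : HasSum (fun n : ℤ => 1 * e ((n * (n + 1)).toNat * τ / 2))
      (theta3 τ (τ / 2)) := by
    simpa only [zero_add, mul_zero, e_zero] using hasSum_theta3_add_half τ 0
  have h := tendsto_tsum_atImInfty (fun _ : ℤ => 1) (fun n => (n * (n + 1)).toNat)
    (hs UpperHalfPlane.I).summable
  simp only [fun τ => (hs τ).tsum_eq, toNat_mul_add_one_eq_zero_iff] at h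
  rw [tsum_eq_sum (s := {0, -1}) fun n hn => by simpa using hn,
    Finset.sum_pair (by norm_num)] at h
  simpa [one_add_one_eq_two] using h

lemma theta3_half_ne_zero (τ : ℍ) : theta3 τ (τ / 2) ≠ 0 := by
  have h := theta2_zero_ne_zero τ
  rw [theta2_eq_theta3, zero_add] at h
  exact right_ne_zero_of_mul h

lemma hasWeakFourierExpansion_inv_theta3 :
    HasWeakFourierExpansion 2 fun τ _ => (theta3 τ 0)⁻¹ := by
  refine hasWeakFourierExpansion_inv_of_tendsto two_pos ?_ theta3_zero_ne_zero (fun τ => ?_)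
    one_ne_zero (tendsto_theta3 0)
  · exact (differentiableOn_theta3 (L := fun _ => 0) (by fun_prop)).comp
      (f := fun w : ℂ => (w, (0 : ℂ))) (by fun_prop) fun w hw => hw
  · rw [pow_two, mul_smul, theta3_T, theta4_T]

lemma hasWeakFourierExpansion_inv_theta4 :
    HasWeakFourierExpansion 2 fun τ _ => (theta4 τ 0)⁻¹ := by
  refine hasWeakFourierExpansion_inv_of_tendsto two_pos ?_ theta4_zero_ne_zero (fun τ => ?_)
    one_ne_zero ?_
  · exact (differentiableOn_theta4 (L := fun _ => 0) (by fun_prop)).comp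
      (f := fun w : ℂ => (w, (0 : ℂ))) (by fun_prop) fun w hw => hw
  · rw [pow_two, mul_smul, theta4_T, theta3_T]
  · simpa only [theta4_eq_theta3] using tendsto_theta3 (0 + 1 / 2)

lemma hasWeakFourierExpansion_inv_theta3_half :
    HasWeakFourierExpansion 1 fun τ _ => (theta3 τ (τ / 2))⁻¹ := by
  refine hasWeakFourierExpansion_inv_of_tendsto one_pos ?_ theta3_half_ne_zero (fun τ => ?_)
    two_ne_zero tendsto_theta3_half
  · refine ((differentiableOn_theta3 (L := fun p => p.1 / 2) (by fun_prop)).comp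
      (f := fun w : ℂ => (w, (0 : ℂ))) (by fun_prop) fun w hw => hw).congr fun w hw => ?_
    simp only [Function.comp_apply, ofComplex_apply_of_im_pos hw]
  · rw [pow_one, theta3_T, theta4_eq_theta3, coe_T_smul, add_div, add_assoc, add_halves,
      theta3_add_one]

lemma tendsto_tprod_eta_q :
    Tendsto (fun τ : ℍ => ∏' n, (1 - ModularForm.eta_q n τ)) atImInfty (𝓝 1) := by
  have hc : ContinuousAt (fun q : ℂ => ∏' n : ℕ, (1 - q ^ (n + 1))) 0 :=
    (ModularForm.differentiableOn_tprod_one_sub_pow.differentiableAt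
      (Metric.ball_mem_nhds 0 one_pos)).continuousAt
  have h := hc.tendsto.comp (qParam_tendsto_atImInfty one_pos)
  simp only [ne_eq, Nat.add_eq_zero_iff, one_ne_zero, and_false, not_false_eq_true, zero_pow,
    sub_zero, tprod_one] at h
  exact h

lemma eta_eq_e_mul_tprod (τ : ℂ) :
    ModularForm.eta τ = e (τ / 24) * ∏' n, (1 - ModularForm.eta_q n τ) := by
  rw [ModularForm.eta, Function.Periodic.qParam, e]
  congr 2; push_cast; ring

lemma hasWeakFourierExpansion_e_div_etaAt :
    HasWeakFourierExpansion 1 fun τ _ => e (τ / 24) / etaAt 1 τ := by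
  have he := differentiable_e
  have hprod (τ : ℍ) : etaAt 1 τ / e (τ / 24) = ∏' n, (1 - ModularForm.eta_q n τ) := by
    rw [etaAt, Nat.cast_one, one_mul, eta_eq_e_mul_tprod, mul_div_cancel_left₀ _ (e_ne_zero _)]
  simp only [← inv_div (etaAt 1 _)]
  refine hasWeakFourierExpansion_inv_of_tendsto one_pos ?_
    (fun τ => div_ne_zero (etaAt_ne_zero one_pos τ) (e_ne_zero _)) (fun τ => ?_) one_ne_zero ?_
  · refine differentiableOn_fun_div (differentiableOn_etaAt one_pos)
      (.congr (f := fun w => e (w / 24)) (by fun_prop) fun w hw => ?_) fun w _ => e_ne_zero _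
    rw [ofComplex_apply_of_im_pos hw]
  · rw [pow_one, etaAt, etaAt, coe_T_smul, Nat.cast_one, one_mul, one_mul, eta_add_one, add_div,
      e_add, mul_comm (e (τ / 24)), mul_div_mul_left _ _ (e_ne_zero _)]
  · simpa only [hprod] using tendsto_tprod_eta_q

theorem hasWeakFourierExpansion_phi01 : HasWeakFourierExpansion 1 phi01 := by
  refine HasWeakFourierExpansion.of_T_invariant ?_ fun τ z => ?_
  · have h3 := hasWeakFourierExpansion_theta3.mul hasWeakFourierExpansion_inv_theta3
    have h4 := hasWeakFourierExpansion_theta4.mul hasWeakFourierExpansion_inv_theta4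
    have h2 := (hasWeakFourierExpansion_theta3_add_half.mul
      hasWeakFourierExpansion_inv_theta3_half).mul_level two_pos
    have h := ((((hasWeakFourierExpansion_e 2 1).mul (h2.mul h2)).add (h3.mul h3)).add
      (h4.mul h4)).const_mul 4
    convert! h using 1
    funext τ z
    have hy : e ((1 : ℤ) * z) = e (z / 2) ^ 2 := by
      rw [← e_natCast_mul]; congr 1; push_cast; ring
    have hq := e_ne_zero (τ / 8)
    have hθ := theta3_half_ne_zero τ
    rw [phi01, theta2_eq_theta3, theta2_eq_theta3, zero_div, e_zero, zero_add, hy]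
    field_simp
  · rw [← jacobiSlash_T 0 1 phi01, jacobiSlash_phi01]

theorem hasWeakFourierExpansion_phi21 : HasWeakFourierExpansion 1 phi21 := by
  have hθ := hasWeakFourierExpansion_theta3_add_half.comp_add_const (1 / 2)
  have hη := hasWeakFourierExpansion_e_div_etaAt
  have hη3 := hη.mul (hη.mul hη)
  have h := ((hasWeakFourierExpansion_e 1 1).mul (hθ.mul hθ)).mul (hη3.mul hη3)
  convert! h using 1
  funext τ z
  have hy : e ((1 : ℤ) * z) = -e ((z + 1 / 2) / 2) ^ 2 := by
    rw [← e_natCast_mul, neg_eq_neg_one_mul, ← inv_neg_one, ← e_half, ← e_neg, ← e_add]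
    congr 1; push_cast; ring
  have hq : e (τ / 8) = e (τ / 24) ^ 3 := by
    rw [← e_natCast_mul]; congr 1; push_cast; ring
  rw [phi21, theta1_eq_theta2, theta2_eq_theta3, hy, hq]
  field [etaAt_ne_zero one_pos τ]

end Fourier

/-! ### The multiplier system of the eta function -/

section EtaMultiplier

open scoped NumberTheorySymbols

lemma eta_add_natCast (τ : ℂ) (m : ℕ) :
    ModularForm.eta (τ + m) = e (m / 24) * ModularForm.eta τ := by
  induction m with
  | zero => simp [e_zero]
  | succ m ih =>
    push_cast
    rw [← add_assoc, eta_add_one, ih, add_div, e_add]; ring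

lemma eta_add_intCast (τ : ℂ) (m : ℤ) :
    ModularForm.eta (τ + m) = e (m / 24) * ModularForm.eta τ := by
  obtain ⟨n, rfl | rfl⟩ := m.eq_nat_or_neg
  · rw [Int.cast_natCast]; exact eta_add_natCast τ n
  · have h := eta_add_natCast (τ - n) n
    rw [sub_add_cancel] at h
    push_cast
    rw [← sub_eq_add_neg, h, neg_div, e_neg, inv_mul_cancel_left₀ (e_ne_zero _)]

/-- The `x`-th power of the primitive 24-th root of unity `e (1 / 24)`; every eta multiplier is one
of these up to sign. -/
noncomputable def zeta24 (x : ℤ) : ℂ := e (x / 24)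

lemma zeta24_add (x y : ℤ) : zeta24 (x + y) = zeta24 x * zeta24 y := by
  rw [zeta24, zeta24, zeta24, ← e_add]; congr 1; push_cast; ring

lemma zeta24_congr {x y : ℤ} (h : (24 : ℤ) ∣ x - y) : zeta24 x = zeta24 y := by
  obtain ⟨k, hk⟩ := h
  have hdiv : (x : ℂ) / 24 = y / 24 + (k : ℤ) := by
    have : (x : ℂ) - y = 24 * k := by exact_mod_cast hk
    linear_combination this / 24
  rw [zeta24, hdiv, e_add, e_intCast, mul_one, zeta24]

lemma zeta24_three : zeta24 3 = e (1 / 8) := by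
  rw [zeta24]; congr 1; norm_num

lemma zeta24_neg_three : zeta24 (-3) = e (-(1 / 8)) := by
  rw [zeta24]; congr 1; norm_num

lemma neg_one_pow_eq_zeta24 (n : ℕ) : (-1 : ℂ) ^ n = zeta24 (12 * n) := by
  rw [← e_half, ← e_natCast_mul, zeta24]; congr 1; push_cast; ring

/-- `η` transforms under the matrix `(a b; c d)` with multiplier `v`. The principal branch of the
square root is taken of `-i(cτ + d)`, which has positive real part when `c > 0`. -/
def HasEtaMultiplier (a b c d : ℤ) (v : ℂ) : Prop :=
  ∀ τ : ℂ, 0 < τ.im → ModularForm.eta ((a * τ + b) / (c * τ + d)) =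
    v * Complex.sqrt (-I * (c * τ + d)) * ModularForm.eta τ

lemma intCast_mul_add_im (c d : ℤ) (τ : ℂ) : ((c : ℂ) * τ + d).im = c * τ.im := by
  simp

lemma intCast_mul_add_im_pos {c : ℤ} (hc : 0 < c) (d : ℤ) {τ : ℂ} (hτ : 0 < τ.im) :
    0 < ((c : ℂ) * τ + d).im := by
  rw [intCast_mul_add_im]
  exact mul_pos (by exact_mod_cast hc) hτ

lemma neg_one_div_im_pos {τ : ℂ} (hτ : 0 < τ.im) : 0 < (-1 / τ).im := by
  rw [neg_div, one_div, Complex.neg_im, Complex.inv_im, neg_div, neg_neg]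
  exact div_pos hτ (Complex.normSq_pos.2 (ne_zero_of_im_pos hτ))

lemma HasEtaMultiplier.add_mul {a b c d : ℤ} {v : ℂ} (h : HasEtaMultiplier a b c d v) (m : ℤ) :
    HasEtaMultiplier a (b + m * a) c (d + m * c) (v * zeta24 m) := by
  intro τ hτ
  have hshift (x y : ℤ) : (x : ℂ) * (τ + m) + y = x * τ + (y + m * x : ℤ) := by push_cast; ring
  have h' := h (τ + m) (by simpa using hτ)
  rw [eta_add_intCast, hshift, hshift] at h'
  rw [h', zeta24]; ring

/-- The two square roots coming from `h` and from `τ ↦ -1/τ` combine into a single one, whose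
argument no longer depends on the sign of `d`. -/
lemma HasEtaMultiplier.eta_comp_neg_one_div {a b c d : ℤ} {v : ℂ} (h : HasEtaMultiplier a b c d v)
    (hc : 0 < c) {τ : ℂ} (hτ : 0 < τ.im) :
    ModularForm.eta ((b * τ - a) / (d * τ - c)) =
      v * Complex.sqrt (c - d * τ) * ModularForm.eta τ := by
  have hτ0 := ne_zero_of_im_pos hτ
  have hτ' := neg_one_div_im_pos hτ
  have hmul (x y : ℤ) : ((x : ℂ) * (-1 / τ) + y) * τ = y * τ - x := by field_simp; ring
  have hsqrt : Complex.sqrt (-I * (c * (-1 / τ) + d)) * Complex.sqrt (-I * τ) =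
      Complex.sqrt (c - d * τ) := by
    rw [← sqrt_mul_of_re_pos]
    · congr 1
      linear_combination (c * (-1 / τ) + d) * τ * I_sq - hmul c d
    · rw [neg_I_mul_re]; exact intCast_mul_add_im_pos hc d hτ'
    · rwa [neg_I_mul_re]
  have h' := h _ hτ'
  rw [eta_neg_one_div hτ, ← mul_div_mul_right _ _ hτ0, hmul, hmul] at h'
  rw [h', ← hsqrt]
  ring

lemma HasEtaMultiplier.mul_S {a b c d : ℤ} {v : ℂ} (h : HasEtaMultiplier a b c d v)
    (hc : 0 < c) (hd : 0 < d) : HasEtaMultiplier b (-a) d (-c) (v * zeta24 (-3)) := by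
  intro τ hτ
  have hsqrt : Complex.sqrt (c - d * τ) =
      zeta24 (-3) * Complex.sqrt (-I * (d * τ + (-c : ℤ))) := by
    rw [zeta24_neg_three, ← sqrt_neg_I_mul]
    · congr 1; push_cast; linear_combination (c - d * τ) * I_sq
    · rw [neg_I_mul_re]; exact intCast_mul_add_im_pos hd _ hτ
  have h' := h.eta_comp_neg_one_div hc hτ
  push_cast [sub_eq_add_neg] at h' hsqrt ⊢
  rw [h', hsqrt]
  ring

lemma HasEtaMultiplier.mul_S_inv {a b c d : ℤ} {v : ℂ} (h : HasEtaMultiplier a b c d v)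
    (hc : 0 < c) (hd : d < 0) : HasEtaMultiplier (-b) a (-d) c (v * zeta24 3) := by
  intro τ hτ
  have hsqrt : Complex.sqrt (c - d * τ) =
      zeta24 3 * Complex.sqrt (-I * ((-d : ℤ) * τ + c)) := by
    rw [zeta24_three, ← sqrt_I_mul]
    · congr 1; push_cast; linear_combination (c - d * τ) * I_sq
    · rw [neg_I_mul_re]; exact intCast_mul_add_im_pos (neg_pos.2 hd) _ hτ
  have h' := h.eta_comp_neg_one_div hc hτ
  rw [← neg_div_neg_eq] at h'
  push_cast at hsqrt ⊢
  rw [neg_sub', neg_sub', ← neg_mul, ← neg_mul, sub_neg_eq_add, sub_neg_eq_add] at h'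
  rw [h', hsqrt]
  ring

lemma dvd_mul_sq_sub_one_of_odd {c : ℤ} (hc : Odd c) : (24 : ℤ) ∣ c * (c ^ 2 - 1) := by
  obtain ⟨k, rfl⟩ := hc
  have hmod : ∀ x : ZMod 6, x * (x + 1) * (2 * x + 1) = 0 := by decide
  have hdvd : ((6 : ℕ) : ℤ) ∣ k * (k + 1) * (2 * k + 1) := by
    rw [← ZMod.intCast_zmod_eq_zero_iff_dvd]
    push_cast
    exact hmod k
  obtain ⟨m, hm⟩ := hdvd
  exact ⟨m, by push_cast at hm; linear_combination 4 * hm⟩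

lemma jacobiSym_neg_of_eq {a : ℤ} {c k : ℕ} (hc : c = 2 * k + 1) :
    J(-a | c) = (-1) ^ k * J(a | c) := by
  rw [jacobiSym.neg _ ⟨k, hc⟩, ZMod.χ₄_eq_neg_one_pow (by lia), show c / 2 = k by lia]

lemma jacobiSym_natCast_reciprocity {n c l k : ℕ} (hn : n = 2 * l + 1) (hc : c = 2 * k + 1) :
    J(n | c) = (-1) ^ (l * k) * J(c | n) := by
  rw [jacobiSym.quadratic_reciprocity ⟨l, hn⟩ ⟨k, hc⟩, show n / 2 = l by lia,
    show c / 2 = k by lia]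

/-- The multiplier of `η` at a matrix `(a b; c d)` of determinant one with `c > 0` odd, in
Petersson's form. -/
noncomputable def etaMultiplier (a b : ℤ) (c : ℕ) (d : ℤ) : ℂ :=
  (J(d | c) : ℤ) * zeta24 ((a + d) * c - b * d * (c ^ 2 - 1) - 3 * c + 3)

lemma etaMultiplier_add_mul {a b : ℤ} {c : ℕ} {d : ℤ} (hc : Odd c) (hdet : a * d - b * c = 1)
    (m : ℤ) :
    etaMultiplier a (b + m * a) c (d + m * c) = etaMultiplier a b c d * zeta24 m := by
  have hJ : J(d + m * c | c) = J(d | c) := by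
    rw [jacobiSym.mod_left (d + m * c), Int.add_mul_emod_self_right, ← jacobiSym.mod_left]
  rw [etaMultiplier, etaMultiplier, hJ, mul_assoc _ (zeta24 _), ← zeta24_add]
  congr 1
  apply zeta24_congr
  obtain ⟨r, hr⟩ := dvd_mul_sq_sub_one_of_odd (c := (c : ℤ)) (by exact_mod_cast hc)
  exact ⟨-(m * (2 * b + m * a) * r), by
    linear_combination -(m * (2 * b + m * a)) * hr - ((c : ℤ) ^ 2 - 1) * m * hdet⟩

lemma etaMultiplier_neg_natCast {a b : ℤ} {c n : ℕ} (hc : Odd c) (hn : Odd n)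
    (hdet : a * -n - b * c = 1) :
    etaMultiplier a b c (-n) = etaMultiplier (-b) a n c * zeta24 (-3) := by
  obtain ⟨k, hk⟩ := hc
  obtain ⟨l, hl⟩ := hn
  have hk' : (c : ℤ) = 2 * k + 1 := by lia
  have hl' : (n : ℤ) = 2 * l + 1 := by lia
  rw [etaMultiplier, etaMultiplier, jacobiSym_neg_of_eq hk, jacobiSym_natCast_reciprocity hl hk]
  push_cast
  rw [neg_one_pow_eq_zeta24, neg_one_pow_eq_zeta24]
  have hzeta : zeta24 (12 * k) * zeta24 (12 * (l * k : ℕ)) *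
      zeta24 ((a + -n) * c - b * -n * (c ^ 2 - 1) - 3 * c + 3) =
        zeta24 ((-b + c) * n - a * c * (n ^ 2 - 1) - 3 * n + 3) * zeta24 (-3) := by
    rw [← zeta24_add, ← zeta24_add, ← zeta24_add]
    congr 1
    push_cast
    linear_combination -(c : ℤ) * n * hdet - 3 * ((n : ℤ) + 1) * hk' - 6 * (k : ℤ) * hl'
  linear_combination (J((c : ℤ) | n) : ℂ) * hzeta

lemma etaMultiplier_natCast {a b : ℤ} {c n : ℕ} (hc : Odd c) (hn : Odd n)
    (hdet : a * n - b * c = 1) :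
    etaMultiplier a b c n = etaMultiplier b (-a) n (-c) * zeta24 3 := by
  obtain ⟨k, hk⟩ := hc
  obtain ⟨l, hl⟩ := hn
  have hk' : (c : ℤ) = 2 * k + 1 := by lia
  have hl' : (n : ℤ) = 2 * l + 1 := by lia
  rw [etaMultiplier, etaMultiplier, jacobiSym_neg_of_eq hl, jacobiSym_natCast_reciprocity hl hk]
  push_cast
  rw [neg_one_pow_eq_zeta24, neg_one_pow_eq_zeta24]
  have hzeta : zeta24 (12 * (l * k : ℕ)) * zeta24 ((a + n) * c - b * n * (c ^ 2 - 1) - 3 * c + 3) =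
      zeta24 (12 * l) * zeta24 ((b + -c) * n - -a * -c * (n ^ 2 - 1) - 3 * n + 3) * zeta24 3 := by
    rw [← zeta24_add, ← zeta24_add, ← zeta24_add]
    refine zeta24_congr ⟨(l * k : ℤ), ?_⟩
    push_cast
    linear_combination (c : ℤ) * n * hdet + 3 * ((n : ℤ) - 1) * hk' + 6 * ((k : ℤ) + 1) * hl'
  linear_combination (J((c : ℤ) | n) : ℂ) * hzeta

lemma exists_odd_add_mul_lt {c : ℕ} (hc : Odd c) (hc1 : 1 < c) {d : ℤ} (hcd : ¬(c : ℤ) ∣ d) :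
    ∃ m : ℤ, Odd (d + m * c) ∧ |d + m * c| < c := by
  have hnonneg := Int.emod_nonneg d (show (c : ℤ) ≠ 0 by lia)
  have hlt := Int.emod_lt_of_pos d (show (0 : ℤ) < c by lia)
  have hdiv := Int.emod_add_mul_ediv d c
  rcases Int.even_or_odd (d % c) with h | h
  · refine ⟨-(d / c) - 1, ?_⟩
    rw [show d + (-(d / c) - 1) * c = d % c - c by linear_combination -hdiv]
    have : d % c ≠ 0 := fun h0 ↦ hcd (Int.dvd_of_emod_eq_zero h0)
    exact ⟨h.sub_odd (by exact_mod_cast hc), abs_lt.2 ⟨by lia, by lia⟩⟩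
  · refine ⟨-(d / c), ?_⟩
    rw [show d + -(d / c) * c = d % c by linear_combination -hdiv]
    exact ⟨h, abs_lt.2 ⟨by lia, hlt⟩⟩

lemma hasEtaMultiplier_one {a b d : ℤ} (hdet : a * d - b = 1) :
    HasEtaMultiplier a b 1 d (etaMultiplier a b 1 d) := by
  intro τ hτ
  have hτd := ne_zero_of_im_pos (intCast_mul_add_im_pos one_pos d hτ)
  have hb : (b : ℂ) = a * d - 1 := by exact_mod_cast (by linear_combination -hdet : b = a * d - 1)
  have hquot : ((a : ℂ) * τ + b) / ((1 : ℤ) * τ + d) = -1 / (τ + d) + a := by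
    rw [hb]; push_cast at hτd ⊢; rw [one_mul] at hτd ⊢; field_simp; ring
  have hexp : (a + d) * (1 : ℕ) - b * d * ((1 : ℕ) ^ 2 - 1) - 3 * (1 : ℕ) + 3 = a + d := by
    push_cast; ring
  rw [hquot, eta_add_intCast, eta_neg_one_div (by simpa using hτ), eta_add_intCast,
    etaMultiplier, jacobiSym.one_right, hexp, zeta24_add, zeta24, zeta24]
  simp only [Int.cast_one, one_mul]
  ring

/-- Induction on `c`: adding a multiple of `c` to `d` makes `d` odd and `|d| < c`, and multiplying
by `S` then exchanges `c` with `|d|`. -/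
theorem hasEtaMultiplier_of_odd {c : ℕ} (hc : Odd c) {a b d : ℤ} (hdet : a * d - b * c = 1) :
    HasEtaMultiplier a b c d (etaMultiplier a b c d) := by
  induction c using Nat.strong_induction_on generalizing a b d with
  | _ c ih =>
  obtain rfl | hc1 : c = 1 ∨ 1 < c := by have := hc.pos; lia
  · exact hasEtaMultiplier_one (by simpa using hdet)
  have hcd : ¬(c : ℤ) ∣ d := fun h ↦ by
    have := Int.le_of_dvd one_pos (hdet ▸ dvd_sub (h.mul_left a) (dvd_mul_left _ b))
    lia
  have of_abs_lt {b d : ℤ} (hdet : a * d - b * c = 1) (hd : Odd d) (hlt : |d| < c) :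
      HasEtaMultiplier a b c d (etaMultiplier a b c d) := by
    obtain ⟨n, rfl | rfl⟩ := d.eq_nat_or_neg
    · have hn : Odd n := by exact_mod_cast hd
      have hpos := hn.pos
      rw [etaMultiplier_natCast hc hn hdet]
      simpa using (ih n (by simpa using hlt) hn (a := b) (b := -a) (d := -c)
        (by linear_combination hdet)).mul_S_inv (by lia) (by lia)
    · have hn : Odd n := by exact_mod_cast odd_neg.1 hd
      have hpos := hn.pos
      rw [etaMultiplier_neg_natCast hc hn hdet]
      simpa using (ih n (by simpa using hlt) hn (a := -b) (b := a) (d := c)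
        (by linear_combination hdet)).mul_S (by lia) (by lia)
  obtain ⟨m, hodd, hlt⟩ := exists_odd_add_mul_lt hc hc1 hcd
  have h := (of_abs_lt (b := b + m * a) (by linear_combination hdet) hodd hlt).add_mul (-m)
  rw [etaMultiplier_add_mul hc hdet, mul_assoc, ← zeta24_add, add_neg_cancel] at h
  simpa [zeta24, e_zero] using h

theorem hasEtaMultiplier_of_pos_of_odd {a b : ℤ} {c d : ℕ} (hc : 0 < c) (hd : Odd d)
    (hdet : a * d - b * c = 1) :
    HasEtaMultiplier a b c d ((J((c : ℤ) | d) : ℤ) *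
      zeta24 (a * c - 2 * c * d - b * d * c ^ 2 + b * d + 3 * d)) := by
  have h := (hasEtaMultiplier_of_odd hd (a := b) (b := -a) (d := -c)
    (by linear_combination hdet)).mul_S_inv (by exact_mod_cast hd.pos) (by lia)
  simp only [neg_neg] at h
  convert! h using 1
  obtain ⟨l, hl⟩ := hd
  have hl' : (d : ℤ) = 2 * l + 1 := by lia
  rw [etaMultiplier, jacobiSym_neg_of_eq hl]
  push_cast
  rw [neg_one_pow_eq_zeta24]
  have hzeta : zeta24 (a * c - 2 * c * d - b * d * c ^ 2 + b * d + 3 * d) =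
      zeta24 (12 * l) * zeta24 ((b + -c) * d - -a * -c * (d ^ 2 - 1) - 3 * d + 3) * zeta24 3 := by
    rw [← zeta24_add, ← zeta24_add]
    congr 1
    linear_combination (c : ℤ) * d * hdet + 6 * hl'
  linear_combination (J((c : ℤ) | d) : ℂ) * hzeta

end EtaMultiplier

/-! ### Transformation of eta quotients -/

section EtaQuotients

open scoped NumberTheorySymbols

/-- The eta quotient `∏ η(kw) ^ r` over the pairs `(k, r)` of a list. -/
noncomputable def etaQuot (l : List (ℕ × ℤ)) (w : ℂ) : ℂ :=
  (l.map fun p => ModularForm.eta (p.1 * w) ^ p.2).prod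

/-- The sum of the exponents of an eta quotient, which is twice its weight. -/
def expSum (l : List (ℕ × ℤ)) : ℤ := (l.map Prod.snd).sum

/-- `∑ r k`, which is `24` times the order of the eta quotient at `∞`. -/
def expOrder (l : List (ℕ × ℤ)) : ℤ := (l.map fun p => p.2 * (p.1 : ℤ)).sum

/-- `∑ r n / k`, which is `24` times the order at `0` of the eta quotient, in the local parameter of
level `n`. The natural division is exact in all uses. -/
def expCoOrder (n : ℕ) (l : List (ℕ × ℤ)) : ℤ := (l.map fun p => p.2 * ((n / p.1 : ℕ) : ℤ)).sum

/-- `∏ k ^ |r|`, whose Jacobi symbol is the quadratic character of an eta quotient. -/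
def expProd (l : List (ℕ × ℤ)) : ℕ := (l.map fun p => p.1 ^ p.2.natAbs).prod

lemma etaQuot_cons (p : ℕ × ℤ) (l : List (ℕ × ℤ)) (w : ℂ) :
    etaQuot (p :: l) w = ModularForm.eta (p.1 * w) ^ p.2 * etaQuot l w := by simp [etaQuot]

lemma expSum_cons (p : ℕ × ℤ) (l : List (ℕ × ℤ)) : expSum (p :: l) = p.2 + expSum l := by
  simp [expSum]

lemma expOrder_cons (p : ℕ × ℤ) (l : List (ℕ × ℤ)) :
    expOrder (p :: l) = p.2 * p.1 + expOrder l := by simp [expOrder]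

lemma expCoOrder_cons (n : ℕ) (p : ℕ × ℤ) (l : List (ℕ × ℤ)) :
    expCoOrder n (p :: l) = p.2 * ((n / p.1 : ℕ) : ℤ) + expCoOrder n l := by simp [expCoOrder]

lemma expProd_cons (p : ℕ × ℤ) (l : List (ℕ × ℤ)) :
    expProd (p :: l) = p.1 ^ p.2.natAbs * expProd l := by simp [expProd]

lemma expCoOrder_mul {n : ℕ} {l : List (ℕ × ℤ)} (hl : ∀ p ∈ l, p.1 ∣ n) (m : ℕ) :
    expCoOrder (n * m) l = m * expCoOrder n l := by
  induction l with
  | nil => simp [expCoOrder]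
  | cons p l ih =>
    rw [List.forall_mem_cons] at hl
    rw [expCoOrder_cons, expCoOrder_cons, ih hl.2, Nat.mul_div_right_comm hl.1]
    push_cast; ring

lemma isCoprime_expProd {n : ℕ} {d : ℤ} (hnd : IsCoprime (n : ℤ) d) {l : List (ℕ × ℤ)}
    (hl : ∀ p ∈ l, p.1 ∣ n) : IsCoprime (expProd l : ℤ) d := by
  induction l with
  | nil => simpa [expProd] using isCoprime_one_left
  | cons p l ih =>
    rw [List.forall_mem_cons] at hl
    rw [expProd_cons]
    push_cast
    exact .mul_left (.pow_left (hnd.of_isCoprime_of_dvd_left (by exact_mod_cast hl.1))) (ih hl.2)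

lemma zeta24_zero : zeta24 0 = 1 := by simp [zeta24, e_zero]

lemma zeta24_zpow (x r : ℤ) : zeta24 x ^ r = zeta24 (r * x) := by
  rw [zeta24, ← e_intCast_mul, zeta24]; congr 1; push_cast; ring

lemma etaQuot_add_intCast (l : List (ℕ × ℤ)) (w : ℂ) (t : ℤ) :
    etaQuot l (w + t) = zeta24 (t * expOrder l) * etaQuot l w := by
  induction l with
  | nil => simp [etaQuot, expOrder, zeta24_zero]
  | cons p l ih =>
    have harg : (p.1 : ℂ) * (w + t) = p.1 * w + ((p.1 * t : ℤ) : ℂ) := by push_cast; ring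
    have hzeta : e (((p.1 * t : ℤ) : ℂ) / 24) ^ p.2 = zeta24 (t * (p.2 * p.1)) := by
      rw [← zeta24, zeta24_zpow]; congr 1; ring
    rw [etaQuot_cons, etaQuot_cons, ih, expOrder_cons, mul_add t, zeta24_add, harg,
      eta_add_intCast, mul_zpow, hzeta]
    ring

lemma zpow_eq_pow_natAbs_of_sq_eq_one {x : ℂ} (hx : x ^ 2 = 1) (r : ℤ) : x ^ r = x ^ r.natAbs := by
  have hinv : x⁻¹ = x := inv_eq_of_mul_eq_one_left (by rw [← sq, hx])
  obtain ⟨n, rfl | rfl⟩ := r.eq_nat_or_neg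
  · simp
  · rw [zpow_neg, zpow_natCast, ← inv_pow, hinv, Int.natAbs_neg, Int.natAbs_natCast]

lemma jacobiSym_sq_eq_one {a : ℤ} {d : ℕ} (h : IsCoprime a d) : ((J(a | d) : ℤ) : ℂ) ^ 2 = 1 := by
  exact_mod_cast jacobiSym.sq_one (Int.isCoprime_iff_gcd_eq_one.1 h)

lemma jacobiSym_ne_zero {a : ℤ} {d : ℕ} (h : IsCoprime a d) : ((J(a | d) : ℤ) : ℂ) ≠ 0 := by
  exact_mod_cast jacobiSym.ne_zero (Int.isCoprime_iff_gcd_eq_one.1 h)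

lemma jacobiSym_pow_natAbs_mul {k : ℤ} {d : ℕ} (h : IsCoprime k d) (r x : ℤ) :
    ((J(k ^ r.natAbs * x | d) : ℤ) : ℂ) = ((J(k | d) : ℤ) : ℂ) ^ r * ((J(x | d) : ℤ) : ℂ) := by
  rw [zpow_eq_pow_natAbs_of_sq_eq_one (jacobiSym_sq_eq_one h), jacobiSym.mul_left,
    jacobiSym.pow_left]
  push_cast; ring

lemma sqrt_ne_zero {x : ℂ} (hx : x ≠ 0) : Complex.sqrt x ≠ 0 := fun h ↦
  hx (by rw [← sqrt_sq x, h, zero_pow two_ne_zero])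

lemma isCoprime_of_det {a b c d : ℤ} (hdet : a * d - b * c = 1) : IsCoprime c d :=
  ⟨-b, a, by linear_combination hdet⟩

lemma eta_natCast_mul_multiplier {k c d : ℕ} {a b : ℤ} (hkc : k ∣ c) (hc : 0 < c) (hd : Odd d)
    (hdet : a * d - b * c = 1) {w : ℂ} (hw : 0 < w.im) :
    ModularForm.eta (k * ((a * w + b) / (c * w + d))) =
      ((J((c : ℤ) | d) : ℤ) : ℂ) * Complex.sqrt (-I * (c * w + d)) * ((J((k : ℤ) | d) : ℤ) : ℂ) *
        zeta24 ((a - 2 * d - b * d * c) * (c / k : ℕ) + b * d * k + 3 * d) *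
          ModularForm.eta (k * w) := by
  have hk := Nat.pos_of_dvd_of_pos hkc hc
  obtain ⟨t, rfl⟩ := hkc
  have hJ : ((J((t : ℤ) | d) : ℤ) : ℂ) =
      ((J(((k * t : ℕ) : ℤ) | d) : ℤ) : ℂ) * ((J((k : ℤ) | d) : ℤ) : ℂ) := by
    have hkd : IsCoprime (k : ℤ) d :=
      (isCoprime_of_det hdet).of_isCoprime_of_dvd_left (by push_cast; exact dvd_mul_right _ _)
    have hsq := jacobiSym_sq_eq_one hkd
    rw [show ((k * t : ℕ) : ℤ) = k * t by push_cast; ring, jacobiSym.mul_left]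
    push_cast
    linear_combination (-(J((t : ℤ) | d) : ℂ)) * hsq
  have hlaw := hasEtaMultiplier_of_pos_of_odd (a := a) (b := k * b) (Nat.pos_of_mul_pos_left hc) hd
    (by rw [← hdet]; push_cast; ring) (k * w) (natCast_mul_im_pos hk hw)
  have hquot : ((a : ℂ) * (k * w) + (k * b : ℤ)) / ((t : ℤ) * (k * w) + (d : ℤ)) =
      k * ((a * w + b) / ((k * t : ℕ) * w + d)) := by
    push_cast; ring
  have hdenom : ((t : ℤ) : ℂ) * (k * w) + (d : ℤ) = (k * t : ℕ) * w + d := by push_cast; ring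
  have hexp : a * t - 2 * t * d - k * b * d * t ^ 2 + k * b * d + 3 * d =
      (a - 2 * d - b * d * (k * t : ℕ)) * (t : ℕ) + b * d * k + 3 * d := by push_cast; ring
  rw [hquot, hdenom, hJ, hexp] at hlaw
  rw [hlaw, Nat.mul_div_cancel_left _ hk]
  ring

lemma etaQuot_multiplier {c d : ℕ} {a b : ℤ} (hc : 0 < c) (hd : Odd d)
    (hdet : a * d - b * c = 1) {l : List (ℕ × ℤ)} (hl : ∀ p ∈ l, p.1 ∣ c) {w : ℂ}
    (hw : 0 < w.im) :
    etaQuot l ((a * w + b) / (c * w + d)) =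
      (((J((c : ℤ) | d) : ℤ) : ℂ) * Complex.sqrt (-I * (c * w + d))) ^ expSum l *
        ((J((expProd l : ℤ) | d) : ℤ) : ℂ) *
        zeta24 ((a - 2 * d - b * d * c) * expCoOrder c l + b * d * expOrder l
          + 3 * d * expSum l) * etaQuot l w := by
  have hcd := isCoprime_of_det hdet
  have hJ := jacobiSym_ne_zero hcd
  have hsqrt : Complex.sqrt (-I * (c * w + d)) ≠ 0 :=
    sqrt_ne_zero (mul_ne_zero (neg_ne_zero.2 I_ne_zero) (by
      exact_mod_cast ne_zero_of_im_pos (intCast_mul_add_im_pos (by exact_mod_cast hc) d hw)))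
  induction l with
  | nil => simp [etaQuot, expSum, expProd, expCoOrder, expOrder, zeta24_zero]
  | cons p l ih =>
    obtain ⟨k, r⟩ := p
    rw [List.forall_mem_cons] at hl
    have hkd : IsCoprime (k : ℤ) d :=
      hcd.of_isCoprime_of_dvd_left (by exact_mod_cast hl.1)
    have hexp : (a - 2 * d - b * d * c) * (r * (c / k : ℕ) + expCoOrder c l)
          + b * d * (r * k + expOrder l) + 3 * d * (r + expSum l) =
        r * ((a - 2 * d - b * d * c) * (c / k : ℕ) + b * d * k + 3 * d) +
        ((a - 2 * d - b * d * c) * expCoOrder c l + b * d * expOrder l + 3 * d * expSum l) := by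
      ring
    simp only [etaQuot_cons, expSum_cons, expOrder_cons, expCoOrder_cons, expProd_cons]
    rw [ih hl.2, eta_natCast_mul_multiplier hl.1 hc hd hdet hw, hexp, zeta24_add (r * _),
      ← zeta24_zpow _ r, zpow_add₀ (mul_ne_zero hJ hsqrt)]
    push_cast
    rw [jacobiSym_pow_natAbs_mul hkd]
    simp only [mul_zpow]
    ring

/-- The congruences, in the style of the Gordon–Hughes–Newman criterion, under which an eta quotient
transforms under `Γ₀(n)` with weight `2j` and multiplier `e (cd / (nh))`. -/
structure NewmanCriterion (n h : ℕ) (j : ℤ) (l : List (ℕ × ℤ)) : Prop where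
  level_pos : 0 < n
  dvd_level : ∀ p ∈ l, p.1 ∣ n
  expSum_eq : expSum l = 4 * j
  h_dvd_level : h ∣ n
  h_dvd : h ∣ 24
  dvd_expOrder : (24 : ℤ) ∣ expOrder l
  dvd_expCoOrder_add : (24 : ℤ) ∣ expCoOrder n l + (24 / h : ℕ)
  isSquare_expProd : IsSquare (expProd l)

instance (n h : ℕ) (j : ℤ) (l : List (ℕ × ℤ)) : Decidable (NewmanCriterion n h j l) :=
  decidable_of_iff (0 < n ∧ (∀ p ∈ l, p.1 ∣ n) ∧ expSum l = 4 * j ∧ h ∣ n ∧ h ∣ 24 ∧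
      (24 : ℤ) ∣ expOrder l ∧ (24 : ℤ) ∣ expCoOrder n l + (24 / h : ℕ) ∧ IsSquare (expProd l))
    ⟨fun ⟨h₁, h₂, h₃, h₄, h₅, h₆, h₇, h₈⟩ => ⟨h₁, h₂, h₃, h₄, h₅, h₆, h₇, h₈⟩,
      fun ⟨h₁, h₂, h₃, h₄, h₅, h₆, h₇, h₈⟩ => ⟨h₁, h₂, h₃, h₄, h₅, h₆, h₇, h₈⟩⟩

lemma dvd_one_sub_sq_mul {d : ℤ} (hd : Odd d) (x : ℤ) (h : IsCoprime 3 d ∨ (3 : ℤ) ∣ x) :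
    (24 : ℤ) ∣ (1 - d ^ 2) * x := by
  have h8 : (8 : ℤ) ∣ 1 - d ^ 2 := (dvd_sub_comm).1 (Int.eight_dvd_sq_sub_one_of_odd hd)
  have h3 : (3 : ℤ) ∣ (1 - d ^ 2) * x := by
    refine h.elim (fun hd3 ↦ Dvd.dvd.mul_right ?_ x) fun hx ↦ hx.mul_left _
    have hd0 : (d : ZMod 3) ≠ 0 := fun h0 ↦ by
      have := hd3.isUnit_of_dvd' dvd_rfl ((ZMod.intCast_zmod_eq_zero_iff_dvd d 3).1 h0)
      rw [Int.isUnit_iff] at this; lia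
    have hmod : ∀ x : ZMod 3, x ≠ 0 → 1 - x ^ 2 = 0 := by decide
    exact (ZMod.intCast_zmod_eq_zero_iff_dvd _ 3).1 (by push_cast; exact hmod d hd0)
  exact IsCoprime.mul_dvd (x := 3) (y := 8) ⟨3, -1, by norm_num⟩ h3 (h8.mul_right x)

lemma e_eq_of_eq_add_intCast {x y : ℂ} (k : ℤ) (h : x = y + k) : e x = e y := by
  rw [h, e_add, e_intCast, mul_one]

lemma mul_sqrt_neg_I_mul_zpow {x : ℂ} (hx : x ^ 2 = 1) (y : ℂ) (j : ℤ) :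
    (x * Complex.sqrt (-I * y)) ^ (4 * j) = (-1) ^ j * y ^ (2 * j) := by
  have hfour : (x * Complex.sqrt (-I * y)) ^ 4 = -1 * y ^ 2 := by
    calc (x * Complex.sqrt (-I * y)) ^ 4
        = (x ^ 2) ^ 2 * (Complex.sqrt (-I * y) ^ 2) ^ 2 := by ring
      _ = -1 * y ^ 2 := by rw [hx, sqrt_sq]; linear_combination y ^ 2 * I_sq
  rw [zpow_mul, zpow_ofNat, hfour, mul_zpow, zpow_mul, zpow_ofNat]

namespace NewmanCriterion

variable {n h : ℕ} {j : ℤ} {l : List (ℕ × ℤ)} (H : NewmanCriterion n h j l)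

include H

lemma h_pos : 0 < h := Nat.pos_of_dvd_of_pos H.h_dvd_level H.level_pos

lemma etaQuot_add_intCast (w : ℂ) (t : ℤ) : etaQuot l (w + t) = etaQuot l w := by
  rw [MathieuMoonshine.etaQuot_add_intCast,
    zeta24_congr (y := 0) (by simpa using H.dvd_expOrder.mul_left t), zeta24_zero, one_mul]

lemma jacobiSym_expProd {d : ℕ} (hnd : IsCoprime (n : ℤ) d) : J(expProd l | d) = 1 := by
  have hcop := isCoprime_expProd hnd H.dvd_level
  obtain ⟨s, hs⟩ := H.isSquare_expProd
  rw [hs, ← sq] at hcop ⊢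
  push_cast at hcop ⊢
  exact jacobiSym.sq_one' (Int.isCoprime_iff_gcd_eq_one.1
    ((IsCoprime.pow_left_iff two_pos).1 hcop))

lemma three_dvd : 3 ∣ n ∨ (3 : ℤ) ∣ expCoOrder n l := by
  obtain ⟨s, hs⟩ := H.h_dvd
  have hdvd := H.dvd_expCoOrder_add
  rw [hs, Nat.mul_div_cancel_left _ H.h_pos] at hdvd
  rcases Nat.prime_three.dvd_mul.1 (hs ▸ (by norm_num : 3 ∣ 24)) with h3 | h3
  · exact .inl (h3.trans H.h_dvd_level)
  · exact .inr (by lia)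

lemma e_div_mul_h {c d : ℕ} {m : ℕ} (hc : c = n * m) :
    e (c * d / (n * h)) = zeta24 (m * d * (24 / h : ℕ)) := by
  obtain ⟨s, hs⟩ := H.h_dvd
  have hn0 : (n : ℂ) ≠ 0 := by exact_mod_cast H.level_pos.ne'
  have hh0 : (h : ℂ) ≠ 0 := by exact_mod_cast H.h_pos.ne'
  have hsC : (24 : ℂ) = h * s := by exact_mod_cast hs
  have hs0 : (s : ℂ) ≠ 0 := by rintro h0; rw [h0] at hsC; norm_num at hsC
  rw [zeta24, hs, Nat.mul_div_cancel_left _ H.h_pos, hc]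
  congr 1
  push_cast
  rw [hsC]; field_simp

lemma zeta24_eq {a b : ℤ} {m d : ℕ} (hd : Odd d) (hdet : a * d - b * (n * m : ℕ) = 1) :
    zeta24 ((a - 2 * d - b * d * (n * m : ℕ)) * (m * expCoOrder n l) + b * d * expOrder l
      + 3 * d * expSum l) = (-1) ^ j * zeta24 (m * d * (24 / h : ℕ)) := by
  have hsign : (-1 : ℂ) ^ j = zeta24 (j * (12 * d)) := by
    rw [← zeta24_zpow, ← neg_one_pow_eq_zeta24, hd.neg_one_pow]
  have hnd : IsCoprime (n : ℤ) d :=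
    (isCoprime_of_det hdet).of_isCoprime_of_dvd_left ⟨m, by push_cast; ring⟩
  have hsq : (24 : ℤ) ∣ (1 - (d : ℤ) ^ 2) * expCoOrder n l :=
    dvd_one_sub_sq_mul (by exact_mod_cast hd) _ (H.three_dvd.imp_left fun h3 =>
      hnd.of_isCoprime_of_dvd_left (by exact_mod_cast h3))
  rw [hsign, ← zeta24_add]
  apply zeta24_congr
  convert! dvd_add (dvd_sub (hsq.mul_left (m * a)) (H.dvd_expCoOrder_add.mul_left (m * d)))
    (H.dvd_expOrder.mul_left (b * d)) using 1
  rw [H.expSum_eq]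
  push_cast at hdet ⊢
  linear_combination (m * d * expCoOrder n l : ℤ) * hdet

theorem etaQuot_smul_of_pos_of_odd {c d : ℕ} {a b : ℤ} (hc : 0 < c) (hnc : n ∣ c) (hd : Odd d)
    (hdet : a * d - b * c = 1) {w : ℂ} (hw : 0 < w.im) :
    etaQuot l ((a * w + b) / (c * w + d)) =
      e (c * d / (n * h)) * (c * w + d) ^ (2 * j) * etaQuot l w := by
  have hcd := isCoprime_of_det hdet
  have hnd : IsCoprime (n : ℤ) d := hcd.of_isCoprime_of_dvd_left (by exact_mod_cast hnc)
  rw [etaQuot_multiplier hc hd hdet (fun p hp ↦ (H.dvd_level p hp).trans hnc) hw]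
  obtain ⟨m, rfl⟩ := hnc
  have hsign : ((-1 : ℂ) ^ j) * (-1) ^ j = 1 := by rw [← mul_zpow]; norm_num
  rw [expCoOrder_mul H.dvd_level, H.jacobiSym_expProd hnd, H.zeta24_eq hd hdet, H.expSum_eq,
    mul_sqrt_neg_I_mul_zpow (jacobiSym_sq_eq_one hcd), H.e_div_mul_h rfl]
  rw [Int.cast_one]
  linear_combination
    (zeta24 (m * d * (24 / h : ℕ)) * ((n * m : ℕ) * w + d) ^ (2 * j) * etaQuot l w) * hsign

end NewmanCriterion

lemma exists_pos_odd_add_mul {c d : ℤ} (hc : 0 < c) (h : Odd c ∨ Odd d) :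
    ∃ t : ℤ, 0 < d + t * c ∧ Odd (d + t * c) := by
  have hpos (t : ℤ) (ht : |d| + 1 ≤ t) : 0 < d + t * c := by
    have := neg_abs_le d
    nlinarith [abs_nonneg d]
  by_cases hodd : Odd (d + (|d| + 1) * c)
  · exact ⟨_, hpos _ le_rfl, hodd⟩
  by_cases hc' : Odd c
  · refine ⟨|d| + 1 + 1, hpos _ (by lia), ?_⟩
    rw [add_mul (|d| + 1), one_mul, ← add_assoc]
    exact (Int.not_odd_iff_even.1 hodd).add_odd hc'
  · exact absurd ((h.resolve_left hc').add_even
      ((Int.not_odd_iff_even.1 hc').mul_left _)) hodd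

lemma odd_or_odd_of_det {a b c d : ℤ} (hdet : a * d - b * c = 1) : Odd c ∨ Odd d := by
  by_contra! h
  exact Int.not_even_one (hdet ▸ ((Int.not_odd_iff_even.1 h.2).mul_left a).sub
    ((Int.not_odd_iff_even.1 h.1).mul_left b))

namespace NewmanCriterion

variable {n h : ℕ} {j : ℤ} {l : List (ℕ × ℤ)} (H : NewmanCriterion n h j l)

include H

lemma e_add_mul_self {c d : ℤ} (hnc : (n : ℤ) ∣ c) (t : ℤ) :
    e (c * (d + t * c) / (n * h)) = e (c * d / (n * h)) := by
  obtain ⟨m, rfl⟩ := hnc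
  obtain ⟨u, hu⟩ := H.h_dvd_level
  have hh0 : (h : ℂ) ≠ 0 := by exact_mod_cast H.h_pos.ne'
  have hn0 : (n : ℂ) ≠ 0 := by exact_mod_cast H.level_pos.ne'
  have hnu : (n : ℂ) = h * u := by exact_mod_cast hu
  apply e_eq_of_eq_add_intCast (t * u * m ^ 2)
  push_cast
  field_simp
  rw [hnu]; ring

theorem etaQuot_smul_of_pos {a b c d : ℤ} (hc : 0 < c) (hdet : a * d - b * c = 1)
    (hnc : (n : ℤ) ∣ c) {w : ℂ} (hw : 0 < w.im) :
    etaQuot l ((a * w + b) / (c * w + d)) =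
      e (c * d / (n * h)) * (c * w + d) ^ (2 * j) * etaQuot l w := by
  obtain ⟨t, ht, hodd⟩ := exists_pos_odd_add_mul hc (odd_or_odd_of_det hdet)
  have hper : etaQuot l (w - t) = etaQuot l w := by
    simpa using (H.etaQuot_add_intCast (w - t) t).symm
  rw [← H.e_add_mul_self hnc t, ← hper]
  lift c to ℕ using hc.le
  obtain ⟨D, hD⟩ := Int.eq_ofNat_of_zero_le ht.le
  have hDC : (D : ℂ) = d + t * c := by exact_mod_cast hD.symm
  have hlaw := H.etaQuot_smul_of_pos_of_odd (a := a) (b := b + t * a) (d := D)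
    (by exact_mod_cast hc) (by exact_mod_cast hnc) (by rw [hD] at hodd; exact_mod_cast hodd)
    (by rw [← hD]; linear_combination hdet) (w := w - t) (by simpa using hw)
  rw [hDC, show (a : ℂ) * (w - t) + (b + t * a : ℤ) = a * w + b by push_cast; ring,
    show (c : ℂ) * (w - t) + (d + t * c) = c * w + d by ring] at hlaw
  exact_mod_cast hlaw

theorem etaQuot_smul {a b c d : ℤ} (hdet : a * d - b * c = 1) (hnc : (n : ℤ) ∣ c) {w : ℂ}
    (hw : 0 < w.im) :
    etaQuot l ((a * w + b) / (c * w + d)) =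
      e (c * d / (n * h)) * (c * w + d) ^ (2 * j) * etaQuot l w := by
  rcases lt_trichotomy c 0 with hc | rfl | hc
  · have hlaw := H.etaQuot_smul_of_pos (a := -a) (b := -b) (c := -c) (d := -d) (by lia)
      (by rw [← hdet]; ring) (by simpa using hnc) hw
    push_cast at hlaw
    rw [show (-(a : ℂ) * w + -b) = -(a * w + b) by ring,
      show (-(c : ℂ) * w + -d) = -(c * w + d) by ring, neg_div_neg_eq, neg_mul_neg,
      Even.neg_zpow (even_two_mul j)] at hlaw
    exact hlaw
  · rw [mul_zero, sub_zero] at hdet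
    obtain ⟨rfl, rfl⟩ | ⟨rfl, rfl⟩ := Int.mul_eq_one_iff_eq_one_or_neg_one.1 hdet
    · simpa [e_zero] using H.etaQuot_add_intCast w b
    · simpa [e_zero, Even.neg_zpow (even_two_mul j), div_neg, neg_add_rev, add_comm]
        using H.etaQuot_add_intCast w (-b)
  · exact H.etaQuot_smul_of_pos hc hdet hnc hw

end NewmanCriterion

end EtaQuotients

/-! ### Behaviour of eta quotients at the cusps -/

section Cusps

open Filter Topology

lemma det_eq_one (γ : SL(2, ℤ)) : γ 0 0 * γ 1 1 - γ 0 1 * γ 1 0 = 1 := by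
  exact_mod_cast coe_det_eq_one γ

/-- The action `τ ↦ (Aτ + B) / D` of an upper triangular matrix on the upper half plane. -/
noncomputable def affineMap (A D : ℕ) (B : ℤ) (hA : 0 < A) (hD : 0 < D) (τ : ℍ) : ℍ :=
  ⟨(A * τ + B) / D, by
    have him : (((A : ℂ) * τ + B) / D).im = A * τ.im / D := by
      rw [Complex.div_natCast_im]; simp
    have := τ.im_pos
    rw [him]; positivity⟩

variable {A D : ℕ} {B : ℤ}

lemma coe_affineMap (hA : 0 < A) (hD : 0 < D) (τ : ℍ) :
    ((affineMap A D B hA hD τ : ℍ) : ℂ) = (A * τ + B) / D := rfl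

lemma im_affineMap (hA : 0 < A) (hD : 0 < D) (τ : ℍ) :
    (affineMap A D B hA hD τ).im = A * τ.im / D := by
  rw [← coe_im, coe_affineMap, Complex.div_natCast_im]; simp

lemma tendsto_affineMap (hA : 0 < A) (hD : 0 < D) :
    Tendsto (affineMap A D B hA hD) atImInfty atImInfty := by
  rw [atImInfty, tendsto_comap_iff]
  have him : UpperHalfPlane.im ∘ affineMap A D B hA hD = fun τ : ℍ => (A / D : ℝ) * τ.im := by
    funext τ
    rw [Function.comp_apply, im_affineMap]; ring
  rw [him]
  exact tendsto_comap.const_mul_atTop (by positivity)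

theorem exists_mul_eq_mul_upperTriangular (γ : SL(2, ℤ)) {k : ℕ} (hk : 0 < k) :
    ∃ (γ' : SL(2, ℤ)) (D : ℕ) (B : ℤ), Int.gcd k (γ 1 0) * D = k ∧
      !![(k : ℤ), 0; 0, 1] * γ.1 = γ'.1 * !![(Int.gcd k (γ 1 0) : ℤ), B; 0, (D : ℤ)] := by
  have hdet : γ.1 0 0 * γ.1 1 1 - γ.1 0 1 * γ.1 1 0 = 1 := det_eq_one γ
  change ∃ (γ' : SL(2, ℤ)) (D : ℕ) (B : ℤ), Int.gcd k (γ.1 1 0) * D = k ∧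
      !![(k : ℤ), 0; 0, 1] * γ.1 = γ'.1 * !![(Int.gcd k (γ.1 1 0) : ℤ), B; 0, (D : ℤ)]
  obtain ⟨D, r, hDr, hkD, hr⟩ := Int.exists_gcd_one (m := k) (n := γ.1 1 0)
    (Int.gcd_pos_of_ne_zero_left _ (by exact_mod_cast hk.ne'))
  generalize Int.gcd k (γ.1 1 0) = A at *
  lift D to ℕ using by
    by_contra! hD
    have := mul_nonpos_of_nonpos_of_nonneg hD.le (Int.natCast_nonneg A)
    lia
  have har : IsCoprime (γ.1 0 0) r := ⟨γ.1 1 1, -γ.1 0 1 * A, by rw [hr] at hdet; linarith⟩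
  obtain ⟨s, t, hst⟩ := (Int.isCoprime_iff_gcd_eq_one.2 hDr).mul_left har
  let γ' : SL(2, ℤ) :=
    ⟨!![D * γ.1 0 0, -t; r, s], by rw [Matrix.det_fin_two_of]; linear_combination hst⟩
  refine ⟨γ', D, s * k * γ.1 0 1 + t * γ.1 1 1, by rw [mul_comm]; exact_mod_cast hkD.symm, ?_⟩
  have hDc : D * γ.1 1 0 = k * r := by rw [hr, hkD]; ring
  have h00 : k * γ.1 0 0 = D * γ.1 0 0 * A := by rw [hkD]; ring
  have h01 : k * γ.1 0 1 = D * γ.1 0 0 * (s * k * γ.1 0 1 + t * γ.1 1 1) + -(t * D) := by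
    linear_combination (-k * γ.1 0 1) * hst - t * D * hdet - t * γ.1 0 1 * hDc
  have h11 : γ.1 1 1 = r * (s * k * γ.1 0 1 + t * γ.1 1 1) + s * D := by
    linear_combination (-γ.1 1 1) * hst + s * D * hdet + s * γ.1 0 1 * hDc
  rw [Matrix.eta_fin_two γ.1]
  simpa [γ'] using ⟨⟨h00, h01⟩, hr, h11⟩

section UpperTriangular

variable {γ γ' : SL(2, ℤ)} {k : ℕ} (hA : 0 < A) (hD : 0 < D)
  (h : !![(k : ℤ), 0; 0, 1] * γ.1 = γ'.1 * !![(A : ℤ), B; 0, (D : ℤ)]) (τ : ℍ)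

include h

lemma denom_affineMap : denom γ' (affineMap A D B hA hD τ) = denom γ τ / D := by
  have hc : (γ 1 0 : ℂ) = γ' 1 0 * A := by
    simpa [Matrix.mul_apply] using congrArg (Int.cast : ℤ → ℂ) (congrFun₂ h 1 0)
  have hd : (γ 1 1 : ℂ) = γ' 1 0 * B + γ' 1 1 * D := by
    simpa [Matrix.mul_apply] using congrArg (Int.cast : ℤ → ℂ) (congrFun₂ h 1 1)
  have hD0 : (D : ℂ) ≠ 0 := by exact_mod_cast hD.ne'
  rw [ModularGroup.denom_apply, ModularGroup.denom_apply, coe_affineMap, hc, hd]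
  field_simp
  ring

lemma coe_smul_affineMap :
    ((γ' • affineMap A D B hA hD τ : ℍ) : ℂ) = k * (γ • τ : ℍ) := by
  have ha : (k : ℂ) * γ 0 0 = γ' 0 0 * A := by
    simpa [Matrix.mul_apply] using congrArg (Int.cast : ℤ → ℂ) (congrFun₂ h 0 0)
  have hb : (k : ℂ) * γ 0 1 = γ' 0 0 * B + γ' 0 1 * D := by
    simpa [Matrix.mul_apply] using congrArg (Int.cast : ℤ → ℂ) (congrFun₂ h 0 1)
  have hD0 : (D : ℂ) ≠ 0 := by exact_mod_cast hD.ne'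
  rw [coe_smul_eq_div_denom, coe_smul_eq_div_denom, denom_affineMap hA hD h, coe_affineMap,
    div_div_eq_mul_div, ← mul_div_assoc]
  field_simp
  linear_combination -(τ : ℂ) * ha - hb

end UpperTriangular

lemma eta_smul_pow (γ : SL(2, ℤ)) (τ : ℍ) :
    ModularForm.eta (γ • τ : ℍ) ^ 24 = denom γ τ ^ 12 * ModularForm.eta τ ^ 24 := by
  have hslash := congrFun (SlashInvariantForm.slash_action_generators_SL2Z
    ModularForm.discriminant_S_invariant ModularForm.discriminant_T_invariant γ) τ
  rw [ModularForm.SL_slash_apply, zpow_neg, zpow_ofNat, ← div_eq_mul_inv,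
    div_eq_iff (pow_ne_zero _ (denom_ne_zero γ τ))] at hslash
  exact hslash.trans (mul_comm _ _)

lemma tendsto_norm_eta :
    Tendsto (fun τ : ℍ => ‖ModularForm.eta τ‖ ^ 24 * Real.exp (2 * π * τ.im)) atImInfty (𝓝 1) := by
  have hlim := tendsto_tprod_eta_q.norm.pow 24
  rw [norm_one, one_pow] at hlim
  refine hlim.congr fun τ => ?_
  have him : (τ / 24 : ℂ).im = τ.im / 24 := by simp
  have hexp : Real.exp (-2 * π * (τ.im / 24)) ^ 24 * Real.exp (2 * π * τ.im) = 1 := by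
    rw [← Real.exp_nat_mul, ← Real.exp_add, Real.exp_eq_one_iff]
    push_cast; ring
  rw [eta_eq_e_mul_tprod, norm_mul, mul_pow, norm_e, him, mul_right_comm, hexp, one_mul]

lemma tendsto_norm_eta_smul (γ : SL(2, ℤ)) {k : ℕ} (hk : 0 < k) :
    ∃ C : ℝ, C ≠ 0 ∧ Tendsto (fun τ : ℍ => ‖ModularForm.eta (k * (γ • τ : ℍ))‖ ^ 24 *
      (‖denom γ τ‖ ^ 12)⁻¹ * Real.exp (2 * π * ((Int.gcd k (γ 1 0) : ℝ) ^ 2 / k) * τ.im))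
      atImInfty (𝓝 C) := by
  obtain ⟨γ', D, B, hAD, hmat⟩ := exists_mul_eq_mul_upperTriangular γ hk
  have hA : 0 < Int.gcd k (γ 1 0) := Nat.pos_of_mul_pos_right (hAD ▸ hk)
  have hD : 0 < D := Nat.pos_of_mul_pos_left (hAD ▸ hk)
  refine ⟨((D : ℝ) ^ 12)⁻¹ * 1, by positivity, ?_⟩
  refine ((tendsto_norm_eta.comp (tendsto_affineMap (B := B) hA hD)).const_mul _).congr fun τ => ?_
  have hdenom : ‖denom γ τ‖ ≠ 0 := norm_ne_zero_iff.2 (denom_ne_zero γ τ)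
  have hkR : (k : ℝ) = Int.gcd k (γ 1 0) * D := by exact_mod_cast hAD.symm
  have hexp : 2 * π * ((Int.gcd k (γ 1 0) : ℝ) ^ 2 / k) * τ.im =
      2 * π * ((Int.gcd k (γ 1 0) : ℝ) * τ.im / D) := by
    rw [hkR]; field_simp
  rw [Function.comp_apply, ← coe_smul_affineMap hA hD hmat, ← norm_pow, ← norm_pow, eta_smul_pow,
    denom_affineMap hA hD hmat, norm_mul, im_affineMap, norm_pow (denom γ τ / _), norm_div,
    Complex.norm_natCast, hexp]
  field_simp

/-- `∑ r (k, c)² n / k`, which is `24 n` times the order in `q` of the eta quotient at the cusp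
`γ∞`, for `γ` with lower left entry `c` (Ligozat's formula). The natural division is exact in all
uses. -/
def cuspOrder (n : ℕ) (l : List (ℕ × ℤ)) (c : ℕ) : ℤ :=
  (l.map fun p => p.2 * (((Nat.gcd p.1 c) ^ 2 * (n / p.1) : ℕ) : ℤ)).sum

lemma cuspOrder_cons (n : ℕ) (p : ℕ × ℤ) (l : List (ℕ × ℤ)) (c : ℕ) :
    cuspOrder n (p :: l) c =
      p.2 * (((Nat.gcd p.1 c) ^ 2 * (n / p.1) : ℕ) : ℤ) + cuspOrder n l c := by
  simp [cuspOrder]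

lemma cuspOrder_gcd {n : ℕ} {l : List (ℕ × ℤ)} (hl : ∀ p ∈ l, p.1 ∣ n) (c : ℕ) :
    cuspOrder n l (n.gcd c) = cuspOrder n l c := by
  unfold cuspOrder
  congr 1
  refine List.map_congr_left fun p hp => ?_
  rw [← Nat.gcd_assoc, Nat.gcd_eq_left (hl p hp)]

lemma tendsto_norm_etaQuot (γ : SL(2, ℤ)) {n : ℕ} (hn : 0 < n) {l : List (ℕ × ℤ)}
    (hl : ∀ p ∈ l, p.1 ∣ n) :
    ∃ C : ℝ, Tendsto (fun τ : ℍ => ‖etaQuot l (γ • τ : ℍ)‖ ^ 24 *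
      ((‖denom γ τ‖ ^ 12)⁻¹) ^ expSum l *
        Real.exp (2 * π * (cuspOrder n l (γ 1 0).natAbs / n) * τ.im))
      atImInfty (𝓝 C) := by
  induction l with
  | nil => exact ⟨1, by simp [etaQuot, expSum, cuspOrder]⟩
  | cons p l ih =>
    rw [List.forall_mem_cons] at hl
    have hp := Nat.pos_of_dvd_of_pos hl.1 hn
    obtain ⟨C, hC⟩ := ih hl.2
    obtain ⟨C', hC0, hC'⟩ := tendsto_norm_eta_smul γ hp
    refine ⟨C' ^ p.2 * C, ((hC'.zpow₀ p.2 (Or.inl hC0)).mul hC).congr fun τ => ?_⟩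
    have hdenom : (‖denom γ τ‖ ^ 12)⁻¹ ≠ 0 :=
      inv_ne_zero (pow_ne_zero _ (norm_ne_zero_iff.2 (denom_ne_zero γ τ)))
    have hexp : Real.exp (2 * π * (cuspOrder n (p :: l) (γ 1 0).natAbs / n) * τ.im) =
        Real.exp (2 * π * ((Int.gcd p.1 (γ 1 0) : ℝ) ^ 2 / p.1) * τ.im) ^ p.2 *
        Real.exp (2 * π * (cuspOrder n l (γ 1 0).natAbs / n) * τ.im) := by
      have hp0 : (p.1 : ℝ) ≠ 0 := by exact_mod_cast hp.ne'
      rw [← Real.rpow_intCast, ← Real.exp_mul, ← Real.exp_add, cuspOrder_cons, Int.gcd,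
        Int.natAbs_natCast]
      congr 1
      rw [Int.cast_add, Int.cast_mul, Int.cast_natCast, Nat.cast_mul, Nat.cast_div hl.1 hp0]
      push_cast
      field_simp
    have hpow (x : ℝ) : (x ^ p.2) ^ 24 = (x ^ 24) ^ p.2 := by
      rw [← zpow_natCast, ← zpow_natCast, zpow_comm]
    rw [etaQuot_cons, expSum_cons, norm_mul, norm_zpow, mul_pow, zpow_add₀ hdenom, mul_zpow,
      mul_zpow, hexp, hpow]
    ring

theorem isBoundedAtImInfty_etaQuot_slash {n : ℕ} (hn : 0 < n) {l : List (ℕ × ℤ)}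
    (hl : ∀ p ∈ l, p.1 ∣ n) {j : ℤ} (hj : expSum l = 4 * j)
    (hord : ∀ t ∈ n.divisors, 0 ≤ cuspOrder n l t) (γ : SL(2, ℤ)) :
    IsBoundedAtImInfty ((fun τ : ℍ => etaQuot l τ) ∣[2 * j] γ) := by
  obtain ⟨C, hC⟩ := tendsto_norm_etaQuot γ hn hl
  have hc : 0 ≤ cuspOrder n l (γ 1 0).natAbs := by
    rw [← cuspOrder_gcd hl]
    exact hord _ (Nat.mem_divisors.2 ⟨Nat.gcd_dvd_left _ _, hn.ne'⟩)
  rw [IsBoundedAtImInfty, BoundedAtFilter, Asymptotics.isBigO_iff]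
  refine ⟨max 1 (C + 1), ?_⟩
  filter_upwards [hC.eventually (gt_mem_nhds (lt_add_one C))] with τ hτ
  rw [Pi.one_apply, norm_one, mul_one]
  set x := ‖((fun τ : ℍ => etaQuot l τ) ∣[2 * j] γ) τ‖ with hx
  have hx24 : x ^ 24 ≤ C + 1 := by
    refine le_trans ?_ hτ.le
    have hweight : ((‖denom γ τ‖ ^ 12)⁻¹) ^ expSum l = (‖denom γ τ‖ ^ (-(2 * j))) ^ 24 := by
      rw [hj, ← zpow_natCast, ← zpow_natCast, ← zpow_neg, ← zpow_mul, ← zpow_mul]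
      congr 1; push_cast; ring
    rw [hx, ModularForm.SL_slash_apply, norm_mul, norm_zpow, mul_pow, hweight]
    refine le_mul_of_one_le_right (by positivity) (Real.one_le_exp ?_)
    have := τ.im_pos
    have := Real.pi_pos
    positivity
  rcases le_total x 1 with h1 | h1
  · exact le_max_of_le_left h1
  · exact le_max_of_le_right ((le_self_pow₀ h1 (by norm_num)).trans hx24)

end Cusps

/-! ### Weight two forms with multiplier -/

/-- `f` is a holomorphic modular form of weight two for `Γ₀(n)` with multiplier `e (cd / (nh))`,
the behaviour of the summands of `tildeT`. -/
structure IsTwistedForm (n h : ℕ) (f : ℍ → ℂ) : Prop where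
  differentiableOn : DifferentiableOn ℂ (fun w => f (ofComplex w)) {w | 0 < w.im}
  slash_eq : ∀ γ ∈ CongruenceSubgroup.Gamma0 n,
    f ∣[(2 : ℤ)] γ = e ((γ 1 0 : ℂ) * (γ 1 1 : ℂ) / (n * h)) • f
  isBoundedAtImInfty_slash : ∀ γ : SL(2, ℤ), IsBoundedAtImInfty (f ∣[(2 : ℤ)] γ)

namespace IsTwistedForm

variable {n h : ℕ} {f g : ℍ → ℂ}

lemma zero : IsTwistedForm n h 0 where
  differentiableOn := differentiableOn_const 0
  slash_eq _ _ := by rw [SlashAction.zero_slash, smul_zero]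
  isBoundedAtImInfty_slash γ := by
    rw [SlashAction.zero_slash]
    exact Filter.const_boundedAtFilter _ (0 : ℂ)

lemma add (hf : IsTwistedForm n h f) (hg : IsTwistedForm n h g) : IsTwistedForm n h (f + g) where
  differentiableOn := hf.differentiableOn.fun_add hg.differentiableOn
  slash_eq γ hγ := by rw [SlashAction.add_slash, hf.slash_eq γ hγ, hg.slash_eq γ hγ, smul_add]
  isBoundedAtImInfty_slash γ := by
    rw [SlashAction.add_slash]
    exact (hf.isBoundedAtImInfty_slash γ).add (hg.isBoundedAtImInfty_slash γ)

lemma const_smul (a : ℂ) (hf : IsTwistedForm n h f) : IsTwistedForm n h (a • f) where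
  differentiableOn := hf.differentiableOn.const_mul a
  slash_eq γ hγ := by rw [ModularForm.SL_smul_slash, hf.slash_eq γ hγ, smul_comm]
  isBoundedAtImInfty_slash γ := by
    rw [ModularForm.SL_smul_slash]
    exact (hf.isBoundedAtImInfty_slash γ).const_mul_left a

end IsTwistedForm

lemma mem_Gamma0_iff {n : ℕ} {γ : SL(2, ℤ)} :
    γ ∈ CongruenceSubgroup.Gamma0 n ↔ (n : ℤ) ∣ γ 1 0 := by
  rw [CongruenceSubgroup.Gamma0_mem, ZMod.intCast_zmod_eq_zero_iff_dvd]

lemma differentiableOn_etaQuot {l : List (ℕ × ℤ)} (hl : ∀ p ∈ l, 0 < p.1) :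
    DifferentiableOn ℂ (etaQuot l) {w | 0 < w.im} := by
  induction l with
  | nil =>
    exact (differentiableOn_const 1).congr fun w _ => by simp [etaQuot]
  | cons p l ih =>
    rw [List.forall_mem_cons] at hl
    rw [funext (etaQuot_cons p l)]
    refine DifferentiableOn.fun_mul (fun w hw => ?_) (ih hl.2)
    have hw' := natCast_mul_im_pos hl.1 hw
    have hd : DifferentiableAt ℂ (fun w => ModularForm.eta (p.1 * w)) w :=
      (ModularForm.differentiableAt_eta_of_mem_upperHalfPlaneSet hw').comp w
        (differentiableAt_id.const_mul _)
    exact (hd.zpow (Or.inl (ModularForm.eta_ne_zero hw'))).differentiableWithinAt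

theorem NewmanCriterion.isTwistedForm {n h : ℕ} {l : List (ℕ × ℤ)} (H : NewmanCriterion n h 1 l)
    (hord : ∀ t ∈ n.divisors, 0 ≤ cuspOrder n l t) : IsTwistedForm n h fun τ => etaQuot l τ where
  differentiableOn := by
    refine (differentiableOn_etaQuot
      fun p hp => Nat.pos_of_dvd_of_pos (H.dvd_level p hp) H.level_pos).congr fun w hw => ?_
    rw [ofComplex_apply_of_im_pos hw]
  slash_eq γ hγ := by
    funext τ
    have hlaw : etaQuot l (γ • τ : ℍ) =
        e ((γ 1 0 : ℂ) * (γ 1 1 : ℂ) / (n * h)) * denom γ τ ^ (2 : ℤ) * etaQuot l τ := by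
      rw [coe_smul_eq_div_denom]
      exact H.etaQuot_smul (det_eq_one γ) (mem_Gamma0_iff.1 hγ) τ.im_pos
    rw [ModularForm.SL_slash_apply, hlaw, mul_right_comm, mul_assoc (e _), zpow_neg,
      mul_inv_cancel₀ (zpow_ne_zero _ (denom_ne_zero γ τ)), mul_one, Pi.smul_apply, smul_eq_mul]
  isBoundedAtImInfty_slash γ := by
    simpa only [mul_one] using
      isBoundedAtImInfty_etaQuot_slash H.level_pos H.dvd_level H.expSum_eq hord γ

/-! ### The forms `Λ_N` -/

section Lam

open EisensteinSeries

lemma E2_smul (γ : SL(2, ℤ)) (τ : ℍ) :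
    E2 (γ • τ) = denom γ τ ^ 2 * E2 τ - 6 * I / π * (γ 1 0 : ℂ) * denom γ τ := by
  have hslash := congrFun (E2_slash_action γ) τ
  have hdenom := denom_ne_zero γ τ
  have hpi : (π : ℂ) ≠ 0 := by exact_mod_cast Real.pi_ne_zero
  rw [ModularForm.SL_slash_apply, Pi.sub_apply, Pi.smul_apply, smul_eq_mul, D2,
    riemannZeta_two, zpow_neg, zpow_ofNat, ← div_eq_mul_inv,
    div_eq_iff (pow_ne_zero _ hdenom)] at hslash
  rw [hslash]
  field_simp

lemma logDeriv_eta_natCast_mul {N : ℕ} {w : ℂ} (hw : 0 < ((N : ℂ) * w).im) :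
    logDeriv (fun w : ℂ => ModularForm.eta (N * w)) w = N * logDeriv ModularForm.eta (N * w) := by
  have hcomp := logDeriv_comp (g := fun w : ℂ => (N : ℂ) * w)
    (ModularForm.differentiableAt_eta_of_mem_upperHalfPlaneSet hw)
    (differentiableAt_id.const_mul _)
  rwa [Function.comp_def, deriv_const_mul _ differentiableAt_fun_id, deriv_id'', mul_one,
    mul_comm] at hcomp

lemma Lam_eq {N : ℕ} (hN : 0 < N) {τ τ' : ℍ} (h : (τ' : ℂ) = N * τ) :
    Lam N τ = N / 24 * (N * E2 τ' - E2 τ) := by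
  have hpos := natCast_mul_im_pos hN τ.im_pos
  have hpi : (π : ℂ) ≠ 0 := by exact_mod_cast Real.pi_ne_zero
  have hI := I_ne_zero
  rw [Lam, logDeriv_div (f := fun w : ℂ => ModularForm.eta (N * w)) (τ : ℂ)
    (ModularForm.eta_ne_zero hpos) (ModularForm.eta_ne_zero τ.im_pos)
    ((ModularForm.differentiableAt_eta_of_mem_upperHalfPlaneSet hpos).comp (τ : ℂ)
      (differentiableAt_id.const_mul _))
    (ModularForm.differentiableAt_eta_of_mem_upperHalfPlaneSet τ.im_pos),
    logDeriv_eta_natCast_mul hpos, ← h, ModularForm.logDeriv_eta_eq_E2,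
    ModularForm.logDeriv_eta_eq_E2]
  field_simp
  ring

lemma differentiableOn_Lam {N : ℕ} (hN : 0 < N) :
    DifferentiableOn ℂ (fun w => Lam N (ofComplex w)) {w | 0 < w.im} := by
  have hE2 := UpperHalfPlane.mdifferentiable_iff.1 E2_mdifferentiable
  have hE2N : DifferentiableOn ℂ (fun w : ℂ => E2 (ofComplex (N * w))) {w | 0 < w.im} :=
    hE2.comp (differentiableOn_id.const_mul (N : ℂ)) fun w hw => natCast_mul_im_pos hN hw
  refine (((hE2N.const_mul (N : ℂ)).fun_sub hE2).const_mul (N / 24 : ℂ)).congr fun w hw =>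
    Lam_eq hN ?_
  rw [ofComplex_apply_of_im_pos hw, ofComplex_apply_of_im_pos (natCast_mul_im_pos hN hw)]

lemma Lam_slash {N A D : ℕ} {B : ℤ} {γ γ' : SL(2, ℤ)} (hA : 0 < A) (hD : 0 < D) (hAD : A * D = N)
    (h : !![(N : ℤ), 0; 0, 1] * γ.1 = γ'.1 * !![(A : ℤ), B; 0, (D : ℤ)]) :
    Lam N ∣[(2 : ℤ)] γ =
      fun τ => N / 24 * (N / D ^ 2 * E2 (affineMap A D B hA hD τ) - E2 τ) := by
  funext τ
  have hN : 0 < N := hAD ▸ mul_pos hA hD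
  have hdenom := denom_ne_zero γ τ
  have hD0 : (D : ℂ) ≠ 0 := by exact_mod_cast hD.ne'
  have hADC : (A : ℂ) * D = N := by exact_mod_cast hAD
  have hc : (γ 1 0 : ℂ) = γ' 1 0 * A := by
    simpa [Matrix.mul_apply] using congrArg (Int.cast : ℤ → ℂ) (congrFun₂ h 1 0)
  have hcorrection : (N : ℂ) * (6 * I / π * γ' 1 0 * (denom γ τ / D)) =
      6 * I / π * γ 1 0 * denom γ τ := by
    rw [hc, ← hADC]; field_simp
  rw [ModularForm.SL_slash_apply, Lam_eq hN (coe_smul_affineMap hA hD h τ), E2_smul, E2_smul,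
    denom_affineMap hA hD h, mul_sub (N : ℂ), hcorrection, zpow_neg, zpow_ofNat]
  field_simp
  ring

lemma Lam_slash_of_dvd {N : ℕ} (hN : 0 < N) {γ : SL(2, ℤ)} (h : (N : ℤ) ∣ γ 1 0) :
    Lam N ∣[(2 : ℤ)] γ = Lam N := by
  obtain ⟨r, hr⟩ := h
  let γ' : SL(2, ℤ) := ⟨!![γ 0 0, N * γ 0 1; r, γ 1 1], by
    rw [Matrix.det_fin_two_of]; linear_combination det_eq_one γ + γ 0 1 * hr⟩
  have hmat : !![(N : ℤ), 0; 0, 1] * γ.1 = γ'.1 * !![(N : ℤ), 0; 0, (1 : ℕ)] := by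
    rw [Matrix.eta_fin_two γ.1]
    simp [γ', hr, mul_comm]
  rw [Lam_slash hN one_pos (mul_one N) hmat]
  funext τ
  rw [Lam_eq hN (τ' := affineMap N 1 0 hN one_pos τ) (by simp [coe_affineMap]), Nat.cast_one,
    one_pow, div_one]

lemma e_mul_div_of_dvd {n : ℕ} (hn : 0 < n) {c : ℤ} (h : (n : ℤ) ∣ c) (d : ℤ) :
    e ((c : ℂ) * d / n) = 1 := by
  obtain ⟨m, rfl⟩ := h
  have hn0 : (n : ℂ) ≠ 0 := by exact_mod_cast hn.ne'
  rw [← e_intCast (m * d)]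
  congr 1
  push_cast
  field_simp

lemma isBoundedAtImInfty_Lam_slash {N : ℕ} (hN : 0 < N) (γ : SL(2, ℤ)) :
    IsBoundedAtImInfty (Lam N ∣[(2 : ℤ)] γ) := by
  obtain ⟨γ', D, B, hAD, hmat⟩ := exists_mul_eq_mul_upperTriangular γ hN
  have hA : 0 < Int.gcd N (γ 1 0) := Nat.pos_of_mul_pos_right (hAD ▸ hN)
  have hD : 0 < D := Nat.pos_of_mul_pos_left (hAD ▸ hN)
  rw [Lam_slash hA hD hAD hmat]
  exact (((isBoundedAtImInfty_E2.comp_tendsto (tendsto_affineMap hA hD)).const_mul_left _).sub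
    isBoundedAtImInfty_E2).const_mul_left _

theorem isTwistedForm_Lam {n : ℕ} (N : ℕ) (hn : 0 < n := by decide) (hNn : N ∣ n := by decide) :
    IsTwistedForm n 1 (Lam N) where
  differentiableOn := differentiableOn_Lam (Nat.pos_of_dvd_of_pos hNn hn)
  slash_eq γ hγ := by
    have hdvd := mem_Gamma0_iff.1 hγ
    rw [Lam_slash_of_dvd (Nat.pos_of_dvd_of_pos hNn hn)
      ((Int.natCast_dvd_natCast.2 hNn).trans hdvd), Nat.cast_one, mul_one,
      e_mul_div_of_dvd hn hdvd, one_smul]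
  isBoundedAtImInfty_slash := isBoundedAtImInfty_Lam_slash (Nat.pos_of_dvd_of_pos hNn hn)

end Lam

/-! ### The Euler product -/

section Euler

/-- The Euler product `∏ (1 - x ^ n)`. -/
noncomputable def eulerProd (x : ℂ) : ℂ := ∏' n : ℕ, (1 - x ^ (n + 1))

/-- The odd part `∏ (1 - x ^ (2n+1))` of the Euler product. -/
noncomputable def eulerOdd (x : ℂ) : ℂ := ∏' n : ℕ, (1 - x ^ (2 * n + 1))

variable {x : ℂ} (hx : ‖x‖ < 1)

include hx

lemma norm_pow_lt_one {n : ℕ} (hn : n ≠ 0) : ‖x ^ n‖ < 1 := by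
  rw [norm_pow]; exact pow_lt_one₀ (norm_nonneg _) hx hn

lemma multipliable_eulerOdd : Multipliable fun n : ℕ => 1 - x ^ (2 * n + 1) := by
  have hsum : Summable fun n : ℕ => ‖-x ^ (2 * n + 1)‖ := by
    simp only [norm_neg, norm_pow]
    exact (summable_geometric_of_lt_one (norm_nonneg x) hx).comp_injective
      (i := fun n => 2 * n + 1) fun a b hab => by simpa using hab
  simpa [sub_eq_add_neg] using multipliable_one_add_of_summable hsum

lemma eulerProd_eq_eulerOdd_mul : eulerProd x = eulerOdd x * eulerProd (x ^ 2) := by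
  have heven (n : ℕ) : 1 - x ^ (2 * n + 1 + 1) = 1 - (x ^ 2) ^ (n + 1) := by
    rw [← pow_mul]; ring
  have hsplit := tprod_even_mul_odd (f := fun n : ℕ => 1 - x ^ (n + 1)) (multipliable_eulerOdd hx)
    (by simpa only [heven] using
      ModularForm.multipliable_one_sub_pow (norm_pow_lt_one hx two_ne_zero))
  rw [eulerProd, ← hsplit, eulerOdd, eulerProd]
  simp only [heven]

lemma eulerOdd_mul_eulerOdd_neg : eulerOdd x * eulerOdd (-x) = eulerOdd (x ^ 2) := by
  rw [eulerOdd, eulerOdd, eulerOdd, ← (multipliable_eulerOdd hx).tprod_mul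
    (multipliable_eulerOdd (by rwa [norm_neg]))]
  refine tprod_congr fun n => ?_
  rw [(odd_two_mul_add_one n).neg_pow, ← pow_mul, mul_comm 2, pow_mul]
  ring

lemma eulerProd_mul_eulerProd_neg :
    eulerProd x * eulerProd (-x) * eulerProd (x ^ 4) = eulerProd (x ^ 2) ^ 3 := by
  have hsq := eulerProd_eq_eulerOdd_mul (norm_pow_lt_one hx two_ne_zero)
  rw [← pow_mul] at hsq
  rw [eulerProd_eq_eulerOdd_mul hx, eulerProd_eq_eulerOdd_mul (x := -x) (by rwa [norm_neg]),
    neg_sq]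
  linear_combination (eulerProd (x ^ 2) ^ 2 * eulerProd (x ^ 4)) * eulerOdd_mul_eulerOdd_neg hx
    - eulerProd (x ^ 2) ^ 2 * hsq

lemma differentiableAt_eulerProd : DifferentiableAt ℂ eulerProd x :=
  ModularForm.differentiableOn_tprod_one_sub_pow.differentiableAt
    (Metric.isOpen_ball.mem_nhds (by simpa using hx))

omit hx

lemma eulerProd_zero : eulerProd 0 = 1 := by simp [eulerProd]

lemma hasDerivAt_eulerProd_zero : HasDerivAt eulerProd (-1) 0 := by
  have hfactor (n : ℕ) : logDeriv (fun x : ℂ => 1 - x ^ (n + 1)) 0 = if n = 0 then -1 else 0 := by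
    rw [logDeriv_apply, ((hasDerivAt_pow (n + 1) (0 : ℂ)).const_sub 1).deriv]
    rcases n with _ | n <;> simp
  have hlog : logDeriv eulerProd 0 = ∑' n, logDeriv (fun x : ℂ => 1 - x ^ (n + 1)) 0 :=
    logDeriv_tprod_eq_tsum Metric.isOpen_ball (Metric.mem_ball_self one_pos) (by simp)
      (fun n => by fun_prop)
      (by simp only [hfactor]; exact (hasSum_ite_eq 0 (-1 : ℂ)).summable)
      ModularForm.multipliableLocallyUniformlyOn_one_sub_pow (by simp)
  simp only [hfactor, tsum_ite_eq] at hlog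
  rw [logDeriv_apply, eulerProd_zero, div_one] at hlog
  rw [← hlog]
  exact (differentiableAt_eulerProd (by simp)).hasDerivAt

lemma eta_eq_eulerProd (w : ℂ) : ModularForm.eta w = e (w / 24) * eulerProd (e w) := by
  rw [eta_eq_e_mul_tprod, eulerProd]
  simp only [ModularForm.eta_q_eq_pow]
  rfl

end Euler

/-! ### Functions invariant under `Γ₀(p)` and the Fricke involution -/

section Fricke

open Filter Topology CongruenceSubgroup
open ModularGroup (S T)

/-- The subgroup of the modular group under whose action `f` is invariant. -/
def invarianceSubgroup {α : Type*} (f : ℍ → α) : Subgroup SL(2, ℤ) where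
  carrier := {γ | ∀ τ, f (γ • τ) = f τ}
  mul_mem' hγ hδ τ := by rw [mul_smul, hγ, hδ]
  one_mem' τ := by rw [one_smul]
  inv_mem' hγ τ := by rw [← hγ, smul_inv_smul]

/-- The matrix `(1 0; n 1)`. -/
def lowerUnipotent (n : ℤ) : SL(2, ℤ) := ⟨!![1, 0; n, 1], by simp⟩

lemma mul_T_apply (γ : SL(2, ℤ)) (i : Fin 2) :
    (γ * T) i 0 = γ i 0 ∧ (γ * T) i 1 = γ i 0 + γ i 1 := by
  rw [Matrix.SpecialLinearGroup.coe_mul, ModularGroup.coe_T]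
  simp [Matrix.mul_apply]

lemma mul_lowerUnipotent_apply (γ : SL(2, ℤ)) (n : ℤ) (i : Fin 2) :
    (γ * lowerUnipotent n) i 0 = γ i 0 + n * γ i 1 ∧ (γ * lowerUnipotent n) i 1 = γ i 1 := by
  rw [Matrix.SpecialLinearGroup.coe_mul, lowerUnipotent]
  simp [Matrix.mul_apply, mul_comm]

lemma mul_T_mem_Gamma0_iff {n : ℕ} {γ : SL(2, ℤ)} : γ * T ∈ Gamma0 n ↔ γ ∈ Gamma0 n := by
  rw [mem_Gamma0_iff, mem_Gamma0_iff, (mul_T_apply γ 1).1]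

lemma Gamma0_two_mul_le_of_mem {n : ℕ} {H : Subgroup SL(2, ℤ)} (hT : T ∈ H)
    (hH : ∀ γ ∈ Gamma0 (2 * n), Even (γ 0 1) → γ ∈ H) : Gamma0 (2 * n) ≤ H := by
  intro γ hγ
  rcases Int.even_or_odd (γ 0 1) with hb | hb
  · exact hH γ hγ hb
  have ha : Odd (γ 0 0) := by
    obtain ⟨k, hk⟩ := mem_Gamma0_iff.1 hγ
    refine Int.not_even_iff_odd.1 fun ⟨m, hm⟩ => ?_
    have hdet : 2 * (m * γ 1 1 - γ 0 1 * (n * k)) = 1 := by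
      push_cast at hk
      linear_combination det_eq_one γ - γ 1 1 * hm + γ 0 1 * hk
    lia
  refine (H.mul_mem_cancel_right hT).1 (hH _ (mul_T_mem_Gamma0_iff.2 hγ) ?_)
  rw [(mul_T_apply γ 0).2]
  exact ha.add_odd hb

theorem Gamma0_le_of_mem {n : ℕ} {H : Subgroup SL(2, ℤ)} (hT : T ∈ H)
    (hL : lowerUnipotent n ∈ H) (hH : ∀ γ ∈ Gamma0 (2 * n), Even (γ 0 1) → γ ∈ H) :
    Gamma0 n ≤ H := by
  have mem_of_odd (γ : SL(2, ℤ)) (hγ : γ ∈ Gamma0 n) (hd : Odd (γ 1 1)) : γ ∈ H := by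
    obtain ⟨k, hk⟩ := mem_Gamma0_iff.1 hγ
    rcases Int.even_or_odd k with ⟨m, rfl⟩ | hk_odd
    · exact Gamma0_two_mul_le_of_mem hT hH
        (mem_Gamma0_iff.2 ⟨m, by rw [hk]; push_cast; ring⟩)
    · obtain ⟨m, hm⟩ := hk_odd.add_odd hd
      refine (H.mul_mem_cancel_right hL).1
        (Gamma0_two_mul_le_of_mem hT hH (mem_Gamma0_iff.2 ⟨m, ?_⟩))
      rw [(mul_lowerUnipotent_apply γ n 1).1, hk, ← mul_add, hm]
      push_cast; ring
  intro γ hγ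
  rcases Int.even_or_odd (γ 1 1) with hd | hd
  · have hc : Odd (γ 1 0) :=
      (odd_or_odd_of_det (det_eq_one γ)).resolve_right (Int.not_odd_iff_even.2 hd)
    refine (H.mul_mem_cancel_right hT).1 (mem_of_odd _ (mul_T_mem_Gamma0_iff.2 hγ) ?_)
    rw [(mul_T_apply γ 1).2]
    exact hc.add_even hd
  · exact mem_of_odd γ hγ hd

theorem exists_eq_mul_S_mul_T_zpow {p : ℕ} (hp : p.Prime) {γ : SL(2, ℤ)} (hγ : γ ∉ Gamma0 p) :
    ∃ γ' ∈ Gamma0 p, ∃ j : ℤ, γ = γ' * (S * T ^ j) := by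
  rw [mem_Gamma0_iff] at hγ
  obtain ⟨u, v, huv⟩ := (Nat.prime_iff_prime_int.1 hp).coprime_iff_not_dvd.2 hγ
  refine ⟨γ * (S * T ^ (v * γ 1 1))⁻¹, ?_, v * γ 1 1, by rw [inv_mul_cancel_right]⟩
  have hentry : (γ * (S * T ^ (v * γ 1 1))⁻¹) 1 0 = p * -(u * γ 1 1) := by
    have hinv : ((S * T ^ (v * γ 1 1))⁻¹ : SL(2, ℤ)).1 = !![v * γ 1 1, 1; -1, 0] := by
      simp [ModularGroup.coe_S, ModularGroup.coe_T_zpow, Matrix.adjugate_fin_two]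
    rw [Matrix.SpecialLinearGroup.coe_mul, hinv, Matrix.mul_apply, Fin.sum_univ_two]
    simp only [Matrix.of_apply, Matrix.cons_val', Matrix.cons_val_zero, Matrix.cons_val_one]
    linear_combination γ 1 1 * huv
  exact mem_Gamma0_iff.2 ⟨_, hentry⟩

/-- The Fricke involution `τ ↦ -1 / (nτ)`. -/
noncomputable def fricke (n : ℕ) (hn : 0 < n) (τ : ℍ) : ℍ := S • affineMap n 1 0 hn one_pos τ

variable {n : ℕ} (hn : 0 < n)

lemma coe_fricke (τ : ℍ) : (fricke n hn τ : ℂ) = -1 / (n * τ) := by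
  rw [fricke, coe_S_smul, coe_affineMap]; simp

lemma fricke_fricke (τ : ℍ) : fricke n hn (fricke n hn τ) = τ := by
  have hτ := τ.ne_zero
  have hn0 : (n : ℂ) ≠ 0 := by exact_mod_cast hn.ne'
  ext
  rw [coe_fricke, coe_fricke]
  field_simp

lemma fricke_smul {γ γ' : SL(2, ℤ)}
    (h : !![0, -1; (n : ℤ), 0] * γ.1 = γ'.1 * !![0, -1; (n : ℤ), 0]) (τ : ℍ) :
    fricke n hn (γ • τ) = γ' • fricke n hn τ := by
  have hn0 : (n : ℂ) ≠ 0 := by exact_mod_cast hn.ne'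
  have hτ := τ.ne_zero
  have hentry (i j : Fin 2) := congrArg (Int.cast : ℤ → ℂ) (congrFun₂ h i j)
  have ⟨⟨h₁₀, h₁₁⟩, h₀₀, h₀₁⟩ : ((-γ 1 0 : ℂ) = γ' 0 1 * n ∧ (γ 1 1 : ℂ) = γ' 0 0) ∧
      (n : ℂ) * γ 0 0 = γ' 1 1 * n ∧ (n : ℂ) * γ 0 1 = -γ' 1 0 := by
    simpa [Matrix.mul_apply, Fin.forall_fin_two] using hentry
  have hnum : (γ' 0 0 : ℂ) * (-1 / (n * τ)) + γ' 0 1 = -denom γ τ / (n * τ) := by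
    rw [ModularGroup.denom_apply]
    field_simp
    linear_combination -τ * h₁₀ + h₁₁
  have hden : denom γ' (fricke n hn τ) = (γ 0 0 * τ + γ 0 1) / τ := by
    rw [ModularGroup.denom_apply, coe_fricke]
    field_simp
    linear_combination -τ * h₀₀ - h₀₁
  have hden0 : (γ 0 0 : ℂ) * τ + γ 0 1 ≠ 0 :=
    (div_ne_zero_iff.1 (hden ▸ denom_ne_zero γ' (fricke n hn τ))).1
  have hdenom := denom_ne_zero γ τ
  ext
  rw [coe_fricke, coe_smul_eq_div_denom, coe_smul_eq_div_denom γ', hden, coe_fricke, hnum]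
  field_simp

lemma lowerUnipotent_mem_invarianceSubgroup {α : Type*} {f : ℍ → α}
    (hfricke : ∀ τ, f (fricke n hn τ) = f τ) (hT : T ∈ invarianceSubgroup f) :
    lowerUnipotent n ∈ invarianceSubgroup f := by
  intro τ
  have hconj : lowerUnipotent n • τ = fricke n hn (T⁻¹ • fricke n hn τ) := by
    rw [fricke_smul hn (γ' := lowerUnipotent n) _ (fricke n hn τ), fricke_fricke]
    simp [lowerUnipotent]
  rw [hconj, hfricke, inv_mem hT, hfricke]

lemma isBoundedAtImInfty_comp_smul_of_fricke {p : ℕ} (hp : p.Prime) {f : ℍ → ℂ}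
    (hinv : Gamma0 p ≤ invarianceSubgroup f) (hfricke : ∀ τ, f (fricke p hp.pos τ) = f τ)
    (hf : IsBoundedAtImInfty f) (γ : SL(2, ℤ)) : IsBoundedAtImInfty fun τ => f (γ • τ) := by
  by_cases hγ : γ ∈ Gamma0 p
  · exact hf.congr_left fun τ => (hinv hγ τ).symm
  obtain ⟨γ', hγ', j, rfl⟩ := exists_eq_mul_S_mul_T_zpow hp hγ
  refine (hf.comp_tendsto (tendsto_affineMap (B := j) one_pos hp.pos)).congr_left fun τ => ?_
  have hp0 : (p : ℂ) ≠ 0 := by exact_mod_cast hp.ne_zero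
  have hcusp : (S * T ^ j) • τ = fricke p hp.pos (affineMap 1 p j one_pos hp.pos τ) := by
    rw [mul_smul, fricke]
    congr 1
    ext
    rw [coe_affineMap, coe_affineMap, UpperHalfPlane.modular_T_zpow_smul, coe_vadd]
    push_cast
    field_simp
    ring
  rw [mul_smul, hinv hγ', hcusp, hfricke, Function.comp_apply]

theorem exists_eq_const_of_invariant {n : ℕ} [NeZero n] {f : ℍ → ℂ}
    (hf : DifferentiableOn ℂ (fun w => f (ofComplex w)) {w | 0 < w.im})
    (hinv : Gamma0 n ≤ invarianceSubgroup f)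
    (hbdd : ∀ γ : SL(2, ℤ), IsBoundedAtImInfty fun τ => f (γ • τ)) :
    ∃ a, f = Function.const ℍ a := by
  have hslash (γ : SL(2, ℤ)) : f ∣[(0 : ℤ)] γ = fun τ => f (γ • τ) := by
    funext τ
    rw [ModularForm.SL_slash_apply, neg_zero, zpow_zero, mul_one]
  let F : ModularForm (Gamma0 n) 0 :=
    { toFun := f
      slash_action_eq' := by
        rintro _ ⟨γ, hγ, rfl⟩
        exact (hslash γ).trans (funext (hinv hγ))
      holo' := UpperHalfPlane.mdifferentiable_iff.2 hf
      bdd_at_cusps' hc := by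
        rw [Subgroup.IsArithmetic.isCusp_iff_isCusp_SL2Z] at hc
        rw [OnePoint.isBoundedAt_iff_forall_SL2Z hc]
        intro γ _
        rw [hslash]
        exact hbdd γ }
  exact ModularForm.eq_const_of_weight_zero F

theorem eq_of_tendsto_of_fricke_invariant {p : ℕ} (hp : p.Prime) {f : ℍ → ℂ} {a : ℂ}
    (hf : DifferentiableOn ℂ (fun w => f (ofComplex w)) {w | 0 < w.im})
    (hinv : Gamma0 p ≤ invarianceSubgroup f) (hfricke : ∀ τ, f (fricke p hp.pos τ) = f τ)
    (hlim : Tendsto f atImInfty (𝓝 a)) (τ : ℍ) : f τ = a := by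
  have : NeZero p := ⟨hp.ne_zero⟩
  obtain ⟨b, rfl⟩ := exists_eq_const_of_invariant hf hinv
    (isBoundedAtImInfty_comp_smul_of_fricke hp hinv hfricke (hlim.isBigO_one ℝ))
  exact tendsto_nhds_unique tendsto_const_nhds hlim

end Fricke

/-! ### Level twenty-three -/

section LevelTwentyThree

open Filter Topology CongruenceSubgroup
open ModularGroup (S T)

/-- The weight one form `η(w) η(23w)`. -/
noncomputable def eta23 (w : ℂ) : ℂ := ModularForm.eta w * ModularForm.eta (23 * w)

/-- The power series in `q` of `η(w) η(23w) / q`. -/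
noncomputable def euler23 (x : ℂ) : ℂ := eulerProd x * eulerProd (x ^ 23)

lemma eta23_eq (w : ℂ) : eta23 w = e w * euler23 (e w) := by
  have hpow : e (23 * w) = e w ^ 23 := by exact_mod_cast e_natCast_mul 23 w
  have hleading : e (w / 24) * e (23 * w / 24) = e w := by rw [← e_add]; congr 1; ring
  rw [eta23, eta_eq_eulerProd, eta_eq_eulerProd, hpow, euler23, ← hleading]; ring

lemma eulerProd_ne_zero {x : ℂ} (hx : ‖x‖ < 1) : eulerProd x ≠ 0 :=
  tprod_one_sub_pow_ne_zero hx

lemma euler23_ne_zero {x : ℂ} (hx : ‖x‖ < 1) : euler23 x ≠ 0 :=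
  mul_ne_zero (eulerProd_ne_zero hx) (eulerProd_ne_zero (norm_pow_lt_one hx (by norm_num)))

lemma eta23_ne_zero {w : ℂ} (hw : 0 < w.im) : eta23 w ≠ 0 := by
  rw [eta23_eq]
  exact mul_ne_zero (e_ne_zero _) (euler23_ne_zero (norm_e_lt_one hw))

lemma euler23_mul_euler23_neg {x : ℂ} (hx : ‖x‖ < 1) :
    euler23 x * euler23 (-x) * euler23 (x ^ 4) = euler23 (x ^ 2) ^ 3 := by
  have h := eulerProd_mul_eulerProd_neg hx
  have h_pow := eulerProd_mul_eulerProd_neg (norm_pow_lt_one hx (n := 23) (by norm_num))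
  simp only [euler23, Odd.neg_pow (by decide : Odd 23), ← pow_mul] at h_pow ⊢
  norm_num only at h_pow ⊢
  linear_combination (eulerProd (x ^ 23) * eulerProd (-x ^ 23) * eulerProd (x ^ 92)) * h +
    eulerProd (x ^ 2) ^ 3 * h_pow

lemma hasDerivAt_euler23_zero : HasDerivAt euler23 (-1) 0 := by
  have hpow : HasDerivAt (fun x : ℂ => eulerProd (x ^ 23)) (-1 * ((23 : ℕ) * 0 ^ 22)) 0 := by
    refine HasDerivAt.comp (h₂ := eulerProd) 0 ?_ (hasDerivAt_pow 23 (0 : ℂ))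
    simpa using hasDerivAt_eulerProd_zero
  simpa [eulerProd_zero] using! hasDerivAt_eulerProd_zero.mul hpow

lemma euler23_zero : euler23 0 = 1 := by simp [euler23, eulerProd_zero]

lemma eta23_add_one (w : ℂ) : eta23 (w + 1) = eta23 w := by
  rw [eta23_eq, eta23_eq, e_eq_of_eq_add_intCast 1 (by rw [Int.cast_one])]

lemma ofNat_mul_im_pos {k : ℕ} [k.AtLeastTwo] {w : ℂ} (hw : 0 < w.im) :
    0 < ((ofNat(k) : ℂ) * w).im :=
  natCast_mul_im_pos (Nat.pos_of_neZero k) hw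

lemma half_im_pos {w : ℂ} (hw : 0 < w.im) : 0 < (w / 2).im := by simpa using hw

lemma add_one_half_im_pos {w : ℂ} (hw : 0 < w.im) : 0 < ((w + 1) / 2).im := by simpa using hw

lemma eta23_fricke {w : ℂ} (hw : 0 < w.im) :
    eta23 (-1 / (23 * w)) = Complex.sqrt 23 * (-I * w) * eta23 w := by
  have hw0 := ne_zero_of_im_pos hw
  have hcancel : 23 * (-1 / (23 * w)) = -1 / w := by field_simp
  rw [eta23, eta23, hcancel, eta_neg_one_div hw, eta_neg_one_div (ofNat_mul_im_pos hw),
    mul_left_comm (-I) 23 w, sqrt_mul_of_re_pos (by norm_num) (by rwa [neg_I_mul_re])]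
  linear_combination (Complex.sqrt 23 * ModularForm.eta (23 * w) * ModularForm.eta w) *
    sqrt_sq (-I * w)

/-- The quotient `η(2w) η(46w) / (η(w) η(23w))`, a modular function for `Γ₀(46)`, and its two
conjugates over `Γ₀(23)`. -/
noncomputable def etaRatio23 : Fin 3 → ℂ → ℂ :=
  ![fun w => eta23 (2 * w) / eta23 w, fun w => eta23 (w / 2) / (2 * eta23 w),
    fun w => eta23 ((w + 1) / 2) / (2 * eta23 w)]

lemma etaRatio23_zero (w : ℂ) : etaRatio23 0 w = eta23 (2 * w) / eta23 w := rfl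

lemma etaRatio23_one (w : ℂ) : etaRatio23 1 w = eta23 (w / 2) / (2 * eta23 w) := rfl

lemma etaRatio23_two (w : ℂ) : etaRatio23 2 w = eta23 ((w + 1) / 2) / (2 * eta23 w) := rfl

lemma eta23_eq_half (w : ℂ) : eta23 w = e (w / 2) ^ 2 * euler23 (e (w / 2) ^ 2) := by
  have hsq : e w = e (w / 2) ^ 2 := by rw [← e_natCast_mul]; congr 1; push_cast; ring
  rw [eta23_eq, hsq]

lemma etaRatio23_zero_eq (w : ℂ) :
    etaRatio23 0 w = e (w / 2) ^ 2 * euler23 (e (w / 2) ^ 4) / euler23 (e (w / 2) ^ 2) := by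
  have hpow : e (2 * w) = e (w / 2) ^ 4 := by rw [← e_natCast_mul]; congr 1; push_cast; ring
  have hne := e_ne_zero (w / 2)
  rw [etaRatio23_zero, eta23_eq, eta23_eq_half w, hpow]
  field_simp

lemma etaRatio23_one_eq (w : ℂ) :
    etaRatio23 1 w = euler23 (e (w / 2)) / (2 * (e (w / 2) * euler23 (e (w / 2) ^ 2))) := by
  have hne := e_ne_zero (w / 2)
  rw [etaRatio23_one, eta23_eq, eta23_eq_half w]
  field_simp

lemma etaRatio23_two_eq (w : ℂ) :
    etaRatio23 2 w = -euler23 (-e (w / 2)) / (2 * (e (w / 2) * euler23 (e (w / 2) ^ 2))) := by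
  have hne := e_ne_zero (w / 2)
  have hneg : e ((w + 1) / 2) = -e (w / 2) := by rw [add_div, e_add, e_half]; ring
  rw [etaRatio23_two, eta23_eq, eta23_eq_half w, hneg]
  field_simp

lemma etaRatio23_ne_zero {w : ℂ} (hw : 0 < w.im) (i : Fin 3) : etaRatio23 i w ≠ 0 := by
  have hden := eta23_ne_zero hw
  fin_cases i
  · exact div_ne_zero (eta23_ne_zero (ofNat_mul_im_pos hw)) hden
  · exact div_ne_zero (eta23_ne_zero (half_im_pos hw)) (mul_ne_zero two_ne_zero hden)
  · exact div_ne_zero (eta23_ne_zero (add_one_half_im_pos hw)) (mul_ne_zero two_ne_zero hden)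

lemma etaRatio23_mul {w : ℂ} (hw : 0 < w.im) :
    etaRatio23 0 w * etaRatio23 1 w * etaRatio23 2 w = -1 / 4 := by
  have hs := norm_e_lt_one (half_im_pos hw)
  have hs0 := e_ne_zero (w / 2)
  have heuler := euler23_ne_zero (norm_pow_lt_one hs two_ne_zero)
  rw [etaRatio23_zero_eq, etaRatio23_one_eq, etaRatio23_two_eq]
  field_simp
  linear_combination -4 * euler23_mul_euler23_neg hs

lemma etaRatio23_two_eq_div {w : ℂ} (hw : 0 < w.im) :
    etaRatio23 2 w = -1 / 4 / (etaRatio23 0 w * etaRatio23 1 w) := by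
  rw [eq_div_iff (mul_ne_zero (etaRatio23_ne_zero hw 0) (etaRatio23_ne_zero hw 1)), mul_comm,
    etaRatio23_mul hw]

lemma etaRatio23_zero_add_one (w : ℂ) : etaRatio23 0 (w + 1) = etaRatio23 0 w := by
  rw [etaRatio23_zero, etaRatio23_zero, mul_add, mul_one, ← one_add_one_eq_two, ← add_assoc,
    eta23_add_one, eta23_add_one, eta23_add_one]

lemma etaRatio23_one_add_one (w : ℂ) : etaRatio23 1 (w + 1) = etaRatio23 2 w := by
  rw [etaRatio23_one, etaRatio23_two, eta23_add_one]

lemma etaRatio23_two_add_one (w : ℂ) : etaRatio23 2 (w + 1) = etaRatio23 1 w := by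
  have hhalf : (w + 1 + 1) / 2 = w / 2 + 1 := by ring
  rw [etaRatio23_two, etaRatio23_one, hhalf, eta23_add_one, eta23_add_one]

lemma etaRatio23_zero_fricke (τ : ℍ) :
    etaRatio23 0 (fricke 23 (by norm_num) τ) = etaRatio23 1 τ := by
  have hτ := τ.ne_zero
  have hdouble : 2 * (-1 / (23 * (τ : ℂ))) = -1 / (23 * (τ / 2)) := by field_simp
  have hsqrt : Complex.sqrt 23 ≠ 0 := sqrt_ne_zero (by norm_num)
  have hI := I_ne_zero
  have hden := eta23_ne_zero τ.im_pos
  rw [etaRatio23_zero, etaRatio23_one, coe_fricke, Nat.cast_ofNat, hdouble, eta23_fricke τ.im_pos,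
    eta23_fricke (half_im_pos τ.im_pos)]
  field_simp

lemma etaRatio23_one_fricke (τ : ℍ) :
    etaRatio23 1 (fricke 23 (by norm_num) τ) = etaRatio23 0 τ := by
  rw [← etaRatio23_zero_fricke, fricke_fricke]

lemma etaRatio23_two_fricke (τ : ℍ) :
    etaRatio23 2 (fricke 23 (by norm_num) τ) = etaRatio23 2 τ := by
  rw [etaRatio23_two_eq_div (UpperHalfPlane.im_pos _), etaRatio23_two_eq_div τ.im_pos,
    etaRatio23_zero_fricke, etaRatio23_one_fricke, mul_comm]

lemma newmanCriterion_etaRatio23 :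
    NewmanCriterion 46 1 0 [(2, 1), (46, 1), (1, -1), (23, -1)] := by
  decide +kernel

lemma etaRatio23_zero_smul {γ : SL(2, ℤ)} (hγ : γ ∈ Gamma0 46) (τ : ℍ) :
    etaRatio23 0 (γ • τ : ℍ) = etaRatio23 0 τ := by
  have hetaQuot (w : ℂ) :
      etaRatio23 0 w = etaQuot [(2, 1), (46, 1), (1, -1), (23, -1)] w := by
    have hmul : (23 : ℂ) * (2 * w) = 46 * w := by ring
    simp only [Fin.isValue, etaRatio23_zero, eta23, hmul, div_eq_mul_inv, mul_inv_rev, etaQuot,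
      Int.reduceNeg, List.map_cons, Nat.cast_ofNat, zpow_ofNat, pow_one, Nat.cast_one, one_mul,
      zpow_neg, List.map_nil, List.prod_cons, List.prod_nil, mul_one]
    ring
  have hmultiplier := e_mul_div_of_dvd (n := 46) (by norm_num) (mem_Gamma0_iff.1 hγ) (γ 1 1)
  have hlaw := newmanCriterion_etaRatio23.etaQuot_smul (det_eq_one γ) (mem_Gamma0_iff.1 hγ)
    τ.im_pos
  rw [hetaQuot, coe_smul_eq_div_denom, hetaQuot]
  refine hlaw.trans ?_
  rw [Nat.cast_one, mul_one, hmultiplier, one_mul, mul_zero, zpow_zero, one_mul]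

lemma etaRatio23_one_smul {γ : SL(2, ℤ)} (hγ : γ ∈ Gamma0 46) (hb : Even (γ 0 1)) (τ : ℍ) :
    etaRatio23 1 (γ • τ : ℍ) = etaRatio23 1 τ := by
  obtain ⟨c, hc⟩ := mem_Gamma0_iff.1 hγ
  obtain ⟨b, hb⟩ := hb
  let γ' : SL(2, ℤ) := ⟨!![γ 1 1, -(2 * c); -(23 * γ 0 1), γ 0 0], by
    rw [Matrix.det_fin_two_of]; linear_combination det_eq_one γ + γ 0 1 * hc⟩
  have hγ' : γ' ∈ Gamma0 46 := mem_Gamma0_iff.2 ⟨-b, by simp [γ', hb]; ring⟩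
  have hconj : fricke 23 (by norm_num) (γ • τ) = γ' • fricke 23 (by norm_num) τ := by
    refine fricke_smul _ ?_ τ
    ext i j
    fin_cases i <;> fin_cases j <;> simp [γ', Matrix.mul_apply, hc, mul_comm]
    ring
  rw [← etaRatio23_zero_fricke, hconj, etaRatio23_zero_smul hγ', etaRatio23_zero_fricke]

lemma etaRatio23_smul {γ : SL(2, ℤ)} (hγ : γ ∈ Gamma0 46) (hb : Even (γ 0 1)) (τ : ℍ)
    (i : Fin 3) : etaRatio23 i (γ • τ : ℍ) = etaRatio23 i τ := by
  have hzero := etaRatio23_zero_smul hγ τ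
  have hone := etaRatio23_one_smul hγ hb τ
  fin_cases i
  · exact hzero
  · exact hone
  · change etaRatio23 2 _ = etaRatio23 2 _
    rw [etaRatio23_two_eq_div τ.im_pos, etaRatio23_two_eq_div (UpperHalfPlane.im_pos _), hzero,
      hone]

/-- The values of `η(2w) η(46w) / (η(w) η(23w))` and its conjugates, as a multiset because `Γ₀(23)`
permutes them. -/
noncomputable def etaRatios23 (τ : ℍ) : Multiset ℂ :=
  {etaRatio23 0 τ, etaRatio23 1 τ, etaRatio23 2 τ}

lemma etaRatios23_fricke (τ : ℍ) : etaRatios23 (fricke 23 (by norm_num) τ) = etaRatios23 τ := by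
  rw [etaRatios23, etaRatio23_zero_fricke, etaRatio23_one_fricke, etaRatio23_two_fricke,
    etaRatios23]
  exact Multiset.cons_swap _ _ _

lemma Gamma0_le_invarianceSubgroup_etaRatios23 : Gamma0 23 ≤ invarianceSubgroup etaRatios23 := by
  have hT : T ∈ invarianceSubgroup etaRatios23 := fun τ => by
    rw [etaRatios23, coe_T_smul, etaRatio23_zero_add_one, etaRatio23_one_add_one,
      etaRatio23_two_add_one, etaRatios23]
    exact congrArg _ (Multiset.cons_swap _ _ _)
  refine Gamma0_le_of_mem hT (lowerUnipotent_mem_invarianceSubgroup _ etaRatios23_fricke hT)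
    fun γ hγ hb τ => ?_
  simp only [etaRatios23, etaRatio23_smul hγ hb]

lemma tendsto_e_half : Tendsto (fun τ : ℍ => e ((τ : ℂ) / 2)) atImInfty (𝓝[≠] 0) := by
  refine tendsto_nhdsWithin_iff.2 ⟨?_, Eventually.of_forall fun τ => e_ne_zero _⟩
  rw [tendsto_zero_iff_norm_tendsto_zero]
  have hnorm (τ : ℍ) : ‖e ((τ : ℂ) / 2)‖ = Real.exp (-(π * τ.im)) := by
    rw [norm_e, Complex.div_ofNat_im, coe_im]
    congr 1
    ring
  simp only [hnorm]
  exact Real.tendsto_exp_neg_atTop_nhds_zero.comp (tendsto_comap.const_mul_atTop Real.pi_pos)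

lemma tendsto_euler23_pow {n : ℕ} (hn : n ≠ 0) :
    Tendsto (fun s : ℂ => euler23 (s ^ n)) (𝓝[≠] 0) (𝓝 1) := by
  have hcont : ContinuousAt euler23 ((0 : ℂ) ^ n) := by
    rw [zero_pow hn]; exact hasDerivAt_euler23_zero.continuousAt
  have hcomp : ContinuousAt (fun s : ℂ => euler23 (s ^ n)) 0 :=
    ContinuousAt.comp (f := fun s : ℂ => s ^ n) hcont (continuous_pow n).continuousAt
  simpa [ContinuousAt, hn, euler23_zero] using! hcomp.tendsto.mono_left nhdsWithin_le_nhds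

lemma tendsto_euler23_sub_euler23_neg_div :
    Tendsto (fun s : ℂ => (euler23 s - euler23 (-s)) / s) (𝓝[≠] 0) (𝓝 (-2)) := by
  have hneg : HasDerivAt (fun s => euler23 (-s)) 1 0 := by
    have hderiv : HasDerivAt euler23 (-1) (-0) := by simpa using hasDerivAt_euler23_zero
    simpa using! HasDerivAt.comp (h₂ := euler23) 0 hderiv (hasDerivAt_neg 0)
  have hslope := (hasDerivAt_euler23_zero.sub hneg).tendsto_slope_zero
  have hval : (-1 : ℂ) - 1 = -2 := by norm_num
  simpa only [div_eq_inv_mul, zero_add, Pi.sub_apply, neg_zero, sub_self, sub_zero, smul_eq_mul,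
    hval] using hslope

lemma tendsto_sum_etaRatios23 : Tendsto (fun τ => (etaRatios23 τ).sum) atImInfty (𝓝 (-1)) := by
  have hsq : Tendsto (fun s : ℂ => s ^ 2) (𝓝[≠] 0) (𝓝 0) := by
    simpa using ((continuous_pow (M := ℂ) 2).tendsto 0).mono_left nhdsWithin_le_nhds
  have htwo := tendsto_euler23_pow two_ne_zero
  have hlim := (((hsq.mul (tendsto_euler23_pow four_ne_zero)).div htwo one_ne_zero).add
    (tendsto_euler23_sub_euler23_neg_div.div (htwo.const_mul 2) (by norm_num))).comp tendsto_e_half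
  have hval : (0 * 1 / 1 + -2 / (2 * 1) : ℂ) = -1 := by norm_num
  rw [hval] at hlim
  refine hlim.congr fun τ => ?_
  have heuler :=
    euler23_ne_zero (norm_pow_lt_one (norm_e_lt_one (half_im_pos τ.im_pos)) two_ne_zero)
  have hne := e_ne_zero ((τ : ℂ) / 2)
  simp only [etaRatios23, Multiset.insert_eq_cons, Multiset.sum_cons, Multiset.sum_singleton,
    etaRatio23_zero_eq, etaRatio23_one_eq, etaRatio23_two_eq, Function.comp_apply, Pi.div_apply]
  field_simp
  ring

lemma differentiableOn_eta23 : DifferentiableOn ℂ eta23 {w | 0 < w.im} := fun _ hw =>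
  ((ModularForm.differentiableAt_eta_of_mem_upperHalfPlaneSet hw).mul
    ((ModularForm.differentiableAt_eta_of_mem_upperHalfPlaneSet (ofNat_mul_im_pos hw)).comp _
      (differentiableAt_id.const_mul (23 : ℂ)))).differentiableWithinAt

lemma differentiableOn_etaRatio23 (i : Fin 3) :
    DifferentiableOn ℂ (etaRatio23 i) {w | 0 < w.im} := by
  have hden := differentiableOn_eta23
  have hden_ne : ∀ w ∈ {w : ℂ | 0 < w.im}, eta23 w ≠ 0 := fun w hw => eta23_ne_zero hw
  have htwo_ne : ∀ w ∈ {w : ℂ | 0 < w.im}, 2 * eta23 w ≠ 0 :=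
    fun w hw => mul_ne_zero two_ne_zero (hden_ne w hw)
  fin_cases i
  · exact differentiableOn_fun_div (hden.comp (differentiableOn_id.const_mul (2 : ℂ))
      fun w hw => ofNat_mul_im_pos hw) hden hden_ne
  · exact differentiableOn_fun_div (hden.comp (differentiableOn_id.div_const (2 : ℂ))
      fun w hw => half_im_pos hw) (hden.const_mul 2) htwo_ne
  · exact differentiableOn_fun_div (hden.comp
      ((differentiableOn_id.add_const (1 : ℂ)).div_const (2 : ℂ))
      fun w hw => add_one_half_im_pos hw) (hden.const_mul 2) htwo_ne

theorem sum_etaRatios23 (τ : ℍ) : (etaRatios23 τ).sum = -1 := by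
  refine eq_of_tendsto_of_fricke_invariant (p := 23) (f := fun τ => (etaRatios23 τ).sum)
    (by norm_num) ?_
    (fun γ hγ τ => congrArg _ (Gamma0_le_invarianceSubgroup_etaRatios23 hγ τ))
    (fun τ => congrArg _ (etaRatios23_fricke τ)) tendsto_sum_etaRatios23 τ
  refine ((differentiableOn_etaRatio23 0).fun_add ((differentiableOn_etaRatio23 1).fun_add
    (differentiableOn_etaRatio23 2))).congr fun w hw => ?_
  simp only [etaRatios23, ofComplex_apply_of_im_pos hw, Multiset.insert_eq_cons,
    Multiset.sum_cons, Multiset.sum_singleton]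

lemma eta23_coe (τ : ℍ) : eta23 τ = etaAt 1 τ * etaAt 23 τ := by simp [eta23, etaAt]

lemma eta23_two_mul_coe (τ : ℍ) : eta23 (2 * τ) = etaAt 2 τ * etaAt 46 τ := by
  have hmul : (23 : ℂ) * (2 * τ) = 46 * τ := by ring
  simp [eta23, etaAt, hmul]

lemma f232_eq (τ : ℍ) : f232 τ = 2 * (etaAt 1 τ ^ 2 * etaAt 23 τ ^ 2) *
    (((etaRatios23 τ).map (· ^ 2)).sum - 1) := by
  have hne := etaRatio23_ne_zero τ.im_pos 0
  have hsum : etaRatio23 1 τ + etaRatio23 2 τ = -1 - etaRatio23 0 τ := by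
    have h := sum_etaRatios23 τ
    simp only [etaRatios23, Multiset.insert_eq_cons, Multiset.sum_cons,
      Multiset.sum_singleton] at h
    linear_combination h
  have hprod : etaRatio23 1 τ * etaRatio23 2 τ = -1 / 4 / etaRatio23 0 τ := by
    rw [eq_div_iff hne, ← etaRatio23_mul τ.im_pos]; ring
  have hsq : ((etaRatios23 τ).map (· ^ 2)).sum =
      etaRatio23 0 τ ^ 2 + ((1 + etaRatio23 0 τ) ^ 2 + 1 / 2 / etaRatio23 0 τ) := by
    simp only [etaRatios23, Multiset.insert_eq_cons, Multiset.map_cons, Multiset.map_singleton,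
      Multiset.sum_cons, Multiset.sum_singleton]
    linear_combination (etaRatio23 1 τ + etaRatio23 2 τ - 1 - etaRatio23 0 τ) * hsum - 2 * hprod
  have h₁ := etaAt_ne_zero one_pos τ
  have h₂ := etaAt_ne_zero two_pos τ
  have h₂₃ := etaAt_ne_zero (k := 23) (by norm_num) τ
  have h₄₆ := etaAt_ne_zero (k := 46) (by norm_num) τ
  rw [hsq, etaRatio23_zero, eta23_coe, eta23_two_mul_coe, f232]
  field_simp
  ring

end LevelTwentyThree

/-! ### The forms `T̃_g` -/

section TildeT

open CongruenceSubgroup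

namespace IsTwistedForm

variable {n h : ℕ} {f f' : ℍ → ℂ}

lemma neg (hf : IsTwistedForm n h f) : IsTwistedForm n h (-f) := by
  simpa using hf.const_smul (-1)

lemma sub (hf : IsTwistedForm n h f) (hf' : IsTwistedForm n h f') :
    IsTwistedForm n h (f - f') := by
  simpa only [sub_eq_add_neg] using hf.add hf'.neg

lemma div_const (hf : IsTwistedForm n h f) (a : ℂ) : IsTwistedForm n h fun τ => f τ / a := by
  simp only [div_eq_inv_mul]
  exact hf.const_smul a⁻¹

lemma of_eq_etaQuot (a : ℂ) (l : List (ℕ × ℤ))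
    (hl : NewmanCriterion n h 1 l := by decide +kernel)
    (hord : ∀ t ∈ n.divisors, 0 ≤ cuspOrder n l t := by decide +kernel)
    (hf : ∀ τ, f τ = a * (l.map fun p => etaAt p.1 τ ^ p.2).prod :=
      by simp [zpow_ofNat, div_eq_mul_inv, mul_assoc]) : IsTwistedForm n h f := by
  rw [funext hf]
  exact (hl.isTwistedForm hord).const_smul a

lemma of_cycleShape_eq {g : Equiv.Perm (Fin 24)} {s : Multiset ℕ} (hf : IsTwistedForm n h f)
    (hg : cycleShape g = s) (hn : s.sup = n) (hh : h ∈ s) (hle : ∀ i ∈ s, h ≤ i) :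
    IsTwistedForm (longest g) (shortest g) f := by
  have hshortest : shortest g = h := by
    rw [shortest, hg]
    exact IsLeast.csInf_eq ⟨hh, hle⟩
  rwa [longest, hg, hn, hshortest]

lemma ite_cycleShape {g : Equiv.Perm (Fin 24)} {s : Multiset ℕ} [Decidable (cycleShape g = s)]
    (hf : IsTwistedForm n h f) (hf' : IsTwistedForm (longest g) (shortest g) f')
    (hs : s.sup = n ∧ h ∈ s ∧ ∀ i ∈ s, h ≤ i := by decide) :
    IsTwistedForm (longest g) (shortest g)
      fun τ => if cycleShape g = s then f τ else f' τ := by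
  by_cases hg : cycleShape g = s
  · simpa only [hg, if_true] using hf.of_cycleShape_eq hg hs.1 hs.2.1 hs.2.2
  · simpa only [hg, if_false] using hf'

end IsTwistedForm

lemma isTwistedForm_f231 : IsTwistedForm 23 1 fun τ => etaAt 1 τ ^ 2 * etaAt 23 τ ^ 2 :=
  .of_eq_etaQuot 1 [(1, 2), (23, 2)]

lemma isTwistedForm_f232_two_mul : IsTwistedForm 46 1 f232 := by
  change IsTwistedForm 46 1 fun τ =>
    etaAt 1 τ ^ 3 * etaAt 23 τ ^ 3 / (etaAt 2 τ * etaAt 46 τ)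
      + 4 * etaAt 1 τ * etaAt 2 τ * etaAt 23 τ * etaAt 46 τ
      + 4 * etaAt 2 τ ^ 2 * etaAt 46 τ ^ 2
  exact ((IsTwistedForm.of_eq_etaQuot 1 [(1, 3), (23, 3), (46, -1), (2, -1)]).add
    (.of_eq_etaQuot 4 [(1, 1), (2, 1), (23, 1), (46, 1)])).add
    (.of_eq_etaQuot 4 [(2, 2), (46, 2)])

theorem isTwistedForm_f232 : IsTwistedForm 23 1 f232 where
  differentiableOn := isTwistedForm_f232_two_mul.differentiableOn
  slash_eq γ hγ := by
    funext τ
    have hslash := congrFun (isTwistedForm_f231.slash_eq γ hγ) τ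
    rw [ModularForm.SL_slash_apply, Pi.smul_apply, smul_eq_mul] at hslash
    rw [ModularForm.SL_slash_apply, Pi.smul_apply, smul_eq_mul, f232_eq, f232_eq τ,
      Gamma0_le_invarianceSubgroup_etaRatios23 hγ]
    linear_combination (2 * (((etaRatios23 τ).map (· ^ 2)).sum - 1)) * hslash
  isBoundedAtImInfty_slash := isTwistedForm_f232_two_mul.isBoundedAtImInfty_slash

lemma isTwistedForm_Lam_eleven_sub :
    IsTwistedForm 11 1 fun τ => 2 * (Lam 11 τ - 11 * etaAt 1 τ ^ 2 * etaAt 11 τ ^ 2) / 5 :=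
  (((isTwistedForm_Lam 11).sub (.of_eq_etaQuot 11 [(1, 2), (11, 2)])).const_smul 2).div_const 5

lemma isTwistedForm_Lam_fourteen_sub :
    IsTwistedForm 14 1 fun τ => (-Lam 2 τ - Lam 7 τ + Lam 14 τ -
      14 * etaAt 1 τ * etaAt 2 τ * etaAt 7 τ * etaAt 14 τ) / 3 :=
  ((((isTwistedForm_Lam 2).neg.sub (isTwistedForm_Lam 7)).add (isTwistedForm_Lam 14)).sub
    (.of_eq_etaQuot 14 [(1, 1), (2, 1), (7, 1), (14, 1)])).div_const 3

lemma isTwistedForm_Lam_fifteen_sub :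
    IsTwistedForm 15 1 fun τ => (-Lam 3 τ - Lam 5 τ + Lam 15 τ -
      15 * etaAt 1 τ * etaAt 3 τ * etaAt 5 τ * etaAt 15 τ) / 4 :=
  ((((isTwistedForm_Lam 3).neg.sub (isTwistedForm_Lam 5)).add (isTwistedForm_Lam 15)).sub
    (.of_eq_etaQuot 15 [(1, 1), (3, 1), (5, 1), (15, 1)])).div_const 4

lemma isTwistedForm_etaQuot_sub_twentyone :
    IsTwistedForm 21 3 fun τ => (7 * etaAt 1 τ ^ 3 * etaAt 7 τ ^ 3 / (etaAt 3 τ * etaAt 21 τ) -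
      etaAt 1 τ ^ 6 / etaAt 3 τ ^ 2) / 3 :=
  ((IsTwistedForm.of_eq_etaQuot 7 [(1, 3), (7, 3), (21, -1), (3, -1)]).sub
    (.of_eq_etaQuot 1 [(1, 6), (3, -2)])).div_const 3

lemma isTwistedForm_Lam_twentythree_sub_add :
    IsTwistedForm 23 1 fun τ =>
      (Lam 23 τ - 23 * (etaAt 1 τ ^ 2 * etaAt 23 τ ^ 2) + 23 * f232 τ) / 11 :=
  (((isTwistedForm_Lam 23).sub (isTwistedForm_f231.const_smul 23)).add
    (isTwistedForm_f232.const_smul 23)).div_const 11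

theorem isTwistedForm_tildeT (g : Equiv.Perm (Fin 24)) :
    IsTwistedForm (longest g) (shortest g) (tildeT g) := by
  change IsTwistedForm _ _ fun τ => tildeT g τ
  simp only [tildeT]
  refine .ite_cycleShape (n := 1) (h := 1) .zero ?_
  refine .ite_cycleShape (n := 2) (h := 1) ((isTwistedForm_Lam 2).const_smul 16) ?_
  refine .ite_cycleShape (n := 2) (h := 2) (.of_eq_etaQuot 2 [(1, 8), (2, -4)]) ?_
  refine .ite_cycleShape (n := 3) (h := 1) ((isTwistedForm_Lam 3).const_smul 6) ?_
  refine .ite_cycleShape (n := 3) (h := 3) (.of_eq_etaQuot 2 [(1, 6), (3, -2)]) ?_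
  refine .ite_cycleShape (n := 4) (h := 2) (.of_eq_etaQuot 2 [(2, 8), (4, -4)]) ?_
  refine .ite_cycleShape (n := 4) (h := 1)
    (((isTwistedForm_Lam 2).neg.add (isTwistedForm_Lam 4)).const_smul 4) ?_
  refine .ite_cycleShape (n := 4) (h := 4) (.of_eq_etaQuot 2 [(1, 4), (2, 2), (4, -2)]) ?_
  refine .ite_cycleShape (n := 5) (h := 1) ((isTwistedForm_Lam 5).const_smul 2) ?_
  refine .ite_cycleShape (n := 6) (h := 1)
    ((((isTwistedForm_Lam 2).neg.sub (isTwistedForm_Lam 3)).add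
      (isTwistedForm_Lam 6)).const_smul 2) ?_
  refine .ite_cycleShape (n := 6) (h := 6)
    (.of_eq_etaQuot 2 [(1, 2), (2, 2), (3, 2), (6, -2)]) ?_
  refine .ite_cycleShape (n := 7) (h := 1) (isTwistedForm_Lam 7) ?_
  refine .ite_cycleShape (n := 8) (h := 1)
    ((isTwistedForm_Lam 4).neg.add (isTwistedForm_Lam 8)) ?_
  refine .ite_cycleShape (n := 10) (h := 2)
    (.of_eq_etaQuot 2 [(1, 3), (2, 1), (5, 1), (10, -1)]) ?_
  refine .ite_cycleShape isTwistedForm_Lam_eleven_sub ?_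
  refine .ite_cycleShape (n := 12) (h := 2)
    (.of_eq_etaQuot 2 [(1, 3), (4, 2), (6, 3), (12, -2), (3, -1), (2, -1)]) ?_
  refine .ite_cycleShape (n := 12) (h := 12)
    (.of_eq_etaQuot 2 [(1, 4), (4, 1), (6, 1), (12, -1), (2, -1)]) ?_
  refine .ite_cycleShape isTwistedForm_Lam_fourteen_sub ?_
  refine .ite_cycleShape isTwistedForm_Lam_fifteen_sub ?_
  refine .ite_cycleShape isTwistedForm_etaQuot_sub_twentyone ?_
  exact .ite_cycleShape isTwistedForm_Lam_twentythree_sub_add .zero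

end TildeT

/-! ### Weak Jacobi forms from twisted forms -/

section WeakJacobiForm

open CongruenceSubgroup

variable {n h : ℕ} {f : ℍ → ℂ}

lemma IsWeakJacobiForm.mono {N N' : ℕ} {w t : ℤ} {φ : ℍ → ℂ → ℂ} (hφ : IsWeakJacobiForm N w t φ)
    (hN : N ∣ N') : IsWeakJacobiForm N' w t φ where
  holo := hφ.holo
  modular γ hγ := hφ.modular γ
    (mem_Gamma0_iff.2 ((Int.natCast_dvd_natCast.2 hN).trans (mem_Gamma0_iff.1 hγ)))
  elliptic := hφ.elliptic
  fourier := hφ.fourier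
  cusps := hφ.cusps

/-- The combination `c φ_{0,1} + f φ_{-2,1}`, which has weight `0` and index `1` if `f` has
weight `2`. -/
noncomputable def jacobiComb (c : ℂ) (f : ℍ → ℂ) (τ : ℍ) (z : ℂ) : ℂ :=
  c * phi01 τ z + f τ * phi21 τ z

lemma jacobiSlash_jacobiComb (c : ℂ) (f : ℍ → ℂ) (γ : SL(2, ℤ)) :
    jacobiSlash 0 1 (jacobiComb c f) γ = jacobiComb c (f ∣[(2 : ℤ)] γ) := by
  funext τ z
  have hphi01 := congrFun₂ (jacobiSlash_phi01 γ) τ z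
  have hphi21 := congrFun₂ (jacobiSlash_phi21 γ) τ z
  have hdenom := denom_ne_zero γ τ
  rw [jacobiSlash_apply] at hphi01 hphi21
  rw [jacobiSlash_apply, jacobiComb, jacobiComb, ModularForm.SL_slash_apply, ← hphi01, ← hphi21,
    neg_neg, neg_zero, zpow_zero, zpow_neg]
  field_simp

lemma e_eq_one_of_mul_dvd (hnh : 0 < n * h) {γ : SL(2, ℤ)} (hγ : ((n * h : ℕ) : ℤ) ∣ γ 1 0) :
    e ((γ 1 0 : ℂ) * (γ 1 1 : ℂ) / (n * h)) = 1 := by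
  rw [← Nat.cast_mul, e_mul_div_of_dvd hnh hγ]

lemma rho_eq_one (hnh : 0 < n * h) {γ : SL(2, ℤ)} (hγ : ((n * h : ℕ) : ℤ) ∣ γ 1 0) :
    rho n h γ = 1 := by
  rw [rho, e_neg, e_eq_one_of_mul_dvd hnh hγ, inv_one]

lemma slash_T_pow_apply (k : ℤ) (f : ℍ → ℂ) (M : ℕ) (τ : ℍ) :
    (f ∣[k] (ModularGroup.T ^ M)) τ = f (ModularGroup.T ^ M • τ) := by
  have hdenom : denom (ModularGroup.T ^ M : SL(2, ℤ)) τ = 1 := by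
    rw [ModularGroup.denom_apply, ← zpow_natCast, ModularGroup.coe_T_zpow]
    simp
  rw [ModularForm.SL_slash_apply, hdenom, one_zpow, mul_one]

lemma conj_T_pow_apply_one_zero (γ : SL(2, ℤ)) (M : ℕ) :
    (γ * ModularGroup.T ^ M * γ⁻¹) 1 0 = -(M * γ 1 0 * γ 1 0) := by
  simp only [Matrix.SpecialLinearGroup.coe_mul, Matrix.SpecialLinearGroup.coe_inv,
    Matrix.adjugate_fin_two, ← zpow_natCast, ModularGroup.coe_T_zpow]
  simp only [Fin.isValue, Matrix.mul_apply, Matrix.of_apply, Matrix.cons_val',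
    Matrix.cons_val_fin_one, Fin.sum_univ_two, Matrix.cons_val_zero, Matrix.cons_val_one, mul_one,
    mul_zero, add_zero, mul_neg]
  ring

namespace IsTwistedForm

lemma slash_eq_self (hf : IsTwistedForm n h f) (hnh : 0 < n * h) {γ : SL(2, ℤ)}
    (hγ : ((n * h : ℕ) : ℤ) ∣ γ 1 0) : f ∣[(2 : ℤ)] γ = f := by
  have hmem : γ ∈ Gamma0 n :=
    mem_Gamma0_iff.2 ((Int.natCast_dvd_natCast.2 (dvd_mul_right n h)).trans hγ)
  rw [hf.slash_eq γ hmem, e_eq_one_of_mul_dvd hnh hγ, one_smul]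

lemma slash_apply_T_pow_smul (hf : IsTwistedForm n h f) (hnh : 0 < n * h) (γ : SL(2, ℤ)) {M : ℕ}
    (hM : ((n * h : ℕ) : ℤ) ∣ M * γ 1 0) (τ : ℍ) :
    (f ∣[(2 : ℤ)] γ) (ModularGroup.T ^ M • τ) = (f ∣[(2 : ℤ)] γ) τ := by
  have hconj : f ∣[(2 : ℤ)] (γ * ModularGroup.T ^ M * γ⁻¹) = f :=
    hf.slash_eq_self hnh (by
      rw [conj_T_pow_apply_one_zero]
      exact (hM.mul_right _).neg_right)
  rw [← slash_T_pow_apply 2 (f ∣[(2 : ℤ)] γ), ← SlashAction.slash_mul,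
    ← inv_mul_cancel_right (γ * ModularGroup.T ^ M) γ, SlashAction.slash_mul, hconj]

lemma hasWeakFourierExpansion_slash (hf : IsTwistedForm n h f) (hnh : 0 < n * h) (γ : SL(2, ℤ))
    {M : ℕ} (hM0 : 0 < M) (hM : ((n * h : ℕ) : ℤ) ∣ M * γ 1 0) :
    HasWeakFourierExpansion M fun τ _ => (f ∣[(2 : ℤ)] γ) τ :=
  hasWeakFourierExpansion_of_isBoundedAtImInfty hM0
    (mdifferentiable_iff.1 ((mdifferentiable_iff.2 hf.differentiableOn).slash 2 γ))
    (hf.slash_apply_T_pow_smul hnh γ hM) (hf.isBoundedAtImInfty_slash γ)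

lemma hasWeakFourierExpansion_jacobiSlash (hf : IsTwistedForm n h f) (hnh : 0 < n * h) (c : ℂ)
    (γ : SL(2, ℤ)) {M : ℕ} (hM0 : 0 < M) (hM : ((n * h : ℕ) : ℤ) ∣ M * γ 1 0) :
    HasWeakFourierExpansion M (jacobiSlash 0 1 (jacobiComb c f) γ) := by
  have hphi01 := hasWeakFourierExpansion_phi01.mul_level hM0
  have hphi21 := hasWeakFourierExpansion_phi21.mul_level hM0
  rw [one_mul] at hphi01 hphi21
  rw [jacobiSlash_jacobiComb]
  exact (hphi01.const_mul c).add ((hf.hasWeakFourierExpansion_slash hnh γ hM0 hM).mul hphi21)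

theorem jacobiComb_eq_rho_mul (hf : IsTwistedForm n h f) (hn : 0 < n) {c : ℂ}
    (hc : c ≠ 0 → h = 1) {γ : SL(2, ℤ)} (hγ : γ ∈ Gamma0 n) (τ : ℍ) (z : ℂ) :
    jacobiComb c f τ z = rho n h γ * jacobiSlash 0 1 (jacobiComb c f) γ τ z := by
  have hrho_form : rho n h γ * (f ∣[(2 : ℤ)] γ) τ = f τ := by
    rw [hf.slash_eq γ hγ, Pi.smul_apply, smul_eq_mul, rho, e_neg,
      inv_mul_cancel_left₀ (e_ne_zero _)]
  have hrho_const : rho n h γ * c = c := by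
    by_cases hc0 : c = 0
    · rw [hc0, mul_zero]
    · obtain rfl := hc hc0
      rw [rho_eq_one (by rwa [mul_one]) (by rw [mul_one]; exact mem_Gamma0_iff.1 hγ), one_mul]
  rw [jacobiSlash_jacobiComb, jacobiComb, jacobiComb]
  linear_combination -phi01 τ z * hrho_const - phi21 τ z * hrho_form

theorem isWeakJacobiForm_jacobiComb (hf : IsTwistedForm n h f) (hnh : 0 < n * h) (c : ℂ) :
    IsWeakJacobiForm (n * h) 0 1 (jacobiComb c f) where
  holo := by
    have hform : DifferentiableOn ℂ (fun p : ℂ × ℂ => f (ofComplex p.1)) {p | 0 < p.1.im} :=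
      hf.differentiableOn.comp differentiableOn_fst fun p hp => hp
    exact (differentiableOn_phi01.const_mul c).fun_add (hform.fun_mul differentiableOn_phi21)
  modular γ hγ τ z := by
    rw [jacobiSlash_jacobiComb, hf.slash_eq_self hnh (mem_Gamma0_iff.1 hγ)]
  elliptic lam mu τ z := by
    rw [Int.cast_one, one_mul, jacobiComb, jacobiComb, phi01_elliptic lam mu,
      phi21_elliptic lam mu]
    ring
  fourier := by
    simpa only [jacobiSlash_one] using
      hf.hasWeakFourierExpansion_jacobiSlash hnh c 1 one_pos (by simp)
  cusps γ := ⟨n * h, hnh, hf.hasWeakFourierExpansion_jacobiSlash hnh c γ hnh (dvd_mul_right _ _)⟩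

end IsTwistedForm

end WeakJacobiForm

/-! ### Cycle shapes and levels -/

section CycleShape

variable {g : Equiv.Perm (Fin 24)}

lemma cycleShape_pos {i : ℕ} (hi : i ∈ cycleShape g) : 0 < i :=
  g.partition.parts_pos hi

lemma cycleShape_ne_zero (g : Equiv.Perm (Fin 24)) : cycleShape g ≠ 0 := by
  intro hzero
  have hsum := g.partition.parts_sum
  rw [← cycleShape, hzero] at hsum
  simp at hsum

lemma le_longest {i : ℕ} (hi : i ∈ cycleShape g) : i ≤ longest g :=
  Multiset.le_sup hi

lemma shortest_le {i : ℕ} (hi : i ∈ cycleShape g) : shortest g ≤ i :=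
  Nat.sInf_le hi

lemma shortest_mem (g : Equiv.Perm (Fin 24)) : shortest g ∈ cycleShape g :=
  Nat.sInf_mem (Multiset.exists_mem_of_ne_zero (cycleShape_ne_zero g))

lemma longest_mem (g : Equiv.Perm (Fin 24)) : longest g ∈ cycleShape g := by
  obtain ⟨i, hi, hsup⟩ := Finset.exists_mem_eq_sup (cycleShape g).toFinset
    (Multiset.toFinset_nonempty.2 (cycleShape_ne_zero g)) id
  rw [Finset.sup_def, Multiset.map_id, Multiset.toFinset_val, Multiset.sup_dedup] at hsup
  rw [longest, hsup]
  exact Multiset.mem_toFinset.1 hi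

lemma longest_pos (g : Equiv.Perm (Fin 24)) : 0 < longest g := cycleShape_pos (longest_mem g)

lemma shortest_pos (g : Equiv.Perm (Fin 24)) : 0 < shortest g := cycleShape_pos (shortest_mem g)

lemma IsBalanced.eq_mul {N : ℕ} (hN : IsBalanced g N) : N = longest g * shortest g := by
  obtain ⟨-, hdvd, hmap⟩ := hN
  have hmem : ∀ i ∈ cycleShape g, N / i ∈ cycleShape g := fun i hi => by
    rw [← hmap]
    exact Multiset.mem_map_of_mem (fun i => N / i) hi
  apply le_antisymm
  · rw [← Nat.div_mul_cancel (hdvd _ (shortest_mem g))]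
    exact Nat.mul_le_mul_right _ (le_longest (hmem _ (shortest_mem g)))
  · conv_rhs => rw [← Nat.div_mul_cancel (hdvd _ (longest_mem g)), mul_comm]
    exact Nat.mul_le_mul_left _ (shortest_le (hmem _ (longest_mem g)))

lemma mul_dvd_level (g : Equiv.Perm (Fin 24)) : longest g * shortest g ∣ level g := by
  rcases Set.eq_empty_or_nonempty {N | IsBalanced g N} with hempty | hbalanced
  · -- `sInf ∅ = 0`, so the level of a permutation that is not balanced is `0`.
    rw [level, hempty, Nat.sInf_empty]
    exact dvd_zero _
  · exact (IsBalanced.eq_mul (Nat.sInf_mem hbalanced)).symm.dvd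

lemma one_mem_cycleShape {i : Fin 24} (hi : g i = i) : 1 ∈ cycleShape g := by
  have hsupp : g.support.card < Fintype.card (Fin 24) :=
    Finset.card_lt_univ_of_notMem (Equiv.Perm.notMem_support.2 hi)
  rw [cycleShape, Equiv.Perm.parts_partition, Multiset.mem_add, Multiset.mem_replicate]
  exact .inr ⟨(Nat.sub_pos_of_lt hsupp).ne', rfl⟩

lemma shortest_eq_one_of_chi_ne_zero (hg : chi g ≠ 0) : shortest g = 1 := by
  rw [chi, Matrix.trace_permutation, Nat.cast_ne_zero] at hg
  obtain ⟨i, hi⟩ := Set.nonempty_of_ncard_ne_zero hg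
  exact le_antisymm (shortest_le (one_mem_cycleShape hi)) (shortest_pos g)

end CycleShape

end MathieuMoonshine

theorem mainTheorem2_general (g : Equiv.Perm (Fin 24)) :
    IsWeakJacobiForm (longest g * shortest g) 0 1 (ellGenus g) ∧
      ∀ γ ∈ CongruenceSubgroup.Gamma0 (longest g), ∀ (τ : ℍ) (z : ℂ),
        ellGenus g τ z =
          rho (longest g) (shortest g) γ *
            MathieuMoonshine.e (-((γ 1 0 : ℂ) * z ^ 2 / ((γ 1 0 : ℂ) * τ + (γ 1 1 : ℂ)))) *
            ellGenus g (γ • τ) (z / ((γ 1 0 : ℂ) * τ + (γ 1 1 : ℂ))) := by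
  have hform := isTwistedForm_tildeT g
  have hchi : chi g / 12 ≠ 0 → shortest g = 1 := fun hne =>
    shortest_eq_one_of_chi_ne_zero (div_ne_zero_iff.1 hne).1
  change IsWeakJacobiForm _ 0 1 (jacobiComb (chi g / 12) (tildeT g)) ∧ _
  refine ⟨hform.isWeakJacobiForm_jacobiComb (Nat.mul_pos (longest_pos g) (shortest_pos g)) _,
    fun γ hγ τ z => ?_⟩
  have hrho := hform.jacobiComb_eq_rho_mul (longest_pos g) hchi hγ τ z
  rwa [jacobiSlash, neg_zero, zpow_zero, one_mul, Int.cast_one, one_mul, ← mul_assoc] at hrho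

theorem mainTheorem2 (C : Submodule (ZMod 2) (Fin 24 → ZMod 2)) (hC : IsGolayCode C)
    (g : Equiv.Perm (Fin 24)) (hg : g ∈ mathieu24 C) :
    IsWeakJacobiForm (level g) 0 1 (ellGenus g) ∧
      ∀ γ ∈ CongruenceSubgroup.Gamma0 (longest g), ∀ (τ : ℍ) (z : ℂ),
        ellGenus g τ z =
          rho (longest g) (shortest g) γ *
            MathieuMoonshine.e (-((γ 1 0 : ℂ) * z ^ 2 / ((γ 1 0 : ℂ) * τ + (γ 1 1 : ℂ)))) *
            ellGenus g (γ • τ) (z / ((γ 1 0 : ℂ) * τ + (γ 1 1 : ℂ))) :=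
  ⟨(mainTheorem2_general g).1.mono (mul_dvd_level g), (mainTheorem2_general g).2⟩
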